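/- **Setting.** Let $B_n$ be the braid group on $n$ strands with its Artin generators $\sigma_1,\dots,\sigma_{n-1}$, let $P_n=\ker(B_n\to S_n)$ be the pure braid group, and let $K_n=P_n/Z(P_n)$. Let $F_n$ be the free group of rank $n$. The group $B_4$ acts by conjugation on its normal free subgroup $F_2=\langle a,b\rangle$, where $a=\sigma_1\sigma_3^{-1}$ and $b=\sigma_2\sigma_1\sigma_3^{-1}\sigma_2^{-1}$. For $1\le i\le 4$ let $\Theta_i\colon P_4\to P_3$ be the homomorphism that removes the $i$-th strand. Let $\Psi\colon P_4\to P_3$ be the restriction of the Cardano–Ferrari epimorphism $B_4\to B_3$, $\sigma_1,\sigma_2,\sigma_3\mapsto\sigma_1,\sigma_2,\sigma_1$. For $n\in\{4,5\}$ let $\pi_1(S_{0,n})=\langle x_1,\dots,x_n\mid x_1\cdots x_n=1\rangle$ be the fundamental group of the $n$-punctured sphere, with $x_k$ a loop around the $k$-th puncture. Let $\mathrm{PMod}(S_{0,n})$ be the pure mapping class group, in its algebraic (Dehn–Nielsen–Baer) form: the group of outer automorphisms of $\pi_1(S_{0,n})$ that preserve the conjugacy class of each $x_k$. The point-pushing subgroup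 of $\mathrm{PMod}(S_{0,5})$ (at the fifth puncture) is the kernel of the homomorphism $\mathrm{PMod}(S_{0,5})\to\mathrm{PMod}(S_{0,4})$ that forgets this puncture, i.e. that is induced by setting $x_5=1$. The group $B_4$ acts on $\pi_1(S_{0,5})$ by $\sigma_j\colon x_j\mapsto x_jx_{j+1}x_j^{-1},\ x_{j+1}\mapsto x_j$, fixing the other $x_k$. **Theorem.** The conjugation action induces an injective homomorphism $K_4\to\mathrm{Aut}(F_2)$ whose image has index $48$. The group $K_4$ admits five extensions $$1\to F_3\to K_4\to F_2\to 1$$ that are pairwise inequivalent in the sense that their fibers (the images of $F_3$) are five distinct normal subgroups of $K_4$; moreover any two of these fibers generate $K_4$. They can be described as follows. 1. For a suitable isomorphism $K_3\cong F_2$, the quotient map $K_4\to F_2$ of the $i$-th extension, $1\le i\le4$, is the composition of that isomorphism with the map $K_4\to K_3$ induced by $\Theta_i$; its fiber is the image of $\ker\Theta_i$ in $K_4$. 2. For the same isomorphism, the quotient map of the fifth extension is the composition with the map $K_4\to K_3$ induced by $\Psi$. The image of $\ker\Psi$ in $K_4$ is contained in the fifth fiber with index $2$. 3. The action of $P_4$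 on $\pi_1(S_{0,5})$ induces an isomorphism $K_4\cong\mathrm{PMod}(S_{0,5})$, and under it the fifth fiber corresponds to the point-pushing subgroup. In particular the fifth fiber is different from the four fibers that come from the strand-forgetting maps. -/

import Mathlib

/-! ### Braid groups, pure braid groups, strand deletion -/

/-- The defining relators of the braid group on `m + 1` strands, on generators `σ_0, …, σ_{m-1}`. -/
def braidRels (m : ℕ) : Set (FreeGroup (Fin m)) :=
  {r | ∃ i j : Fin m, (i : ℕ) + 1 = j ∧
    r = FreeGroup.of i * FreeGroup.of j * FreeGroup.of i *
      (FreeGroup.of j * FreeGroup.of i * FreeGroup.of j)⁻¹} ∪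
  {r | ∃ i j : Fin m, (i : ℕ) + 1 < j ∧
    r = FreeGroup.of i * FreeGroup.of j * (FreeGroup.of j * FreeGroup.of i)⁻¹}

/-- The braid group on `m + 1` strands, by its Artin presentation. -/
abbrev BraidGroup (m : ℕ) : Type := PresentedGroup (braidRels m)

/-- The braid group on four strands. -/
abbrev B4 : Type := BraidGroup 3

/-- The braid group on three strands. -/
abbrev B3 : Type := BraidGroup 2

/-- The Artin generator `σ_i`, crossing the strands in positions `i` and `i + 1`
(positions are numbered from `0`). -/
def sig {m : ℕ} (i : Fin m) : BraidGroup m := PresentedGroup.of i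

theorem sig_braid {m : ℕ} (i j : Fin m) (h : (i : ℕ) + 1 = j) :
    (sig i * sig j * sig i : BraidGroup m) = sig j * sig i * sig j :=
  PresentedGroup.mk_eq_mk_of_mul_inv_mem (Or.inl ⟨i, j, h, rfl⟩)

theorem sig_comm {m : ℕ} (i j : Fin m) (h : (i : ℕ) + 1 < j) :
    (sig i * sig j : BraidGroup m) = sig j * sig i :=
  PresentedGroup.mk_eq_mk_of_mul_inv_mem (Or.inr ⟨i, j, h, rfl⟩)

/-- The homomorphism out of the braid group given by elements satisfying the braid relations. -/
def braidLift {m : ℕ} {G : Type*} [Group G] (s : Fin m → G)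
    (h1 : ∀ i j : Fin m, (i : ℕ) + 1 = j → s i * s j * s i = s j * s i * s j)
    (h2 : ∀ i j : Fin m, (i : ℕ) + 1 < j → s i * s j = s j * s i) : BraidGroup m →* G :=
  PresentedGroup.toGroup (f := s) (by
    rintro r (⟨i, j, h, rfl⟩ | ⟨i, j, h, rfl⟩)
    · simpa [mul_inv_eq_one, ← mul_assoc] using mul_inv_eq_one.mpr (h1 i j h)
    · simpa [← mul_assoc] using mul_inv_eq_one.mpr (h2 i j h))

@[simp] theorem braidLift_sig {m : ℕ} {G : Type*} [Group G] (s : Fin m → G) (h1 h2) (i : Fin m) :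
    braidLift s h1 h2 (sig i) = s i :=
  PresentedGroup.toGroup.of _

theorem forall_fin3_braid {G : Type*} [Group G] {s : Fin 3 → G}
    (h01 : s 0 * s 1 * s 0 = s 1 * s 0 * s 1) (h12 : s 1 * s 2 * s 1 = s 2 * s 1 * s 2) :
    ∀ i j : Fin 3, (i : ℕ) + 1 = j → s i * s j * s i = s j * s i * s j := by
  intro i j h
  fin_cases i <;> fin_cases j <;> first | exact h01 | exact h12 | simp at h

theorem forall_fin3_comm {G : Type*} [Group G] {s : Fin 3 → G} (h02 : s 0 * s 2 = s 2 * s 0) :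
    ∀ i j : Fin 3, (i : ℕ) + 1 < j → s i * s j = s j * s i := by
  intro i j h
  fin_cases i <;> fin_cases j <;> first | exact h02 | simp at h

theorem braid_induction {m : ℕ} (H : Subgroup (BraidGroup m)) (h : ∀ i, sig i ∈ H)
    (b : BraidGroup m) : b ∈ H :=
  PresentedGroup.generated_by _ H h b

/-- The permutation induced by a braid: `σ_i` maps to the transposition `(i, i + 1)`. -/
def braidPerm (m : ℕ) : BraidGroup m →* Equiv.Perm (Fin (m + 1)) :=
  braidLift (fun i => Equiv.swap i.castSucc i.succ)
    (by
      intro i j h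
      have hj : j.castSucc = i.succ := by ext; simp [h]
      have h1 : i.castSucc ≠ i.succ := by simp [Fin.ext_iff]
      have h2 : i.castSucc ≠ j.succ := by simp [Fin.ext_iff]; omega
      have h3 : i.succ ≠ j.succ := by simp [Fin.ext_iff]; omega
      have e1 := Equiv.swap_mul_swap_mul_swap h3.symm h2.symm
      have e2 := Equiv.swap_mul_swap_mul_swap h1 h2
      rw [Equiv.swap_comm i.succ i.castSucc, Equiv.swap_comm j.succ i.succ] at e1
      rw [hj, e1, e2, Equiv.swap_comm])
    (by
      intro i j h
      apply Equiv.Perm.Disjoint.commute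
      intro x
      by_cases hx : x = j.castSucc ∨ x = j.succ
      · left
        apply Equiv.swap_apply_of_ne_of_ne <;> rcases hx with rfl | rfl <;>
          simp [Fin.ext_iff] <;> omega
      · right
        push Not at hx
        exact Equiv.swap_apply_of_ne_of_ne hx.1 hx.2)

theorem braidPerm_sig {m : ℕ} (i : Fin m) :
    braidPerm m (sig i) = Equiv.swap i.castSucc i.succ :=
  braidLift_sig _ _ _ i

/-- The pure braid group on `m + 1` strands. -/
abbrev PureBraid (m : ℕ) : Subgroup (BraidGroup m) := (braidPerm m).ker

/-- The pure braid group on four strands. -/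
abbrev P4 : Subgroup B4 := PureBraid 3

/-- The pure braid group on three strands. -/
abbrev P3 : Subgroup B3 := PureBraid 2

/-- What is left of the crossing `σ_j` of a four-strand braid when the strand in position `i` is
removed: nothing if that strand takes part in the crossing, and otherwise the same crossing with
its position renumbered. -/
def deleteCrossing (j : Fin 3) (i : Fin 4) : B3 :=
  ![![1, 1, sig 0, sig 0],
    ![sig 0, 1, 1, sig 1],
    ![sig 1, sig 1, 1, 1]] j i

theorem arrow_apply {A H : Type*} [Group H] (s : Equiv.Perm A) (f : A → H) (i : A) :
    mulAutArrow s f i = f (s.symm i) := rfl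

theorem perm_mul_symm_apply {A : Type*} (s t : Equiv.Perm A) (i : A) :
    Equiv.symm (s * t) i = t.symm (s.symm i) := rfl

/-- Strand deletion on all four-strand braids. The first component of the image of `b` is the
family `i ↦ (b with the strand starting in position i removed)`, the second one is the permutation
of `b`. The product of the semidirect product expresses the rule
`delete i (b * c) = delete i b * delete i' c`, where `i'` is the position in which the strand of `b`
that starts in position `i` ends. -/
def braidDelete : B4 →* (Fin 4 → B3) ⋊[mulAutArrow] Equiv.Perm (Fin 4) :=
  braidLift (fun j => ⟨deleteCrossing j, Equiv.swap j.castSucc j.succ⟩)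
    (forall_fin3_braid
      (by
        ext i
        · fin_cases i <;> simp [-mulAutArrow_apply_apply, -map_mul, arrow_apply, perm_mul_symm_apply,
            deleteCrossing, Equiv.swap_apply_def, sig_braid (0 : Fin 2) 1 rfl]
        · revert i; decide)
      (by
        ext i
        · fin_cases i <;> simp [-mulAutArrow_apply_apply, -map_mul, arrow_apply, perm_mul_symm_apply,
            deleteCrossing, Equiv.swap_apply_def, sig_braid (0 : Fin 2) 1 rfl]
        · revert i; decide))
    (forall_fin3_comm (by
        ext i
        · fin_cases i <;> simp [-mulAutArrow_apply_apply, -map_mul, arrow_apply,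
            deleteCrossing, Equiv.swap_apply_def]
        · revert i; decide))

theorem braidDelete_right (b : B4) : (braidDelete b).right = braidPerm 3 b := by
  have : SemidirectProduct.rightHom.comp braidDelete = braidPerm 3 := by
    apply PresentedGroup.ext
    intro x
    change (braidDelete (sig x)).right = braidPerm 3 (sig x)
    rw [braidPerm_sig, braidDelete, braidLift_sig]
  exact DFunLike.congr_fun this b

theorem braidDelete_sig (j : Fin 3) :
    braidDelete (sig j) = ⟨deleteCrossing j, Equiv.swap j.castSucc j.succ⟩ :=
  braidLift_sig _ _ _ j

/-- The permutation of `b` with a strand removed is the permutation of `b` restricted to the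
remaining strands, renumbered in order. -/
theorem braidPerm_delete (b : B4) (i : Fin 4) (k : Fin 3) :
    i.succAbove (braidPerm 2 ((braidDelete b).left i) k) =
      braidPerm 3 b (((braidPerm 3 b)⁻¹ i).succAbove k) := by
  let H : Subgroup B4 :=
    { carrier := {b | ∀ i k, i.succAbove (braidPerm 2 ((braidDelete b).left i) k) =
        braidPerm 3 b (((braidPerm 3 b)⁻¹ i).succAbove k)}
      one_mem' := by intro i k; simp
      mul_mem' := by
        intro b c hb hc i k
        have h : (braidDelete (b * c)).left i =
            (braidDelete b).left i * (braidDelete c).left ((braidPerm 3 b)⁻¹ i) := by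
          rw [map_mul, SemidirectProduct.mul_left, Pi.mul_apply, arrow_apply, braidDelete_right]
          rfl
        rw [h, map_mul, Equiv.Perm.mul_apply, hb, hc, map_mul]
        simp
      inv_mem' := by
        intro b hb i k
        have h : (braidDelete b⁻¹).left i = ((braidDelete b).left (braidPerm 3 b i))⁻¹ := by
          rw [map_inv, SemidirectProduct.inv_left, braidDelete_right]
          rfl
        have h2 := hb (braidPerm 3 b i) ((braidPerm 2 ((braidDelete b).left (braidPerm 3 b i)))⁻¹ k)
        rw [h, map_inv, map_inv, inv_inv]
        rw [← Equiv.Perm.mul_apply, mul_inv_cancel, Equiv.Perm.one_apply] at h2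
        rw [h2]
        simp }
  refine braid_induction H ?_ b i k
  intro j i k
  rw [braidDelete_sig, braidPerm_sig]
  have h0 := braidPerm_sig (0 : Fin 2)
  have h1 := braidPerm_sig (1 : Fin 2)
  fin_cases j <;> fin_cases i <;> simp [deleteCrossing, h0, h1] <;> revert k <;> decide

/-- The strand-forgetting homomorphism `Θ_i` on pure braids: remove the strand `i`. -/
def strandForget (i : Fin 4) : P4 →* P3 where
  toFun p := ⟨(braidDelete p).left i, by
    rw [MonoidHom.mem_ker]
    ext1 k
    have h := braidPerm_delete p i k
    rw [MonoidHom.mem_ker.mp p.2] at h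
    exact Fin.succAbove_right_injective h⟩
  map_one' := by ext1; simp
  map_mul' p q := by
    ext1
    have h : braidPerm 3 p = 1 := MonoidHom.mem_ker.mp p.2
    simp [braidDelete_right, h]

/-! ### The Cardano–Ferrari epimorphism -/

/-- The Cardano–Ferrari epimorphism `Ψ : B₄ → B₃`, with `σ₁, σ₂, σ₃ ↦ σ₁, σ₂, σ₁`. -/
def cardanoFerrariB4 : B4 →* B3 :=
  braidLift ![sig 0, sig 1, sig 0]
    (forall_fin3_braid (by simpa using sig_braid (0 : Fin 2) 1 rfl)
      (by simpa using (sig_braid (0 : Fin 2) 1 rfl).symm))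
    (forall_fin3_comm (by simp))

/-- The three double transpositions of four letters. -/
def doubleTransp : Fin 3 → Equiv.Perm (Fin 4) :=
  ![Equiv.swap 0 3 * Equiv.swap 1 2, Equiv.swap 0 2 * Equiv.swap 1 3,
    Equiv.swap 0 1 * Equiv.swap 2 3]

theorem braidPerm_cardanoFerrari (b : B4) (k : Fin 3) :
    doubleTransp (braidPerm 2 (cardanoFerrariB4 b) k) =
      braidPerm 3 b * doubleTransp k * (braidPerm 3 b)⁻¹ := by
  let H : Subgroup B4 :=
    { carrier := {b | ∀ k, doubleTransp (braidPerm 2 (cardanoFerrariB4 b) k) =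
        braidPerm 3 b * doubleTransp k * (braidPerm 3 b)⁻¹}
      one_mem' := by intro k; simp
      mul_mem' := by
        intro b c hb hc k
        rw [map_mul, map_mul, map_mul, Equiv.Perm.mul_apply, hb, hc]
        group
      inv_mem' := by
        intro b hb k
        have h := hb ((braidPerm 2 (cardanoFerrariB4 b))⁻¹ k)
        rw [← Equiv.Perm.mul_apply, mul_inv_cancel, Equiv.Perm.one_apply] at h
        rw [map_inv, map_inv, map_inv, h]
        group }
  refine braid_induction H ?_ b k
  intro j k
  rw [cardanoFerrariB4, braidLift_sig, braidPerm_sig]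
  revert k
  fin_cases j <;> simp only [Fin.zero_eta, Fin.mk_one, Fin.reduceFinMk, Matrix.cons_val] <;>
    rw [braidPerm_sig] <;> decide

/-- The restriction `Ψ : P₄ → P₃` of the Cardano–Ferrari epimorphism to pure braids. -/
def cardanoFerrari : P4 →* P3 :=
  (cardanoFerrariB4.comp P4.subtype).codRestrict P3 (by
    intro p
    rw [MonoidHom.mem_ker]
    ext1 k
    have h := braidPerm_cardanoFerrari p k
    rw [MonoidHom.mem_ker.mp p.2] at h
    have hinj : Function.Injective doubleTransp := by decide
    apply hinj
    simpa using h)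

/-! ### The groups `K₄` and `K₃` -/

/-- `K₄ = P₄ / Z(P₄)`. -/
abbrev K4 : Type := P4 ⧸ Subgroup.center P4

/-- `K₃ = P₃ / Z(P₃)`. -/
abbrev K3 : Type := P3 ⧸ Subgroup.center P3

/-- The projection `P₄ → K₄`. -/
abbrev toK4 : P4 →* K4 := QuotientGroup.mk' (Subgroup.center P4)

/-- The projection `P₃ → K₃`. -/
abbrev toK3 : P3 →* K3 := QuotientGroup.mk' (Subgroup.center P3)

/-! ### The action of the braid group `B₄` on the free group `F₂` by conjugation -/

/-- The free group `F₂` on the letters `a = of 0` and `b = of 1`. -/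
abbrev F2 : Type := FreeGroup (Fin 2)

/-- The homomorphism `F₂ → B₄` with `a ↦ σ₁σ₃⁻¹` and `b ↦ σ₂σ₁σ₃⁻¹σ₂⁻¹`. -/
def freeToB4 : F2 →* B4 :=
  FreeGroup.lift ![sig 0 * (sig 2)⁻¹, sig 1 * sig 0 * (sig 2)⁻¹ * (sig 1)⁻¹]

/-- The endomorphism of `F₂` with `a ↦ x` and `b ↦ y`. -/
def endF2 (x y : F2) : F2 →* F2 := FreeGroup.lift ![x, y]

@[simp] theorem endF2_a (x y : F2) : endF2 x y (FreeGroup.of 0) = x := by simp [endF2]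

@[simp] theorem endF2_b (x y : F2) : endF2 x y (FreeGroup.of 1) = y := by simp [endF2]

/-- The automorphism of `F₂` with `a ↦ x`, `b ↦ y` whose inverse is `a ↦ x'`, `b ↦ y'`. -/
def autF2 (x y x' y' : F2)
    (h1 : endF2 x' y' x = FreeGroup.of 0) (h2 : endF2 x' y' y = FreeGroup.of 1)
    (h3 : endF2 x y x' = FreeGroup.of 0) (h4 : endF2 x y y' = FreeGroup.of 1) : MulAut F2 :=
  MonoidHom.toMulEquiv (endF2 x y) (endF2 x' y')
    (by ext i; fin_cases i <;> simp [h1, h2]) (by ext i; fin_cases i <;> simp [h3, h4])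

/-- The automorphisms of `F₂` by which the Artin generators act. -/
def autGen : Fin 3 → MulAut F2 :=
  let a : F2 := FreeGroup.of 0
  let b : F2 := FreeGroup.of 1
  ![autF2 a (b * a⁻¹) a (b * a) (endF2_a _ _) (by simp [a, b]) (endF2_a _ _) (by simp [a, b]),
    autF2 b (b * a⁻¹ * b) (a * b⁻¹ * a) a (by simp [a, b]) (by simp [a, b])
      (by simp [a, b, mul_assoc]) (by simp [a, b]),
    autF2 a (a⁻¹ * b) a (a * b) (endF2_a _ _) (by simp [a, b]) (endF2_a _ _) (by simp [a, b])]

/-- The action `B₄ → Aut(F₂)`. By `freeToB4_braidAut` it is the action by conjugation on the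
subgroup generated by `σ₁σ₃⁻¹` and `σ₂σ₁σ₃⁻¹σ₂⁻¹`. -/
def braidAut : B4 →* MulAut F2 :=
  braidLift autGen
    (forall_fin3_braid
      (by
        apply MulEquiv.toMonoidHom_injective
        ext i
        fin_cases i <;> simp [autGen, autF2, mul_assoc])
      (by
        apply MulEquiv.toMonoidHom_injective
        ext i
        fin_cases i <;> simp [autGen, autF2, mul_assoc]))
    (forall_fin3_comm
      (by
        apply MulEquiv.toMonoidHom_injective
        ext i
        fin_cases i <;> simp [autGen, autF2, mul_assoc]))

theorem braid_conj_identities {G : Type*} [Group G] {x y z : G} (h01 : x * y * x = y * x * y)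
    (h12 : y * z * y = z * y * z) (h02 : x * z = z * x) :
    x * (x * z⁻¹) * x⁻¹ = x * z⁻¹ ∧ z * (x * z⁻¹) * z⁻¹ = x * z⁻¹ ∧
    x * (y * x * z⁻¹ * y⁻¹) * x⁻¹ = y * x * z⁻¹ * y⁻¹ * (x * z⁻¹)⁻¹ ∧
    z * (y * x * z⁻¹ * y⁻¹) * z⁻¹ = (x * z⁻¹)⁻¹ * (y * x * z⁻¹ * y⁻¹) ∧
    y * (y * x * z⁻¹ * y⁻¹) * y⁻¹ =
      y * x * z⁻¹ * y⁻¹ * (x * z⁻¹)⁻¹ * (y * x * z⁻¹ * y⁻¹) := by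
  have e1 : y * z⁻¹ * y⁻¹ = z⁻¹ * y⁻¹ * z := by
    have : z * y * z⁻¹ = y⁻¹ * z * y := by
      rw [mul_inv_eq_iff_eq_mul, mul_assoc, mul_assoc, eq_inv_mul_iff_mul_eq, ← mul_assoc,
        ← mul_assoc, h12]
    calc y * z⁻¹ * y⁻¹ = z⁻¹ * (z * y * z⁻¹) * y⁻¹ := by group
      _ = z⁻¹ * y⁻¹ * z := by rw [this]; group
  have e2 : x⁻¹ * y * x = y * x * y⁻¹ := by
    rw [eq_mul_inv_iff_mul_eq, mul_assoc, mul_assoc, inv_mul_eq_iff_eq_mul, ← mul_assoc,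
      ← mul_assoc, h01]
  have e3 : z⁻¹ * x = x * z⁻¹ := by
    rw [inv_mul_eq_iff_eq_mul, ← mul_assoc, ← h02, mul_inv_cancel_right]
  refine ⟨?_, ?_, ?_, ?_, ?_⟩
  · rw [mul_inv_eq_iff_eq_mul, mul_assoc, e3]
  · rw [← e3]; group
    exact (by simpa using e3.symm)
  · calc x * (y * x * z⁻¹ * y⁻¹) * x⁻¹ = (x * y * x) * z⁻¹ * y⁻¹ * x⁻¹ := by group
      _ = y * x * (y * z⁻¹ * y⁻¹) * x⁻¹ := by rw [h01]; group
      _ = _ := by rw [e1]; group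
  · calc z * (y * x * z⁻¹ * y⁻¹) * z⁻¹ = z * x⁻¹ * (x * y * x) * z⁻¹ * y⁻¹ * z⁻¹ := by group
      _ = z * x⁻¹ * y * x * (y * z⁻¹ * y⁻¹) * z⁻¹ := by rw [h01]; group
      _ = _ := by rw [e1]; group
  · symm
    calc y * x * z⁻¹ * y⁻¹ * (x * z⁻¹)⁻¹ * (y * x * z⁻¹ * y⁻¹)
        = y * x * (z⁻¹ * y⁻¹ * z) * (x⁻¹ * y * x) * z⁻¹ * y⁻¹ := by group
      _ = y * x * y * (z⁻¹ * x) * y⁻¹ * z⁻¹ * y⁻¹ := by rw [← e1, e2]; group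
      _ = y * (x * y * x) * z⁻¹ * y⁻¹ * z⁻¹ * y⁻¹ := by rw [e3]; group
      _ = y * (y * x * (y * z⁻¹ * y⁻¹)) * z⁻¹ * y⁻¹ := by rw [h01]; group
      _ = _ := by rw [e1]; group

theorem freeToB4_braidAut (β : B4) (x : F2) :
    freeToB4 (braidAut β x) = β * freeToB4 x * β⁻¹ := by
  let H : Subgroup B4 :=
    { carrier := {β | ∀ x, freeToB4 (braidAut β x) = β * freeToB4 x * β⁻¹}
      one_mem' := by intro x; simp
      mul_mem' := by
        intro b c hb hc x
        rw [map_mul, MulAut.mul_apply, hb, hc]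
        group
      inv_mem' := by
        intro b hb x
        have h := hb ((braidAut b)⁻¹ x)
        rw [MulAut.apply_inv_self] at h
        rw [map_inv, h]
        group }
  refine braid_induction H ?_ β x
  intro j
  have key : freeToB4.comp (braidAut (sig j)).toMonoidHom =
      (MulAut.conj (sig j : B4)).toMonoidHom.comp freeToB4 := by
    have h01 := sig_braid (0 : Fin 3) 1 rfl
    have h12 := sig_braid (1 : Fin 3) 2 rfl
    have h02 := sig_comm (0 : Fin 3) 2 (by decide)
    obtain ⟨i1, i2, i3, i4, i5⟩ := braid_conj_identities h01 h12 h02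
    ext i
    rw [braidAut, braidLift_sig]
    fin_cases j <;> fin_cases i <;>
      simp only [autGen, autF2, freeToB4, Fin.zero_eta, Fin.mk_one, Fin.reduceFinMk,
        Matrix.cons_val, MonoidHom.comp_apply, MulEquiv.coe_toMonoidHom, MonoidHom.toMulEquiv_apply,
        endF2_a, endF2_b, map_mul, map_inv, FreeGroup.lift_apply_of, MulAut.conj_apply]
    · exact i1.symm.trans (by group)
    · exact i3.symm.trans (by group)
    · simp [mul_assoc]
    · exact i5.symm.trans (by group)
    · exact i2.symm.trans (by group)
    · exact i4.symm.trans (by group)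
  intro x
  exact DFunLike.congr_fun key x

/-! ### Pure mapping class groups of punctured spheres -/

/-- The fundamental group `⟨x_0, …, x_{n-1} | x_0 ⋯ x_{n-1} = 1⟩` of the sphere with `n` punctures,
where `x_k` is a loop around the puncture `k`. -/
abbrev SpherePi (n : ℕ) : Type :=
  PresentedGroup {(List.ofFn fun k : Fin n => FreeGroup.of k).prod}

/-- The loop `x_k` around the puncture `k`. -/
def loop {n : ℕ} (k : Fin n) : SpherePi n := PresentedGroup.of k

theorem loop_prod (n : ℕ) : (List.ofFn fun k : Fin n => loop k).prod = 1 := by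
  have h : PresentedGroup.mk {(List.ofFn fun k : Fin n => FreeGroup.of k).prod}
      (List.ofFn fun k : Fin n => FreeGroup.of k).prod = 1 :=
    PresentedGroup.one_of_mem rfl
  rw [map_list_prod, List.map_ofFn] at h
  exact h

/-- The automorphisms of `π₁(S_{0,n})` that preserve the conjugacy class of the loop around each
puncture (so they fix each puncture and preserve the orientation). -/
def PureAut (n : ℕ) : Subgroup (MulAut (SpherePi n)) where
  carrier := {φ | ∀ k, IsConj (loop k) (φ (loop k))}
  one_mem' k := IsConj.refl _
  mul_mem' {φ ψ} hφ hψ k := (hφ k).trans (φ.toMonoidHom.map_isConj (hψ k))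
  inv_mem' {φ} hφ k := by
    have h := (φ⁻¹).toMonoidHom.map_isConj (hφ k)
    simpa using h.symm

/-- The inner automorphisms, as a subgroup of `PureAut n`. -/
def InnerAut (n : ℕ) : Subgroup (PureAut n) :=
  (MulAut.conj : SpherePi n →* MulAut (SpherePi n)).range.subgroupOf (PureAut n)

instance (n : ℕ) : (InnerAut n).Normal where
  conj_mem := by
    rintro φ ⟨g, hg⟩ ψ
    refine ⟨ψ.1 g, ?_⟩
    ext x
    have h := DFunLike.congr_fun hg (ψ.1⁻¹ x)
    simp at h
    simp [← h]

/-- The pure mapping class group `PMod(S_{0,n})`, as the group of outer automorphisms of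
`π₁(S_{0,n})` that preserve the conjugacy class of the loop around each puncture. -/
abbrev PMod (n : ℕ) : Type := PureAut n ⧸ InnerAut n

/-- The homomorphism out of `π₁(S_{0,n})` given by elements with product `1`. -/
def sphereLift {n : ℕ} {G : Type*} [Group G] (f : Fin n → G) (h : (List.ofFn f).prod = 1) :
    SpherePi n →* G :=
  PresentedGroup.toGroup (f := f) (by
    rintro r rfl
    rw [map_list_prod, List.map_ofFn]
    simpa [Function.comp_def] using h)

@[simp] theorem sphereLift_loop {n : ℕ} {G : Type*} [Group G] (f : Fin n → G) (h) (k : Fin n) :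
    sphereLift f h (loop k) = f k :=
  PresentedGroup.toGroup.of _

theorem sphere_hom_ext {n : ℕ} {G : Type*} [Group G] {f g : SpherePi n →* G}
    (h : ∀ k, f (loop k) = g (loop k)) : f = g :=
  PresentedGroup.ext h

/-- The homomorphism `π₁(S_{0,n+1}) → π₁(S_{0,n})` that fills in the last puncture. -/
def fillPuncture (n : ℕ) : SpherePi (n + 1) →* SpherePi n :=
  sphereLift (Fin.lastCases 1 loop) (by
    rw [List.ofFn_succ_last]
    simpa using loop_prod n)

@[simp] theorem fillPuncture_castSucc {n : ℕ} (k : Fin n) :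
    fillPuncture n (loop k.castSucc) = loop k := by
  simp [fillPuncture]

@[simp] theorem fillPuncture_last {n : ℕ} :
    fillPuncture n (loop (Fin.last n)) = 1 := by
  simp [fillPuncture]

theorem fillPuncture_surjective (n : ℕ) : Function.Surjective (fillPuncture n) := by
  rw [← MonoidHom.range_eq_top, eq_top_iff]
  intro y _
  exact PresentedGroup.generated_by _ _ (fun k => MonoidHom.mem_range.mpr ⟨loop k.castSucc, fillPuncture_castSucc k⟩) y

theorem fillPuncture_aut_last {n : ℕ} (φ : PureAut (n + 1)) :
    fillPuncture n (φ.1 (loop (Fin.last n))) = 1 := by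
  have h := (fillPuncture n).map_isConj (φ.2 (Fin.last n))
  rw [fillPuncture_last] at h
  exact isConj_one_right.mp h

/-- The endomorphism of `π₁(S_{0,n})` induced by an element of `PureAut (n + 1)`. -/
def inducedEnd {n : ℕ} (φ : PureAut (n + 1)) : SpherePi n →* SpherePi n :=
  sphereLift (fun k => fillPuncture n (φ.1 (loop k.castSucc))) (by
    have h := congrArg (fun x => fillPuncture n (φ.1 x)) (loop_prod (n + 1))
    simp only [List.ofFn_succ_last, List.prod_append, map_mul, List.prod_singleton, map_one,
      fillPuncture_aut_last, mul_one, map_list_prod, List.map_ofFn] at h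
    exact h)

theorem inducedEnd_fill {n : ℕ} (φ : PureAut (n + 1)) (x : SpherePi (n + 1)) :
    inducedEnd φ (fillPuncture n x) = fillPuncture n (φ.1 x) := by
  have h : (inducedEnd φ).comp (fillPuncture n) =
      (fillPuncture n).comp φ.1.toMonoidHom := by
    apply sphere_hom_ext
    intro k
    induction k using Fin.lastCases with
    | last => simp [fillPuncture_aut_last]
    | cast k => simp [inducedEnd]
  exact DFunLike.congr_fun h x

theorem inducedEnd_mul {n : ℕ} (φ ψ : PureAut (n + 1)) :
    inducedEnd (φ * ψ) = (inducedEnd φ).comp (inducedEnd ψ) := by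
  apply MonoidHom.ext
  intro y
  obtain ⟨x, rfl⟩ := fillPuncture_surjective n y
  simp [inducedEnd_fill]

theorem inducedEnd_one (n : ℕ) :
    inducedEnd (1 : PureAut (n + 1)) = MonoidHom.id (SpherePi n) := by
  apply MonoidHom.ext
  intro y
  obtain ⟨x, rfl⟩ := fillPuncture_surjective n y
  simp [inducedEnd_fill]

/-- Forgetting the last puncture, on automorphisms: `forgetAut φ` is the automorphism of
`π₁(S_{0,n})` with `forgetAut φ (fillPuncture n x) = fillPuncture n (φ x)`. -/
def forgetAut (n : ℕ) : PureAut (n + 1) →* PureAut n where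
  toFun φ := ⟨MonoidHom.toMulEquiv (inducedEnd φ) (inducedEnd φ⁻¹)
    (by rw [← inducedEnd_mul, inv_mul_cancel, inducedEnd_one])
    (by rw [← inducedEnd_mul, mul_inv_cancel, inducedEnd_one]), by
      intro k
      have h := (fillPuncture n).map_isConj (φ.2 k.castSucc)
      rw [← inducedEnd_fill, fillPuncture_castSucc] at h
      exact h⟩
  map_one' := by
    ext y
    exact DFunLike.congr_fun (inducedEnd_one n) y
  map_mul' φ ψ := by
    ext y
    exact DFunLike.congr_fun (inducedEnd_mul φ ψ) y

theorem forgetAut_fill {n : ℕ} (φ : PureAut (n + 1)) (x : SpherePi (n + 1)) :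
    (forgetAut n φ).1 (fillPuncture n x) = fillPuncture n (φ.1 x) :=
  inducedEnd_fill φ x

/-- The homomorphism `PMod(S_{0,n+1}) → PMod(S_{0,n})` that forgets the last puncture. -/
def forgetPuncture (n : ℕ) : PMod (n + 1) →* PMod n :=
  QuotientGroup.map _ _ (forgetAut n) (by
    rintro φ ⟨g, hg⟩
    refine ⟨fillPuncture n g, ?_⟩
    ext y
    obtain ⟨x, rfl⟩ := fillPuncture_surjective n y
    have h : φ.1 x = g * x * g⁻¹ := (DFunLike.congr_fun hg x).symm
    change _ = (forgetAut n φ).1 (fillPuncture n x)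
    rw [forgetAut_fill, h]
    simp)

/-- The point-pushing subgroup of `PMod(S_{0,n+1})` at the last puncture: the kernel of the
homomorphism that forgets this puncture. -/
def pointPush (n : ℕ) : Subgroup (PMod (n + 1)) := (forgetPuncture n).ker

/-! ### The action of braids on the five-punctured sphere -/

/-- The images of the loops under `σ_j`: `x_j ↦ x_j x_{j+1} x_j⁻¹`, `x_{j+1} ↦ x_j`, and the other
loops are fixed. -/
def twistLoop (j : Fin 3) (k : Fin 5) : SpherePi 5 :=
  if k = j.castSucc.castSucc then
    loop j.castSucc.castSucc * loop j.succ.castSucc * (loop j.castSucc.castSucc)⁻¹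
  else if k = j.succ.castSucc then loop j.castSucc.castSucc else loop k

/-- The images of the loops under the inverse of `σ_j`. -/
def twistInvLoop (j : Fin 3) (k : Fin 5) : SpherePi 5 :=
  if k = j.castSucc.castSucc then loop j.succ.castSucc
  else if k = j.succ.castSucc then
    (loop j.succ.castSucc)⁻¹ * loop j.castSucc.castSucc * loop j.succ.castSucc
  else loop k

theorem twistLoop_prod (j : Fin 3) : (List.ofFn (twistLoop j)).prod = 1 := by
  have hx := loop_prod 5
  simp only [List.ofFn_succ, List.ofFn_zero, List.prod_cons, List.prod_nil] at hx ⊢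
  fin_cases j <;> simpa [twistLoop, mul_assoc] using hx

theorem twistInvLoop_prod (j : Fin 3) : (List.ofFn (twistInvLoop j)).prod = 1 := by
  have hx := loop_prod 5
  simp only [List.ofFn_succ, List.ofFn_zero, List.prod_cons, List.prod_nil] at hx ⊢
  fin_cases j <;> simpa [twistInvLoop, mul_assoc] using hx

/-- The automorphism of `π₁(S_{0,5})` by which `σ_j` (a half twist) acts. -/
def halfTwist (j : Fin 3) : MulAut (SpherePi 5) :=
  MonoidHom.toMulEquiv (sphereLift (twistLoop j) (twistLoop_prod j))
    (sphereLift (twistInvLoop j) (twistInvLoop_prod j))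
    (by
      apply sphere_hom_ext
      intro k
      fin_cases j <;> fin_cases k <;> simp [twistLoop, twistInvLoop, mul_assoc])
    (by
      apply sphere_hom_ext
      intro k
      fin_cases j <;> fin_cases k <;> simp [twistLoop, twistInvLoop, mul_assoc])

theorem halfTwist_loop (j : Fin 3) (k : Fin 5) : halfTwist j (loop k) = twistLoop j k :=
  sphereLift_loop _ (twistLoop_prod j) k

/-- The action of `B₄` on `π₁(S_{0,5})`: the four strands correspond to the punctures `0, 1, 2, 3`,
and the puncture `4`, which corresponds to the boundary of the disk, is fixed. -/
def artinAction : B4 →* MulAut (SpherePi 5) :=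
  braidLift halfTwist
    (forall_fin3_braid
      (by
        apply MulEquiv.toMonoidHom_injective
        apply sphere_hom_ext
        intro k
        fin_cases k <;> simp [halfTwist_loop, twistLoop, mul_assoc])
      (by
        apply MulEquiv.toMonoidHom_injective
        apply sphere_hom_ext
        intro k
        fin_cases k <;> simp [halfTwist_loop, twistLoop, mul_assoc]))
    (forall_fin3_comm
      (by
        apply MulEquiv.toMonoidHom_injective
        apply sphere_hom_ext
        intro k
        fin_cases k <;> simp [halfTwist_loop, twistLoop, mul_assoc]))

theorem artinAction_last (b : B4) : artinAction b (loop (Fin.last 4)) = loop (Fin.last 4) := by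
  let H : Subgroup B4 := (MulAction.stabilizer (MulAut (SpherePi 5))
    (loop (Fin.last 4) : SpherePi 5)).comap artinAction
  refine braid_induction H ?_ b
  intro j
  change artinAction (sig j) (loop (Fin.last 4)) = loop (Fin.last 4)
  rw [artinAction, braidLift_sig, halfTwist_loop, twistLoop]
  fin_cases j <;> simp

theorem artinAction_isConj (b : B4) (k : Fin 4) :
    IsConj (loop (braidPerm 3 b k).castSucc) (artinAction b (loop k.castSucc)) := by
  let H : Subgroup B4 :=
    { carrier := {b | ∀ k, IsConj (loop (braidPerm 3 b k).castSucc)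
        (artinAction b (loop k.castSucc))}
      one_mem' := by intro k; simpa using IsConj.refl (loop k.castSucc : SpherePi 5)
      mul_mem' := by
        intro b c hb hc k
        rw [map_mul, map_mul, Equiv.Perm.mul_apply, MulAut.mul_apply]
        exact (hb _).trans ((artinAction b).toMonoidHom.map_isConj (hc k))
      inv_mem' := by
        intro b hb k
        have h := (artinAction b)⁻¹.toMonoidHom.map_isConj (hb ((braidPerm 3 b)⁻¹ k))
        rw [← Equiv.Perm.mul_apply, mul_inv_cancel, Equiv.Perm.one_apply] at h
        rw [map_inv, map_inv]
        simpa using h.symm }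
  refine braid_induction H ?_ b k
  intro j k
  rw [braidPerm_sig, artinAction, braidLift_sig, halfTwist_loop, twistLoop]
  have h (x y : SpherePi 5) : IsConj y (x * y * x⁻¹) := isConj_iff.mpr ⟨x, rfl⟩
  have hq : j.succ.castSucc ≠ j.castSucc.castSucc := by simp [Fin.ext_iff]
  by_cases h1 : k = j.castSucc
  · subst h1
    rw [Equiv.swap_apply_left, if_pos rfl]
    exact h _ _
  · by_cases h2 : k = j.succ
    · subst h2
      rw [Equiv.swap_apply_right, if_neg hq, if_pos rfl]
    · rw [Equiv.swap_apply_of_ne_of_ne h1 h2, if_neg, if_neg]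
      · exact fun h => h2 (Fin.castSucc_injective _ h)
      · exact fun h => h1 (Fin.castSucc_injective _ h)

/-- The action of a pure braid on `π₁(S_{0,5})`, as an element of `PureAut 5`. -/
def artinPure : P4 →* PureAut 5 :=
  (artinAction.comp P4.subtype).codRestrict (PureAut 5) (by
    intro p k
    induction k using Fin.lastCases with
    | last => exact isConj_iff.mpr ⟨1, by simpa using (artinAction_last p).symm⟩
    | cast k =>
      have h := artinAction_isConj p k
      rw [MonoidHom.mem_ker.mp p.2] at h
      exact h)

/-- The homomorphism `P₄ → PMod(S_{0,5})` induced by capping the boundary of the four-punctured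
disk with a once-punctured disk. -/
def capping : P4 →* PMod 5 := (QuotientGroup.mk' (InnerAut 5)).comp artinPure

/-!
On the abelianization `ℤ²` of `F₂`, a braid `β` in `B₄` acts as its image `Ψ β` under the
Cardano–Ferrari epimorphism does, through the usual map `B₃ → SL₂(ℤ)` (`abF2_braidAut`). Since `B₄`
is the semidirect product of `F₂ = ker Ψ` and a copy of `B₃`, and since the kernel of `B₃ → SL₂(ℤ)`
is generated by the square of the full twist (a ping-pong argument), the kernel of `B₄ → Aut(F₂)`
is generated by the full twist (`braidAut_eq_one_iff`). Hence a four-strand braid is determined by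
its action on `F₂` and its exponent sum (`B4_ext`), which turns identities between braids into
computations in a free group, and `K₄` embeds in `Aut(F₂)`.

The index of the image is `2 · 24`. The image of `P₄` has index `24` in that of `B₄`, and the
latter has index two in `Aut(F₂)`: together with the exchange of the two letters it contains
Nielsen's generators (`eq_top_of_nielsen_mem`), whereas all its elements act with determinant `1`.
Nielsen's theorem is proved in rank two, by showing that a pair of generators of minimal total
length under the Nielsen moves and conjugations is Nielsen reduced, so that it consists of letters.

The fiber over a forgotten strand is free on three twists of this strand: it is enough to treat the
last strand, by conjugation. The twists generate by combing (`exists_eq_lastTwistHom_mul`); they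
are free because the braid conjugates the loop around the last strand by a path that lifts the loop
along which the strand moves (`artinAction_lastTwistHom`).

The fifth fiber comes from the braids `A_k` in which the strand `k` goes once around all the
others. They satisfy `A₀ A₁ A₂ A₃ = Δ⁴`, where `Δ²` is the full twist, and braids act on them by
conjugation as they act on the loops of `π₁(S_{0,5})`. So they define an equivariant homomorphism
`π₁(S_{0,4}) → K₄`, and pushing along a loop acts on `π₁(S_{0,4})` as the conjugation by this loop
(`artinFill_pushP4`), whence it is injective. `Ψ` maps each `A_k` to the full twist, and `F₂ ∩ P₄`,
which is generated by conjugates of squares and of a commutator, consists of pushes up to the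
center; therefore the image of the pushes is the kernel of `K₄ → K₃` (`toK4_mem_range_pushK4_iff`).
It contains the image of `ker Ψ` with index two, because the pushes are mapped to arbitrary powers
of the full twist on three strands and the full twist on four strands to its square. That two
fibers generate `K₄` is checked on generators, for the fourth fiber and one other; the other cases
are conjugate to these.

`K₄ → PMod(S_{0,5})` is surjective by Artin's theorem (`exists_artinAction_eq_of_conjGen`): if the
product of conjugates `gₖ x gₖ⁻¹` of the generators is the product of the generators and some
conjugator `gₖ`, in shortest form, is nontrivial, then a braid generator or its inverse shortens
the conjugators. It is injective for two reasons: a braid that acts as an inner automorphism is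
conjugating by a power of the last loop, which it fixes, and so acts trivially on `π₁(S_{0,4})`;
and a pure braid that acts trivially on `π₁(S_{0,4})` commutes with all pushes in `K₄`, hence fixes
the squares of the generators of `F₂` (`mem_center_P4_of_artinFill`).
-/

/-! ### Free groups -/

section FreeGroupLemmas

variable {α : Type*} [DecidableEq α]

/-- An element of a free group that commutes with a generator is a power of this generator. -/
theorem FreeGroup.mem_zpowers_of_commute (i : α) (x : FreeGroup α)
    (h : Commute x (FreeGroup.of i)) : x ∈ Subgroup.zpowers (FreeGroup.of i) := by
  induction hn : x.norm using Nat.strong_induction_on generalizing x with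
  | _ n ih =>
  have hpow : FreeGroup.of i ∈ Subgroup.zpowers (FreeGroup.of i) := Subgroup.mem_zpowers _
  have hred := FreeGroup.isReduced_toWord (x := x)
  have hx : FreeGroup.mk x.toWord = x := FreeGroup.mk_toWord
  rcases hw : x.toWord with _ | ⟨⟨j, s⟩, w⟩
  · rw [FreeGroup.toWord_eq_nil_iff.mp hw]
    exact one_mem _
  by_cases hj : j = i
  · -- The first letter is a power of the generator: strip it.
    subst hj
    have hxw : x = FreeGroup.mk [(j, s)] * FreeGroup.mk w := by
      rw [FreeGroup.mul_mk, ← hx, hw]; rfl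
    have hs : FreeGroup.mk [(j, s)] ∈ Subgroup.zpowers (FreeGroup.of j) := by
      cases s
      · exact inv_mem hpow
      · exact hpow
    have hc : Commute (FreeGroup.mk [(j, s)]) (FreeGroup.of j) := by
      obtain ⟨m, hm⟩ := hs
      rw [← hm]
      exact (Commute.refl _).zpow_left m
    have hyw : FreeGroup.mk w = (FreeGroup.mk [(j, s)])⁻¹ * x := by rw [hxw]; group
    rw [hxw]
    refine mul_mem hs (ih _ ?_ _ ?_ rfl)
    · rw [← hn]
      refine lt_of_le_of_lt FreeGroup.norm_mk_le ?_
      rw [FreeGroup.norm, hw]; simp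
    · rw [hyw]
      exact hc.inv_left.mul_left h
  · -- Otherwise the generator does not cancel on the left, so it is the last letter of `x`.
    have e : (x * FreeGroup.of i).toWord = (i, true) :: x.toWord := by
      rw [h.eq, FreeGroup.toWord_mul, FreeGroup.toWord_of]
      apply FreeGroup.IsReduced.reduce_eq
      rw [hw] at hred ⊢
      exact List.isChain_cons_cons.mpr ⟨fun h => absurd h.symm hj, hred⟩
    exfalso
    have h1 : (x * FreeGroup.of i).toWord.Sublist (x.toWord ++ [(i, true)]) := by
      have := FreeGroup.toWord_mul_sublist x (FreeGroup.of i)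
      rwa [FreeGroup.toWord_of] at this
    have h2 := h1.eq_of_length (by rw [e]; simp)
    rw [e, hw] at h2
    simp at h2
    exact hj h2.1.1.symm

theorem FreeGroup.eq_one_of_commute {i j : α} (hij : i ≠ j) {x : FreeGroup α}
    (hi : Commute x (FreeGroup.of i)) (hj : Commute x (FreeGroup.of j)) : x = 1 := by
  obtain ⟨m, hm⟩ := FreeGroup.mem_zpowers_of_commute i x hi
  obtain ⟨n, hn⟩ := FreeGroup.mem_zpowers_of_commute j x hj
  let f : FreeGroup α →* FreeGroup α := FreeGroup.lift fun k => if k = i then FreeGroup.of i else 1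
  have h1 : f x = x := by
    rw [← hm]; simp [f]
  have h2 : f x = 1 := by
    rw [← hn]; simp [f, hij.symm]
  rw [← h1, h2]

end FreeGroupLemmas

/-! ### The fundamental group of a punctured sphere is free -/

/-- `π₁(S_{0,n+1})` is free on all its loops but the last one. -/
def sphereFreeLast (n : ℕ) : SpherePi (n + 1) ≃* FreeGroup (Fin n) :=
  MonoidHom.toMulEquiv
    (sphereLift (Fin.lastCases ((List.ofFn fun k : Fin n => FreeGroup.of k).prod)⁻¹ FreeGroup.of)
      (by rw [List.ofFn_succ_last]; simp))
    (FreeGroup.lift fun k => loop k.castSucc)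
    (by
      apply sphere_hom_ext
      intro k
      induction k using Fin.lastCases with
      | last =>
        have h := loop_prod (n + 1)
        simp only [List.ofFn_succ_last, List.prod_append, List.prod_singleton] at h
        simpa [map_list_prod, List.map_ofFn, Function.comp_def] using inv_eq_of_mul_eq_one_right h
      | cast k => simp)
    (by ext k; simp)

@[simp] theorem sphereFreeLast_castSucc {n : ℕ} (k : Fin n) :
    sphereFreeLast n (loop k.castSucc) = FreeGroup.of k := by
  simp [sphereFreeLast]

/-- `π₁(S_{0,n+1})` is free on all its loops but the first one. -/
def sphereFreeFirst (n : ℕ) : SpherePi (n + 1) ≃* FreeGroup (Fin n) :=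
  MonoidHom.toMulEquiv
    (sphereLift (Fin.cases ((List.ofFn fun k : Fin n => FreeGroup.of k).prod)⁻¹ FreeGroup.of)
      (by rw [List.ofFn_succ]; simp))
    (FreeGroup.lift fun k => loop k.succ)
    (by
      apply sphere_hom_ext
      intro k
      induction k using Fin.cases with
      | zero =>
        have h := loop_prod (n + 1)
        simp only [List.ofFn_succ, List.prod_cons] at h
        simpa [map_list_prod, List.map_ofFn, Function.comp_def] using inv_eq_of_mul_eq_one_left h
      | succ k => simp)
    (by ext k; simp)

@[simp] theorem sphereFreeFirst_succ {n : ℕ} (k : Fin n) :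
    sphereFreeFirst n (loop k.succ) = FreeGroup.of k := by
  simp [sphereFreeFirst]

/-- An element that commutes with a loop other than the first one is a power of this loop. -/
theorem mem_zpowers_loop_of_commute {n : ℕ} (k : Fin n) (x : SpherePi (n + 1))
    (h : Commute x (loop k.succ)) : x ∈ Subgroup.zpowers (loop k.succ : SpherePi (n + 1)) := by
  have h1 := h.map (sphereFreeFirst n)
  rw [sphereFreeFirst_succ] at h1
  obtain ⟨m, hm⟩ := FreeGroup.mem_zpowers_of_commute k _ h1
  refine ⟨m, (sphereFreeFirst n).injective ?_⟩
  rw [← hm]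
  simp

theorem sphere_eq_one_of_commute {n : ℕ} {j k : Fin n} (hjk : j ≠ k) {x : SpherePi (n + 1)}
    (hj : Commute x (loop j.castSucc)) (hk : Commute x (loop k.castSucc)) : x = 1 := by
  have h1 := hj.map (sphereFreeLast n)
  have h2 := hk.map (sphereFreeLast n)
  rw [sphereFreeLast_castSucc] at h1 h2
  exact (map_eq_one_iff _ (sphereFreeLast n).injective).mp (FreeGroup.eq_one_of_commute hjk h1 h2)

/-! ### Transversals in braid groups -/

theorem mem_normalizer_closure {G : Type*} [Group G] {S : Set G} {g : G}
    (h : ∀ x ∈ S, g * x * g⁻¹ ∈ Subgroup.closure S)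
    (h' : ∀ x ∈ S, g⁻¹ * x * g ∈ Subgroup.closure S) :
    g ∈ Subgroup.normalizer (Subgroup.closure S : Set G) := by
  have key : ∀ k : G, (∀ x ∈ S, k * x * k⁻¹ ∈ Subgroup.closure S) →
      ∀ x ∈ Subgroup.closure S, k * x * k⁻¹ ∈ Subgroup.closure S := by
    intro k hk x hx
    have : Subgroup.closure S ≤ (Subgroup.closure S).comap (MulAut.conj k).toMonoidHom :=
      (Subgroup.closure_le _).mpr fun y hy => hk y hy
    exact this hx
  intro x
  refine ⟨key g h x, fun hx => ?_⟩
  have := key g⁻¹ (by simpa using h') _ hx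
  simpa [mul_assoc] using this

theorem exists_mul_of_mem_sup {G : Type*} [Group G] {N H : Subgroup G}
    (hH : H ≤ Subgroup.normalizer (N : Set G)) {x : G} (hx : x ∈ N ⊔ H) :
    ∃ n ∈ N, ∃ h ∈ H, n * h = x := by
  have : x ∈ (↑(N ⊔ H) : Set G) := hx
  rw [Subgroup.coe_mul_of_right_le_normalizer_left N H hH] at this
  exact this

/-- A criterion for a subgroup `H` of a braid group to contain the stabilizer of the position `k₀`:
there are representatives `t k` for the cosets `H t`, permuted by the generators in the same
way as the positions. -/
theorem mem_of_transversal {m : ℕ} (H : Subgroup (BraidGroup m)) (t : Fin (m + 1) → BraidGroup m)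
    {k₀ : Fin (m + 1)} (ht : t k₀ = 1)
    (h : ∀ j k, t k * sig j * (t (Equiv.swap j.castSucc j.succ k))⁻¹ ∈ H)
    {b : BraidGroup m} (hb : braidPerm m b k₀ = k₀) : b ∈ H := by
  let C : Subgroup (BraidGroup m) :=
    { carrier := {b | ∀ k, t k * b * (t ((braidPerm m b)⁻¹ k))⁻¹ ∈ H}
      one_mem' := by intro k; simp
      mul_mem' := by
        intro b c hb hc k
        have := mul_mem (hb k) (hc ((braidPerm m b)⁻¹ k))
        simpa [mul_assoc] using this
      inv_mem' := by
        intro b hb k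
        have := inv_mem (hb (braidPerm m b k))
        simpa [mul_assoc] using this }
  have hC : b ∈ C := by
    refine braid_induction C (fun j k => ?_) b
    rw [braidPerm_sig, Equiv.swap_inv]
    exact h j k
  have := hC k₀
  rwa [show (braidPerm m b)⁻¹ k₀ = k₀ by rw [Equiv.Perm.inv_eq_iff_eq, hb], ht, one_mul, inv_one,
    mul_one] at this

/-! ### The braid group on three strands -/

theorem conj_inv_of_braid {G : Type*} [Group G] {x y : G} (h : x * y * x = y * x * y) :
    x⁻¹ * y * x = y * x * y⁻¹ := by
  rw [eq_mul_inv_iff_mul_eq, mul_assoc, mul_assoc, inv_mul_eq_iff_eq_mul, ← mul_assoc, ← mul_assoc,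
    h]

theorem sig_braid_B3 : (sig 0 * sig 1 * sig 0 : B3) = sig 1 * sig 0 * sig 1 :=
  sig_braid (0 : Fin 2) 1 rfl

/-- The full twist on three strands. -/
def fullTwist3 : B3 := (sig 0 * sig 1 * sig 0) ^ 2

theorem fullTwist3_comm (b : B3) : Commute fullTwist3 b := by
  have h := sig_braid_B3
  have h0 : sig 0 * sig 1 * sig 0 * sig 0 = sig 1 * (sig 0 * sig 1 * sig 0 : B3) := by
    nth_rw 1 [h]; group
  have h1 : sig 0 * sig 1 * sig 0 * sig 1 = sig 0 * (sig 0 * sig 1 * sig 0 : B3) := by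
    nth_rw 2 [h]; group
  have hb : b ∈ Subgroup.centralizer {fullTwist3} := by
    refine braid_induction _ (fun i => ?_) b
    rw [Subgroup.mem_centralizer_singleton_iff, fullTwist3]
    generalize (sig 0 * sig 1 * sig 0 : B3) = d at h0 h1
    rw [pow_two]
    fin_cases i
    · change sig 0 * (d * d) = d * d * sig 0
      rw [← mul_assoc, ← h1, mul_assoc, ← h0, mul_assoc]
    · change sig 1 * (d * d) = d * d * sig 1
      rw [← mul_assoc, ← h0, mul_assoc, ← h1, mul_assoc]
  exact (Subgroup.mem_centralizer_singleton_iff.mp hb).symm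

/-- The pure braid in which the first strand goes around the second one. -/
def twist12 : B3 := sig 0 ^ 2

/-- The pure braid in which the first strand goes around the third one. -/
def twist13 : B3 := sig 1 * sig 0 ^ 2 * (sig 1)⁻¹

theorem twist13_eq : twist13 = (sig 0)⁻¹ * sig 1 ^ 2 * sig 0 := by
  have h := conj_inv_of_braid sig_braid_B3
  calc twist13 = (sig 1 * sig 0 * (sig 1)⁻¹) ^ 2 := by rw [twist13, conj_pow]
    _ = ((sig 0)⁻¹ * sig 1 * sig 0) ^ 2 := by rw [h]
    _ = _ := by simp [pow_two, mul_assoc]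

theorem fullTwist3_eq : fullTwist3 = twist13 * sig 1 ^ 2 * twist12 := by
  have h := sig_braid_B3
  calc fullTwist3 = sig 1 * sig 0 * (sig 1 * sig 0 * sig 1) * sig 0 := by
        rw [fullTwist3, pow_two]; nth_rw 1 [h]; group
    _ = _ := by rw [← h, twist12, twist13]; simp [pow_two, mul_assoc]

theorem sig_one_sq_eq : (sig 1 : B3) ^ 2 = twist13⁻¹ * fullTwist3 * twist12⁻¹ := by
  rw [fullTwist3_eq]; group

theorem braidPerm_sig_sq {m : ℕ} (i : Fin m) : braidPerm m (sig i ^ 2) = 1 := by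
  rw [map_pow, braidPerm_sig, pow_two, Equiv.swap_mul_self]

theorem braidPerm_twist12 : braidPerm 2 twist12 = 1 := braidPerm_sig_sq _

theorem braidPerm_twist13 : braidPerm 2 twist13 = 1 := by
  rw [twist13, map_mul, map_mul, braidPerm_sig_sq, map_inv, mul_one, mul_inv_cancel]

theorem braidPerm_fullTwist3 : braidPerm 2 fullTwist3 = 1 := by
  rw [fullTwist3_eq, map_mul, map_mul, braidPerm_twist12, braidPerm_twist13, braidPerm_sig_sq]; rfl

/-- The homomorphism `F₂ → P₃` onto the subgroup generated by the twists of the first strand around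
the other two. -/
def freeToP3 : F2 →* P3 :=
  FreeGroup.lift ![⟨twist12, braidPerm_twist12⟩, ⟨twist13, braidPerm_twist13⟩]

/-- The full twist on three strands, as a pure braid. -/
def fullTwistP3 : P3 := ⟨fullTwist3, braidPerm_fullTwist3⟩

theorem fullTwistP3_comm (p : P3) : Commute fullTwistP3 p :=
  Subtype.ext (fullTwist3_comm p)

/-- `P₃` is generated by the twists of the first strand and the full twist. -/
theorem exists_eq_freeToP3_mul (p : P3) : ∃ (w : F2) (n : ℤ), p = freeToP3 w * fullTwistP3 ^ n := by
  let S : Set B3 := {twist12, twist13, fullTwist3}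
  let N := Subgroup.closure S
  have h12 : twist12 ∈ N := Subgroup.subset_closure (by simp [S])
  have h13 : twist13 ∈ N := Subgroup.subset_closure (by simp [S])
  have hz : fullTwist3 ∈ N := Subgroup.subset_closure (by simp [S])
  have h23 : sig 1 ^ 2 ∈ N := by
    rw [sig_one_sq_eq]
    exact mul_mem (mul_mem (inv_mem h13) hz) (inv_mem h12)
  have hnorm : Subgroup.zpowers (sig 0 : B3) ≤ Subgroup.normalizer (N : Set B3) := by
    rw [Subgroup.zpowers_le]
    refine mem_normalizer_closure ?_ ?_
    · rintro x (rfl | rfl | rfl)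
      · convert h12 using 1
        rw [twist12]; group
      · convert h23 using 1
        rw [twist13_eq]; group
      · convert hz using 1
        rw [(fullTwist3_comm (sig 0)).symm.eq]; group
    · rintro x (rfl | rfl | rfl)
      · convert h12 using 1
        rw [twist12]; group
      · convert mul_mem (mul_mem (inv_mem h12) h23) h12 using 1
        rw [twist13_eq, twist12]; simp [pow_two, mul_assoc]
      · convert hz using 1
        rw [mul_assoc, (fullTwist3_comm (sig 0)).eq]; group
  have hs : (sig 0 : B3) ∈ N ⊔ Subgroup.zpowers (sig 0) :=
    Subgroup.mem_sup_right (Subgroup.mem_zpowers _)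
  have hp : (p : B3) ∈ N ⊔ Subgroup.zpowers (sig 0) := by
    refine mem_of_transversal _ ![sig 1 * sig 0, sig 1, 1] (k₀ := 2) rfl ?_
      (by rw [MonoidHom.mem_ker.mp p.2]; rfl)
    intro j k
    have e : (sig 1 * sig 0 * sig 1 * (sig 1 * sig 0)⁻¹ : B3) = sig 0 := by
      rw [← sig_braid_B3]; group
    have e' : (sig 1 * sig 0 * sig 0 * (sig 1)⁻¹ : B3) = twist13 := by
      rw [twist13]; simp [pow_two, mul_assoc]
    fin_cases j <;> fin_cases k
    · change sig 1 * sig 0 * sig 0 * (sig 1)⁻¹ ∈ _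
      rw [e']; exact Subgroup.mem_sup_left h13
    · change sig 1 * sig 0 * (sig 1 * sig 0)⁻¹ ∈ _
      simp
    · change 1 * sig 0 * 1⁻¹ ∈ _
      simpa using hs
    · change sig 1 * sig 0 * sig 1 * (sig 1 * sig 0)⁻¹ ∈ _
      rwa [e]
    · change sig 1 * sig 1 * 1⁻¹ ∈ _
      rw [← pow_two, inv_one, mul_one]; exact Subgroup.mem_sup_left h23
    · change 1 * sig 1 * (sig 1)⁻¹ ∈ _
      simp
  obtain ⟨n, hn, h, ⟨m, rfl⟩, hp⟩ := exists_mul_of_mem_sup hnorm hp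
  -- A pure braid involves an even power of `sig 0`.
  have hNP : N ≤ P3 := by
    rw [Subgroup.closure_le]
    rintro x (rfl | rfl | rfl)
    exacts [braidPerm_twist12, braidPerm_twist13, braidPerm_fullTwist3]
  have hm : Even m := by
    have h1 : braidPerm 2 (sig 0 ^ m) = 1 := by
      have := MonoidHom.mem_ker.mp p.2
      rw [← hp, map_mul, MonoidHom.mem_ker.mp (hNP hn), one_mul] at this
      exact this
    rcases Int.even_or_odd' m with ⟨c, rfl | rfl⟩
    · simp
    · exfalso
      rw [zpow_add, zpow_mul, map_mul, map_zpow, zpow_ofNat, braidPerm_sig_sq, zpow_one, one_zpow,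
        one_mul, braidPerm_sig] at h1
      exact absurd h1 (by decide)
  have hpN : (p : B3) ∈ N := by
    obtain ⟨c, rfl⟩ := hm
    rw [← hp]
    refine mul_mem hn ?_
    change sig 0 ^ (c + c) ∈ N
    rw [← two_mul, zpow_mul, zpow_ofNat]
    exact zpow_mem h12 c
  let K : Subgroup B3 := (freeToP3.range.map P3.subtype) ⊔ Subgroup.zpowers fullTwist3
  have hNK : N ≤ K := by
    rw [Subgroup.closure_le]
    rintro x (rfl | rfl | rfl)
    · exact Subgroup.mem_sup_left ⟨_, ⟨FreeGroup.of 0, rfl⟩, by simp [freeToP3]⟩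
    · exact Subgroup.mem_sup_left ⟨_, ⟨FreeGroup.of 1, rfl⟩, by simp [freeToP3]⟩
    · exact Subgroup.mem_sup_right (Subgroup.mem_zpowers _)
  obtain ⟨_, ⟨_, ⟨w, rfl⟩, rfl⟩, _, ⟨k, rfl⟩, h⟩ := exists_mul_of_mem_sup (by
    rw [Subgroup.zpowers_le]
    intro x
    rw [(fullTwist3_comm x).eq, mul_inv_cancel_right]) (hNK hpN)
  exact ⟨w, k, Subtype.ext h.symm⟩

/-! ### The linear action of the braid group on three strands -/

/-- The action of `B₃` on `ℤ²`, the abelianization of its action on `F₂`. -/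
def linearAction : B3 →* ((ℤ × ℤ) ≃ₗ[ℤ] (ℤ × ℤ)) :=
  braidLift ![
    { toFun := fun v => (v.1 - v.2, v.2)
      invFun := fun v => (v.1 + v.2, v.2)
      left_inv := fun v => by ext <;> simp
      right_inv := fun v => by ext <;> simp
      map_add' := fun v w => by ext <;> simp; ring
      map_smul' := fun c v => by ext <;> simp; ring },
    { toFun := fun v => (-v.2, v.1 + 2 * v.2)
      invFun := fun v => (v.2 + 2 * v.1, -v.1)
      left_inv := fun v => by ext <;> simp
      right_inv := fun v => by ext <;> simp
      map_add' := fun v w => by ext <;> simp <;> ring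
      map_smul' := fun c v => by ext <;> simp; ring }]
    (by
      intro i j h
      fin_cases i <;> fin_cases j <;> first | (simp at h; done) | skip
      ext v <;> simp <;> ring)
    (by
      intro i j h
      fin_cases i <;> fin_cases j <;> simp at h)

theorem linearAction_sig_zero (v : ℤ × ℤ) : linearAction (sig 0) v = (v.1 - v.2, v.2) := by
  rw [linearAction, braidLift_sig]; rfl

theorem linearAction_sig_one (v : ℤ × ℤ) : linearAction (sig 1) v = (-v.2, v.1 + 2 * v.2) := by
  rw [linearAction, braidLift_sig]; rfl

theorem linearAction_sig_one_inv (v : ℤ × ℤ) :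
    (linearAction (sig 1))⁻¹ v = (v.2 + 2 * v.1, -v.1) := by
  rw [linearAction, braidLift_sig]; rfl

theorem linearAction_fullTwist3 (v : ℤ × ℤ) : linearAction fullTwist3 v = -v := by
  ext <;> simp [fullTwist3, pow_two, linearAction_sig_zero, linearAction_sig_one] <;> ring

theorem linearAction_twist12_zpow (n : ℤ) (v : ℤ × ℤ) :
    linearAction (twist12 ^ n) v = (v.1 - 2 * n * v.2, v.2) := by
  have h1 : ∀ v : ℤ × ℤ, linearAction twist12 v = (v.1 - 2 * v.2, v.2) := by
    intro v
    ext <;> simp [twist12, pow_two, linearAction_sig_zero]; ring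
  induction n using Int.induction_on generalizing v with
  | zero => simp
  | succ n ih =>
    rw [zpow_add_one, map_mul, LinearEquiv.mul_apply, ih, h1]
    ext <;> simp; ring
  | pred n ih =>
    have h2 : v = linearAction twist12 (v.1 + 2 * v.2, v.2) := by rw [h1]; simp
    nth_rw 1 [h2]
    rw [← LinearEquiv.mul_apply, ← map_mul, ← zpow_add_one, sub_add_cancel, ih]
    ext <;> simp; ring

theorem linearAction_twist13_zpow (n : ℤ) (v : ℤ × ℤ) :
    linearAction (twist13 ^ n) v = (v.1, v.2 + 2 * n * v.1) := by
  have h := linearAction_twist12_zpow n ((linearAction (sig 1))⁻¹ v)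
  rw [twist13, ← MulAut.conj_apply, ← map_zpow, MulAut.conj_apply, ← twist12, map_mul, map_mul,
    map_inv, LinearEquiv.mul_apply, LinearEquiv.mul_apply, h, linearAction_sig_one,
    linearAction_sig_one_inv]
  ext <;> simp; ring

/-- The linear action of the subgroup generated by the twists of the first strand is faithful: its
image is freely generated by the two standard parabolic matrices of level two. The sets
`{|q| < |p|}` and `{|p| < |q|}` are a ping-pong pair for the powers of these matrices. -/
theorem linearAction_freeToP3_injective :
    Function.Injective ((linearAction.comp P3.subtype).comp freeToP3) := by
  let g : Fin 2 → B3 := ![twist12, twist13]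
  let f : ∀ i : Fin 2, FreeGroup Unit →* ((ℤ × ℤ) ≃ₗ[ℤ] (ℤ × ℤ)) :=
    fun i => FreeGroup.lift fun _ => linearAction (g i)
  have e : (linearAction.comp P3.subtype).comp freeToP3 =
      (Monoid.CoprodI.lift f).comp (@freeGroupEquivCoprodI (Fin 2)).toMonoidHom := by
    ext1 i
    fin_cases i <;> simp [f, g, freeToP3]
  rw [e, MonoidHom.coe_comp]
  refine Function.Injective.comp ?_ (MulEquiv.injective freeGroupEquivCoprodI)
  let X : Fin 2 → Set (ℤ × ℤ) := ![{v | |v.2| < |v.1|}, {v | |v.1| < |v.2|}]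
  refine Monoid.CoprodI.lift_injective_of_ping_pong f (Or.inr ⟨0, ?_⟩) X ?_ ?_ ?_
  · have : Infinite (FreeGroup Unit) := FreeGroup.freeGroupUnitEquivInt.symm.infinite_iff.mp inferInstance
    exact (Cardinal.natCast_le_aleph0 (n := 3)).trans (Cardinal.aleph0_le_mk _)
  · intro i
    fin_cases i
    · exact ⟨(1, 0), by simp [X]⟩
    · exact ⟨(0, 1), by simp [X]⟩
  · intro i j hij
    refine Set.disjoint_left.mpr fun v hi hj => ?_
    fin_cases i <;> fin_cases j <;> simp [X] at hij hi hj <;> omega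
  · intro i j hij h hne
    obtain ⟨n, rfl⟩ := FreeGroup.freeGroupUnitEquivInt.symm.surjective h
    have hn : n ≠ 0 := by
      rintro rfl
      exact hne (by simp [FreeGroup.freeGroupUnitEquivInt])
    have hf : f i (FreeGroup.freeGroupUnitEquivInt.symm n) = linearAction (g i ^ n) := by
      change f i (FreeGroup.of () ^ n) = _
      simp [f]
    rw [hf]
    have key : ∀ p q : ℤ, |p| < |q| → |q| < |p - 2 * n * q| ∧ |q| < |p + 2 * n * q| := by
      intro p q hpq
      have h1 : |q| ≤ |n * q| := by
        rw [abs_mul]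
        exact le_mul_of_one_le_left (abs_nonneg _) (Int.one_le_abs hn)
      rw [mul_assoc]
      generalize n * q = r at *
      simp only [abs_eq_max_neg] at *
      omega
    rintro _ ⟨v, hv, rfl⟩
    change linearAction (g i ^ n) v ∈ X i
    fin_cases i <;> fin_cases j <;> simp only [X] at hij hv ⊢
    · exact absurd rfl hij
    · change linearAction (twist12 ^ n) v ∈ _
      rw [linearAction_twist12_zpow]
      exact (key _ _ hv).1
    · change linearAction (twist13 ^ n) v ∈ _
      rw [linearAction_twist13_zpow]
      exact (key _ _ hv).2
    · exact absurd rfl hij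

theorem freeToP3_injective : Function.Injective freeToP3 :=
  Function.Injective.of_comp (f := linearAction.comp P3.subtype)
    (by rw [← MonoidHom.coe_comp]; exact linearAction_freeToP3_injective)

theorem freeToP3_mem_center {w : F2} (h : freeToP3 w ∈ Subgroup.center P3) : w = 1 := by
  have hc (i : Fin 2) : Commute w (FreeGroup.of i) :=
    freeToP3_injective (by simpa using ((Subgroup.mem_center_iff.mp h) (freeToP3 (FreeGroup.of i))).symm)
  exact FreeGroup.eq_one_of_commute (i := (0 : Fin 2)) (j := 1) (by decide) (hc 0) (hc 1)

theorem fullTwistP3_mem_center : fullTwistP3 ∈ Subgroup.center P3 :=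
  Subgroup.mem_center_iff.mpr fun p => (fullTwistP3_comm p).symm

theorem mem_center_P3_iff {p : P3} : p ∈ Subgroup.center P3 ↔ ∃ n : ℤ, p = fullTwistP3 ^ n := by
  constructor
  · intro hp
    obtain ⟨w, n, rfl⟩ := exists_eq_freeToP3_mul p
    have hw := (Subgroup.mul_mem_cancel_right _ (zpow_mem fullTwistP3_mem_center n)).mp hp
    exact ⟨n, by rw [freeToP3_mem_center hw, map_one, one_mul]⟩
  · rintro ⟨n, rfl⟩
    exact zpow_mem fullTwistP3_mem_center n

/-- `K₃` is free on the classes of the twists of the first strand around the other two. -/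
noncomputable def freeToK3 : F2 ≃* K3 :=
  MulEquiv.ofBijective (toK3.comp freeToP3) (by
    constructor
    · rw [injective_iff_map_eq_one]
      intro w hw
      exact freeToP3_mem_center ((QuotientGroup.eq_one_iff _).mp hw)
    · intro k
      obtain ⟨p, rfl⟩ := QuotientGroup.mk'_surjective _ k
      obtain ⟨w, n, rfl⟩ := exists_eq_freeToP3_mul p
      refine ⟨w, ?_⟩
      rw [map_mul, show toK3 (fullTwistP3 ^ n) = 1 from
        (QuotientGroup.eq_one_iff _).mpr (zpow_mem fullTwistP3_mem_center n), mul_one]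
      rfl)

/-- The nonzero vectors modulo two, labelled by the strands. -/
def vecMod2 : Fin 3 → ZMod 2 × ZMod 2 := ![(1, 1), (0, 1), (1, 0)]

/-- Modulo two, a braid permutes the nonzero vectors in the way in which it permutes the strands. In
particular, braids that act trivially on `ℤ²` are pure. -/
theorem linearAction_mod2 (b : B3) (k : Fin 3) (v : ℤ × ℤ) :
    (((linearAction b v).1, (linearAction b v).2) : ZMod 2 × ZMod 2) = vecMod2 (braidPerm 2 b k) ↔
      ((v.1, v.2) : ZMod 2 × ZMod 2) = vecMod2 k := by
  let H : Subgroup B3 :=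
    { carrier := {b | ∀ (k : Fin 3) (v : ℤ × ℤ),
        (((linearAction b v).1, (linearAction b v).2) : ZMod 2 × ZMod 2) =
          vecMod2 (braidPerm 2 b k) ↔ ((v.1, v.2) : ZMod 2 × ZMod 2) = vecMod2 k}
      one_mem' := by intro k v; simp
      mul_mem' := by
        intro b c hb hc k v
        rw [map_mul, map_mul, LinearEquiv.mul_apply, Equiv.Perm.mul_apply, hb, hc]
      inv_mem' := by
        intro b hb k v
        rw [← hb, map_inv, map_inv, ← LinearEquiv.mul_apply, mul_inv_cancel, ← Equiv.Perm.mul_apply,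
          mul_inv_cancel]
        rfl }
  refine braid_induction H (fun j => ?_) b k v
  intro k v
  have h2 : (2 : ZMod 2) = 0 := rfl
  rw [braidPerm_sig]
  fin_cases j
  · simp only [Fin.zero_eta, linearAction_sig_zero]
    push_cast
    generalize (v.1 : ZMod 2) = p, (v.2 : ZMod 2) = q
    revert k p q; decide
  · simp only [Fin.mk_one, linearAction_sig_one]
    push_cast
    generalize (v.1 : ZMod 2) = p, (v.2 : ZMod 2) = q
    revert k p q; decide

/-- The kernel of the linear action is generated by the square of the full twist. -/
theorem eq_fullTwist3_zpow_of_linearAction {b : B3} (hb : linearAction b = 1) :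
    ∃ n : ℤ, b = fullTwist3 ^ (2 * n) := by
  have hp : b ∈ P3 := by
    rw [MonoidHom.mem_ker]
    have key (k : Fin 3) (v : ℤ × ℤ) (hv : ((v.1, v.2) : ZMod 2 × ZMod 2) = vecMod2 k) :
        braidPerm 2 b k = k := by
      have := (linearAction_mod2 b k v).mpr hv
      rw [hb, LinearEquiv.coe_one, id, hv] at this
      exact ((show Function.Injective vecMod2 by decide) this).symm
    ext1 k
    fin_cases k
    · exact key 0 (1, 1) (by decide)
    · exact key 1 (0, 1) (by decide)
    · exact key 2 (1, 0) (by decide)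
  obtain ⟨w, n, h⟩ := exists_eq_freeToP3_mul ⟨b, hp⟩
  have hbw : b = freeToP3 w * fullTwist3 ^ n := congrArg Subtype.val h
  have hz (v : ℤ × ℤ) : linearAction (fullTwist3 ^ 2) v = v := by
    rw [pow_two, map_mul, LinearEquiv.mul_apply, linearAction_fullTwist3, linearAction_fullTwist3,
      neg_neg]
  have hz2 : linearAction (fullTwist3 ^ 2) = 1 := LinearEquiv.ext hz
  -- The free part acts as a power of `-1`, so its square acts trivially.
  have hw : w = 1 := by
    have h1 : w ^ 2 = 1 := by
      apply linearAction_freeToP3_injective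
      have h3 : (freeToP3 w : B3) = b * (fullTwist3 ^ n)⁻¹ := by rw [hbw]; group
      have h4 : linearAction (fullTwist3 ^ n) ^ 2 = 1 := by
        rw [← map_pow, ← zpow_natCast, ← zpow_mul, mul_comm, zpow_mul, zpow_natCast, map_zpow, hz2,
          one_zpow]
      rw [map_pow, map_one]
      change linearAction (freeToP3 w : B3) ^ 2 = 1
      rw [h3, map_mul, hb, one_mul, map_inv, inv_pow, h4, inv_one]
    exact pow_left_injective two_ne_zero (by simpa using h1)
  subst hw
  rw [map_one, Subgroup.coe_one, one_mul] at hbw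
  rcases Int.even_or_odd' n with ⟨c, rfl | rfl⟩
  · exact ⟨c, hbw⟩
  · exfalso
    rw [hbw, zpow_add, zpow_mul, zpow_one, map_mul, map_zpow, zpow_ofNat, hz2, one_zpow,
      one_mul] at hb
    have := linearAction_fullTwist3 (1, 0)
    rw [hb] at this
    exact absurd this (by decide)

/-! ### The kernel of the action of the braid group on four strands on `F₂` -/

theorem MulAut.ext_F2 {f g : MulAut F2} (h0 : f (FreeGroup.of 0) = g (FreeGroup.of 0))
    (h1 : f (FreeGroup.of 1) = g (FreeGroup.of 1)) : f = g := by
  apply MulEquiv.toMonoidHom_injective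
  ext i
  fin_cases i
  · exact h0
  · exact h1

theorem braidAut_sig (j : Fin 3) : braidAut (sig j) = autGen j := braidLift_sig _ _ _ j

section

local notation "a" => (FreeGroup.of 0 : F2)
local notation "b" => (FreeGroup.of 1 : F2)

@[simp] theorem autGen_zero_a : autGen 0 a = a := by simp [autGen, autF2]
@[simp] theorem autGen_zero_b : autGen 0 b = b * a⁻¹ := by simp [autGen, autF2]
@[simp] theorem autGen_one_a : autGen 1 a = b := by simp [autGen, autF2]
@[simp] theorem autGen_one_b : autGen 1 b = b * a⁻¹ * b := by simp [autGen, autF2]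
@[simp] theorem autGen_two_a : autGen 2 a = a := by simp [autGen, autF2]
@[simp] theorem autGen_two_b : autGen 2 b = a⁻¹ * b := by simp [autGen, autF2]

@[simp] theorem autGen_zero_symm_a : (autGen 0).symm a = a := by simp [autGen, autF2]
@[simp] theorem autGen_zero_symm_b : (autGen 0).symm b = b * a := by simp [autGen, autF2]
@[simp] theorem autGen_one_symm_a : (autGen 1).symm a = a * b⁻¹ * a := by simp [autGen, autF2]
@[simp] theorem autGen_one_symm_b : (autGen 1).symm b = a := by simp [autGen, autF2]
@[simp] theorem autGen_two_symm_a : (autGen 2).symm a = a := by simp [autGen, autF2]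
@[simp] theorem autGen_two_symm_b : (autGen 2).symm b = a * b := by simp [autGen, autF2]

end

/-- The homomorphism `B₃ → B₄` that adds a strand on the right. It splits the Cardano–Ferrari
epimorphism. -/
def addStrand : B3 →* B4 :=
  braidLift ![sig 0, sig 1]
    (by
      intro i j h
      fin_cases i <;> fin_cases j <;> first | exact sig_braid (0 : Fin 3) 1 rfl | simp at h)
    (by
      intro i j h
      fin_cases i <;> fin_cases j <;> simp at h)

@[simp] theorem addStrand_sig_zero : addStrand (sig 0) = sig 0 := braidLift_sig _ _ _ 0
@[simp] theorem addStrand_sig_one : addStrand (sig 1) = sig 1 := braidLift_sig _ _ _ 1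

@[simp] theorem cardanoFerrariB4_sig_zero : cardanoFerrariB4 (sig 0) = sig 0 :=
  braidLift_sig _ _ _ 0
@[simp] theorem cardanoFerrariB4_sig_one : cardanoFerrariB4 (sig 1) = sig 1 :=
  braidLift_sig _ _ _ 1
@[simp] theorem cardanoFerrariB4_sig_two : cardanoFerrariB4 (sig 2) = sig 0 :=
  braidLift_sig _ _ _ 2

@[simp] theorem cardanoFerrariB4_addStrand (b : B3) : cardanoFerrariB4 (addStrand b) = b := by
  have h : cardanoFerrariB4.comp addStrand = MonoidHom.id B3 := by
    apply PresentedGroup.ext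
    intro i
    change cardanoFerrariB4 (addStrand (sig i)) = sig i
    fin_cases i <;> simp
  exact DFunLike.congr_fun h b

@[simp] theorem cardanoFerrariB4_freeToB4 (x : F2) : cardanoFerrariB4 (freeToB4 x) = 1 := by
  have h : cardanoFerrariB4.comp freeToB4 = 1 := by
    ext i
    fin_cases i <;> simp [freeToB4]
  exact DFunLike.congr_fun h x

/-- `B₄` is the semidirect product of `F₂` and `B₃`. -/
theorem exists_eq_freeToB4_mul (β : B4) :
    ∃ x : F2, β = freeToB4 x * addStrand (cardanoFerrariB4 β) := by
  have hn : addStrand.range ≤ Subgroup.normalizer (freeToB4.range : Set B4) := by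
    rw [Subgroup.le_normalizer_iff]
    rintro _ ⟨c, rfl⟩ _ ⟨x, rfl⟩
    exact ⟨_, freeToB4_braidAut _ x⟩
  have h : β ∈ freeToB4.range ⊔ addStrand.range := by
    have h0 : (sig 0 : B4) ∈ freeToB4.range ⊔ addStrand.range :=
      Subgroup.mem_sup_right ⟨sig 0, addStrand_sig_zero⟩
    refine braid_induction _ (fun i => ?_) β
    fin_cases i
    · exact h0
    · exact Subgroup.mem_sup_right ⟨sig 1, addStrand_sig_one⟩
    · have h2 : (sig 0 * (sig 2)⁻¹ : B4) ∈ freeToB4.range ⊔ addStrand.range :=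
        Subgroup.mem_sup_left ⟨FreeGroup.of 0, by simp [freeToB4]⟩
      have := mul_mem (inv_mem h2) h0
      simpa using this
  obtain ⟨_, ⟨x, rfl⟩, _, ⟨c, rfl⟩, rfl⟩ := exists_mul_of_mem_sup hn h
  exact ⟨x, by simp⟩

/-- The full twist on four strands. -/
def fullTwist4 : B4 := (sig 0 * sig 1 * sig 2) ^ 4

theorem fullTwist4_comm (β : B4) : Commute fullTwist4 β := by
  have h01 : (sig 0 * sig 1 * sig 0 : B4) = sig 1 * sig 0 * sig 1 := sig_braid (0 : Fin 3) 1 rfl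
  have h12 : (sig 1 * sig 2 * sig 1 : B4) = sig 2 * sig 1 * sig 2 := sig_braid (1 : Fin 3) 2 rfl
  have h02 : (sig 0 * sig 2 : B4) = sig 2 * sig 0 := sig_comm (0 : Fin 3) 2 (by decide)
  suffices hβ : β ∈ Subgroup.centralizer {fullTwist4} from
    (Subgroup.mem_centralizer_singleton_iff.mp hβ).symm
  have e0 : sig 0 * sig 1 * sig 2 * sig 0 = sig 1 * (sig 0 * sig 1 * sig 2 : B4) := by
    calc sig 0 * sig 1 * sig 2 * sig 0 = sig 0 * sig 1 * (sig 2 * sig 0 : B4) := by group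
      _ = sig 0 * sig 1 * sig 0 * sig 2 := by rw [← h02]; group
      _ = _ := by rw [h01]; group
  have e1 : sig 0 * sig 1 * sig 2 * sig 1 = sig 2 * (sig 0 * sig 1 * sig 2 : B4) := by
    calc sig 0 * sig 1 * sig 2 * sig 1 = sig 0 * (sig 1 * sig 2 * sig 1 : B4) := by group
      _ = sig 0 * sig 2 * sig 1 * sig 2 := by rw [h12]; group
      _ = _ := by rw [h02]; group
  have e2 : sig 0 * sig 1 * sig 2 * (sig 0 * sig 1 * sig 2) * sig 2 =
      sig 0 * (sig 0 * sig 1 * sig 2 * (sig 0 * sig 1 * sig 2) : B4) := by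
    calc sig 0 * sig 1 * sig 2 * (sig 0 * sig 1 * sig 2) * sig 2
        = sig 0 * sig 1 * (sig 2 * sig 0) * sig 1 * sig 2 * (sig 2 : B4) := by simp only [mul_assoc]
      _ = sig 0 * sig 1 * sig 0 * (sig 2 * sig 1 * sig 2) * sig 2 := by
        rw [← h02]; simp only [mul_assoc]
      _ = sig 0 * sig 1 * sig 0 * (sig 1 * sig 2 * sig 1) * sig 2 := by rw [h12]
      _ = sig 0 * (sig 1 * sig 0 * sig 1) * (sig 2 * sig 1 * sig 2) := by simp only [mul_assoc]
      _ = sig 0 * sig 0 * sig 1 * (sig 0 * sig 2) * sig 1 * sig 2 := by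
        rw [← h01]; simp only [mul_assoc]
      _ = _ := by rw [h02]; simp only [mul_assoc]
  refine braid_induction _ (fun i => ?_) β
  rw [Subgroup.mem_centralizer_singleton_iff, fullTwist4]
  generalize (sig 0 * sig 1 * sig 2 : B4) = d at e0 e1 e2
  have e0' : d * d * sig 0 = sig 2 * (d * d) := by rw [mul_assoc, e0, ← mul_assoc, e1, mul_assoc]
  have hd : d ^ 4 = d * d * (d * d) := by simp [pow_succ, mul_assoc]
  rw [hd]
  fin_cases i
  · change sig 0 * _ = _ * sig 0
    rw [mul_assoc (d * d) (d * d), e0', ← mul_assoc (d * d) (sig 2), e2]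
    simp only [mul_assoc]
  · change sig 1 * (d * d * (d * d)) = _ * sig 1
    calc sig 1 * (d * d * (d * d)) = sig 1 * d * d * d * d := by simp only [mul_assoc]
      _ = d * (sig 0 * (d * d)) * d := by rw [← e0]; simp only [mul_assoc]
      _ = d * d * d * (sig 2 * d) := by rw [← e2]; simp only [mul_assoc]
      _ = _ := by rw [← e1]; simp only [mul_assoc]
  · change sig 2 * (d * d * (d * d)) = _ * sig 2
    rw [mul_assoc (d * d) (d * d), e2, ← mul_assoc (d * d) (sig 0), e0']
    simp only [mul_assoc]

theorem cardanoFerrariB4_fullTwist4 : cardanoFerrariB4 fullTwist4 = fullTwist3 ^ 2 := by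
  simp [fullTwist4, fullTwist3, ← pow_mul]

theorem braidAut_fullTwist4 : braidAut fullTwist4 = 1 := by
  apply MulAut.ext_F2 <;> simp [fullTwist4, braidAut_sig, pow_succ, mul_assoc]

theorem braidAut_freeToB4 (x : F2) : braidAut (freeToB4 x) = MulAut.conj x := by
  have h : braidAut.comp freeToB4 = MulAut.conj := by
    ext1 i
    apply MulAut.ext_F2 <;> fin_cases i <;> simp [freeToB4, braidAut_sig, mul_assoc]
  exact DFunLike.congr_fun h x

theorem F2_conj_injective : Function.Injective (MulAut.conj : F2 →* MulAut F2) := by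
  rw [injective_iff_map_eq_one]
  intro x hx
  have h (i : Fin 2) : Commute x (FreeGroup.of i) := by
    have := DFunLike.congr_fun hx (FreeGroup.of i)
    rw [MulAut.conj_apply, MulAut.one_apply] at this
    exact mul_inv_eq_iff_eq_mul.mp this
  exact FreeGroup.eq_one_of_commute (i := (0 : Fin 2)) (j := 1) (by decide) (h 0) (h 1)

theorem freeToB4_injective : Function.Injective freeToB4 := by
  intro x y h
  apply F2_conj_injective
  rw [← braidAut_freeToB4, h, braidAut_freeToB4]

/-- The abelianization of `F₂`. -/
def abF2 : F2 →* Multiplicative (ℤ × ℤ) :=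
  FreeGroup.lift ![Multiplicative.ofAdd (1, 0), Multiplicative.ofAdd (0, 1)]

theorem abF2_braidAut (β : B4) (x : F2) :
    (abF2 (braidAut β x)).toAdd = linearAction (cardanoFerrariB4 β) (abF2 x).toAdd := by
  let H : Subgroup B4 :=
    { carrier := {β | ∀ x, (abF2 (braidAut β x)).toAdd =
        linearAction (cardanoFerrariB4 β) (abF2 x).toAdd}
      one_mem' := by intro x; simp
      mul_mem' := by
        intro b c hb hc x
        rw [map_mul, MulAut.mul_apply, hb, hc, map_mul, map_mul, LinearEquiv.mul_apply]
      inv_mem' := by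
        intro b hb x
        have h := hb ((braidAut b)⁻¹ x)
        rw [MulAut.apply_inv_self] at h
        rw [map_inv, map_inv, map_inv, h, ← LinearEquiv.mul_apply, inv_mul_cancel]
        rfl }
  refine braid_induction H (fun j x => ?_) β x
  have key : abF2.comp (braidAut (sig j)).toMonoidHom =
      (AddMonoidHom.toMultiplicative
        (linearAction (cardanoFerrariB4 (sig j))).toAddEquiv.toAddMonoidHom).comp abF2 := by
    ext1 i
    fin_cases j <;> fin_cases i <;> apply Multiplicative.toAdd.injective <;>
      simp [braidAut_sig, abF2, linearAction_sig_zero, linearAction_sig_one]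
  exact congrArg Multiplicative.toAdd (DFunLike.congr_fun key x)

/-- The kernel of the action of `B₄` on `F₂` is generated by the full twist. -/
theorem braidAut_eq_one_iff {β : B4} : braidAut β = 1 ↔ ∃ n : ℤ, β = fullTwist4 ^ n := by
  constructor
  · intro h
    obtain ⟨x, hx⟩ := exists_eq_freeToB4_mul β
    have hl : linearAction (cardanoFerrariB4 β) = 1 := by
      have hv : ∀ v : ℤ × ℤ, ∃ y, (abF2 y).toAdd = v := by
        intro v
        refine ⟨FreeGroup.of 0 ^ v.1 * FreeGroup.of 1 ^ v.2, ?_⟩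
        simp [abF2]
      ext1 v
      obtain ⟨y, rfl⟩ := hv v
      rw [← abF2_braidAut, h]
      rfl
    obtain ⟨n, hn⟩ := eq_fullTwist3_zpow_of_linearAction hl
    have h0 : cardanoFerrariB4 (β * (fullTwist4 ^ n)⁻¹) = 1 := by
      rw [map_mul, map_inv, map_zpow, cardanoFerrariB4_fullTwist4, hn, zpow_mul, zpow_ofNat,
        mul_inv_cancel]
    obtain ⟨y, hy⟩ := exists_eq_freeToB4_mul (β * (fullTwist4 ^ n)⁻¹)
    rw [h0, map_one, mul_one] at hy
    have h1 : MulAut.conj y = 1 := by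
      rw [← braidAut_freeToB4, ← hy, map_mul, h, map_inv, map_zpow, braidAut_fullTwist4, one_zpow,
        inv_one, one_mul]
    have hy1 : y = 1 := F2_conj_injective (by rw [h1, map_one])
    rw [hy1, map_one, mul_inv_eq_one] at hy
    exact ⟨n, hy⟩
  · rintro ⟨n, rfl⟩
    rw [map_zpow, braidAut_fullTwist4, one_zpow]

/-- The exponent sum of a four-strand braid. -/
def expSum : B4 →* Multiplicative ℤ :=
  braidLift (fun _ => Multiplicative.ofAdd 1) (fun _ _ _ => rfl) (fun _ _ _ => rfl)

@[simp] theorem expSum_sig (i : Fin 3) : expSum (sig i) = Multiplicative.ofAdd 1 :=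
  braidLift_sig _ _ _ i

theorem expSum_fullTwist4 : expSum fullTwist4 = Multiplicative.ofAdd 12 := by
  simp [fullTwist4]; rfl

/-- Two braids on four strands are equal if they act in the same way on `F₂` and have the same
exponent sum. -/
theorem B4_ext {β γ : B4} (h : braidAut β = braidAut γ) (he : expSum β = expSum γ) : β = γ := by
  have h1 : braidAut (β * γ⁻¹) = 1 := by rw [map_mul, map_inv, h, mul_inv_cancel]
  obtain ⟨n, hn⟩ := braidAut_eq_one_iff.mp h1
  have h2 : expSum (β * γ⁻¹) = 1 := by rw [map_mul, map_inv, he, mul_inv_cancel]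
  rw [hn, map_zpow, expSum_fullTwist4] at h2
  have h3 : n * 12 = 0 := by
    have := congrArg Multiplicative.toAdd h2
    simpa using this
  have h4 : n = 0 := by omega
  rw [h4, zpow_zero, mul_inv_eq_one] at hn
  exact hn

/-! ### The center of the pure braid group on four strands -/

theorem braidPerm_fullTwist4 : braidPerm 3 fullTwist4 = 1 := by
  rw [fullTwist4, map_pow, map_mul, map_mul, braidPerm_sig, braidPerm_sig, braidPerm_sig]
  decide

/-- The full twist on four strands, as a pure braid. -/
def fullTwistP4 : P4 := ⟨fullTwist4, braidPerm_fullTwist4⟩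

theorem fullTwistP4_mem_center : fullTwistP4 ∈ Subgroup.center P4 :=
  Subgroup.mem_center_iff.mpr fun p => Subtype.ext (fullTwist4_comm p).symm.eq

theorem MulAut.eq_one_of_map_sq {φ : MulAut F2}
    (h : ∀ i, φ (FreeGroup.of i ^ 2) = FreeGroup.of i ^ 2) : φ = 1 := by
  have h' (i) : φ (FreeGroup.of i) = FreeGroup.of i := by
    have := h i
    rw [map_pow] at this
    exact pow_left_injective two_ne_zero this
  exact MulAut.ext_F2 (h' 0) (h' 1)

theorem freeToB4_sq_mem (i : Fin 2) : freeToB4 (FreeGroup.of i ^ 2) ∈ P4 := by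
  rw [MonoidHom.mem_ker, map_pow, map_pow]
  fin_cases i <;>
    simp only [freeToB4, FreeGroup.lift_apply_of, Fin.zero_eta, Fin.mk_one, Matrix.cons_val,
      map_mul, map_inv, braidPerm_sig] <;> decide

/-- A central pure braid fixes the squares of the generators of `F₂`, which are pure braids, and hence
it acts trivially on `F₂`. -/
theorem mem_center_P4_iff {p : P4} : p ∈ Subgroup.center P4 ↔ braidAut p = 1 := by
  constructor
  · intro hp
    refine MulAut.eq_one_of_map_sq fun i => freeToB4_injective ?_
    have := Subgroup.mem_center_iff.mp hp ⟨_, freeToB4_sq_mem i⟩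
    rw [freeToB4_braidAut, mul_inv_eq_iff_eq_mul]
    exact (congrArg Subtype.val this).symm
  · intro h
    obtain ⟨n, hn⟩ := braidAut_eq_one_iff.mp h
    have : p = fullTwistP4 ^ n := Subtype.ext hn
    rw [this]
    exact zpow_mem fullTwistP4_mem_center n

theorem mem_center_P4_iff_zpow {p : P4} :
    p ∈ Subgroup.center P4 ↔ ∃ n : ℤ, p = fullTwistP4 ^ n := by
  rw [mem_center_P4_iff, braidAut_eq_one_iff]
  exact exists_congr fun n => ⟨fun h => Subtype.ext h, fun h => congrArg Subtype.val h⟩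

/-- The embedding of `K₄` into `Aut(F₂)`. -/
def K4ToAut : K4 →* MulAut F2 :=
  QuotientGroup.lift _ (braidAut.comp P4.subtype) fun _ hp => mem_center_P4_iff.mp hp

theorem K4ToAut_mk (p : P4) : K4ToAut (toK4 p) = braidAut p := rfl

theorem K4ToAut_injective : Function.Injective K4ToAut := by
  rw [injective_iff_map_eq_one]
  intro k hk
  obtain ⟨p, rfl⟩ := QuotientGroup.mk'_surjective _ k
  exact (QuotientGroup.eq_one_iff p).mpr (mem_center_P4_iff.mpr hk)

/-! ### Pushing the fifth puncture -/

theorem artinAction_sig (j : Fin 3) : artinAction (sig j) = halfTwist j := braidLift_sig _ _ _ j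

theorem artinAction_sig_loop (j : Fin 3) (k : Fin 5) :
    artinAction (sig j) (loop k) = twistLoop j k := by
  rw [artinAction_sig, halfTwist_loop]

/-- The braid in which the `k`-th strand goes once around all the others. In `K₄`, which is the
mapping class group of the five-punctured sphere, it pushes the fifth puncture around the `k`-th
one. -/
def pushBraid : Fin 4 → B4 :=
  ![sig 0 * sig 1 * sig 2 * sig 2 * sig 1 * sig 0, sig 1 * sig 2 * sig 2 * sig 1 * sig 0 * sig 0,
    sig 2 * sig 2 * sig 1 * sig 0 * sig 0 * sig 1, sig 2 * sig 1 * sig 0 * sig 0 * sig 1 * sig 2]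

theorem expSum_pushBraid (k : Fin 4) : expSum (pushBraid k) = Multiplicative.ofAdd 6 := by
  fin_cases k <;> simp [pushBraid] <;> rfl

section

local notation "a" => (FreeGroup.of 0 : F2)
local notation "b" => (FreeGroup.of 1 : F2)

theorem braidAut_pushBraid_zero_a : braidAut (pushBraid 0) a = a * b⁻¹ * a⁻¹ * b * a⁻¹ := by
  simp [pushBraid, braidAut_sig, mul_assoc]
theorem braidAut_pushBraid_zero_b : braidAut (pushBraid 0) b = a * b⁻¹ * a⁻¹ := by
  simp [pushBraid, braidAut_sig, mul_assoc]
theorem braidAut_pushBraid_one_a : braidAut (pushBraid 1) a = b⁻¹ * a⁻¹ * b := by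
  simp [pushBraid, braidAut_sig, mul_assoc]
theorem braidAut_pushBraid_one_b : braidAut (pushBraid 1) b = b⁻¹ * a⁻¹ * b⁻¹ * a * b := by
  simp [pushBraid, braidAut_sig, mul_assoc]
theorem braidAut_pushBraid_two_a :
    braidAut (pushBraid 2) a = a⁻¹ * a⁻¹ * b * a⁻¹ * b⁻¹ * a * a := by
  simp [pushBraid, braidAut_sig, mul_assoc]
theorem braidAut_pushBraid_two_b :
    braidAut (pushBraid 2) b = a⁻¹ * a⁻¹ * b * a⁻¹ * b⁻¹ * a * b⁻¹ * a * a := by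
  simp [pushBraid, braidAut_sig, mul_assoc]
theorem braidAut_pushBraid_three_a : braidAut (pushBraid 3) a = a⁻¹ * b * a⁻¹ * b⁻¹ * a := by
  simp [pushBraid, braidAut_sig, mul_assoc]
theorem braidAut_pushBraid_three_b : braidAut (pushBraid 3) b = a⁻¹ * b⁻¹ * a := by
  simp [pushBraid, braidAut_sig, mul_assoc]

end

theorem braidAut_pushBraid_zero_mul_one :
    braidAut (pushBraid 0 * pushBraid 1) = MulAut.conj (FreeGroup.of 0 ^ 2) := by
  apply MulAut.ext_F2 <;> simp [braidAut_pushBraid_zero_a, braidAut_pushBraid_zero_b,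
    braidAut_pushBraid_one_a, braidAut_pushBraid_one_b, mul_assoc, pow_two]

theorem braidAut_pushBraid_two_mul_three :
    braidAut (pushBraid 2 * pushBraid 3) = MulAut.conj ((FreeGroup.of 0 ^ 2)⁻¹) := by
  apply MulAut.ext_F2 <;> simp [braidAut_pushBraid_two_a, braidAut_pushBraid_two_b,
    braidAut_pushBraid_three_a, braidAut_pushBraid_three_b, mul_assoc, pow_two]

theorem braidAut_pushBraid_one :
    braidAut (pushBraid 1) = MulAut.conj ((FreeGroup.of 1 ^ 2)⁻¹ * FreeGroup.of 0 ^ 2) *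
      braidAut (pushBraid 2) := by
  apply MulAut.ext_F2 <;> simp [braidAut_pushBraid_two_a, braidAut_pushBraid_two_b,
    braidAut_pushBraid_one_a, braidAut_pushBraid_one_b, mul_assoc, pow_two]

theorem braidAut_pushBraid_zero_sq :
    braidAut (pushBraid 0 * pushBraid 0) = MulAut.conj (FreeGroup.of 0 *
      (FreeGroup.of 1)⁻¹ * (FreeGroup.of 0)⁻¹ * FreeGroup.of 1) := by
  apply MulAut.ext_F2 <;> simp [braidAut_pushBraid_zero_a, braidAut_pushBraid_zero_b, mul_assoc]

theorem pushBraid_prod :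
    pushBraid 0 * pushBraid 1 * pushBraid 2 * pushBraid 3 = fullTwist4 ^ 2 := by
  apply B4_ext
  · rw [map_pow, braidAut_fullTwist4, one_pow, mul_assoc _ (pushBraid 2), map_mul,
      braidAut_pushBraid_zero_mul_one, braidAut_pushBraid_two_mul_three, ← map_mul, mul_inv_cancel,
      map_one]
  · apply Multiplicative.toAdd.injective
    simp [expSum_pushBraid, expSum_fullTwist4]

theorem pushBraid_succ (j : Fin 3) : sig j * pushBraid j.succ * (sig j)⁻¹ = pushBraid j.castSucc := by
  fin_cases j <;> simp [pushBraid, mul_assoc]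

theorem sig_conj_pushBraid (j : Fin 3) : sig j * pushBraid j.castSucc * (sig j)⁻¹ =
    pushBraid j.castSucc * pushBraid j.succ * (pushBraid j.castSucc)⁻¹ := by
  rw [eq_mul_inv_iff_mul_eq]
  apply B4_ext
  · apply MulAut.ext_F2 <;> fin_cases j <;> simp [braidAut_sig, braidAut_pushBraid_zero_a,
      braidAut_pushBraid_zero_b, braidAut_pushBraid_one_a, braidAut_pushBraid_one_b,
      braidAut_pushBraid_two_a, braidAut_pushBraid_two_b, braidAut_pushBraid_three_a,
      braidAut_pushBraid_three_b, mul_assoc]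
  · simp [expSum_pushBraid]

theorem sig_comm_pushBraid (j : Fin 3) (k : Fin 4) (h1 : k ≠ j.castSucc) (h2 : k ≠ j.succ) :
    Commute (sig j) (pushBraid k) := by
  apply B4_ext
  · apply MulAut.ext_F2 <;> fin_cases j <;> fin_cases k <;>
      first
      | exact absurd rfl h1
      | exact absurd rfl h2
      | simp [braidAut_sig, braidAut_pushBraid_zero_a,
          braidAut_pushBraid_zero_b, braidAut_pushBraid_one_a, braidAut_pushBraid_one_b,
          braidAut_pushBraid_two_a, braidAut_pushBraid_two_b, braidAut_pushBraid_three_a,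
          braidAut_pushBraid_three_b, mul_assoc]
  · rw [map_mul, map_mul, mul_comm]

/-- The homomorphism `π₁(S_{0,5}) → B₄` that lifts the point-pushing map. Its value on the loop
around the fifth puncture itself is central. -/
def pushHom : SpherePi 5 →* B4 :=
  sphereLift (Fin.lastCases ((fullTwist4 ^ 2)⁻¹) pushBraid) (by
    rw [List.ofFn_succ_last, ← pushBraid_prod]
    simp only [Fin.lastCases_castSucc, Fin.lastCases_last, List.prod_append, List.prod_singleton]
    simp only [List.ofFn_succ, List.ofFn_zero, List.prod_cons, List.prod_nil, mul_one]
    change pushBraid 0 * (pushBraid 1 * (pushBraid 2 * pushBraid 3)) * _ = 1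
    group)

@[simp] theorem pushHom_castSucc (k : Fin 4) : pushHom (loop k.castSucc) = pushBraid k := by
  rw [pushHom, sphereLift_loop, Fin.lastCases_castSucc]

theorem pushHom_last : pushHom (loop (Fin.last 4)) = (fullTwist4 ^ 2)⁻¹ := by
  rw [pushHom, sphereLift_loop, Fin.lastCases_last]

/-- Point pushing is equivariant: conjugating a push by a braid pushes along the image loop. -/
theorem pushHom_artinAction (β : B4) (x : SpherePi 5) :
    pushHom (artinAction β x) = β * pushHom x * β⁻¹ := by
  let H : Subgroup B4 :=
    { carrier := {β | ∀ x, pushHom (artinAction β x) = β * pushHom x * β⁻¹}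
      one_mem' := by intro x; simp
      mul_mem' := by
        intro b c hb hc x
        rw [map_mul, MulAut.mul_apply, hb, hc]
        group
      inv_mem' := by
        intro b hb x
        have h := hb ((artinAction b)⁻¹ x)
        rw [MulAut.apply_inv_self] at h
        rw [map_inv, h]
        group }
  refine braid_induction H (fun j x => ?_) β x
  have key : pushHom.comp (artinAction (sig j)).toMonoidHom =
      (MulAut.conj (sig j : B4)).toMonoidHom.comp pushHom := by
    apply sphere_hom_ext
    intro k
    simp only [MonoidHom.comp_apply, MulEquiv.coe_toMonoidHom, artinAction_sig_loop,
      MulAut.conj_apply]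
    induction k using Fin.lastCases with
    | last =>
      have h1 : twistLoop j (Fin.last 4) = loop (Fin.last 4) := by
        rw [← artinAction_sig_loop, artinAction_last]
      rw [h1, pushHom_last, ((fullTwist4_comm (sig j)).symm.pow_right 2).inv_right.eq,
        mul_inv_cancel_right]
    | cast k =>
      rw [pushHom_castSucc]
      by_cases h1 : k = j.castSucc
      · subst h1
        rw [sig_conj_pushBraid]
        rw [twistLoop, if_pos rfl, map_mul, map_mul, map_inv, pushHom_castSucc, pushHom_castSucc]
      · by_cases h2 : k = j.succ
        · subst h2
          rw [pushBraid_succ, twistLoop, if_neg (by simp [Fin.ext_iff]), if_pos rfl,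
            pushHom_castSucc]
        · rw [(sig_comm_pushBraid j k h1 h2).eq, mul_inv_cancel_right, twistLoop,
            if_neg fun h => h1 (Fin.castSucc_injective _ h),
            if_neg fun h => h2 (Fin.castSucc_injective _ h), pushHom_castSucc]
  exact DFunLike.congr_fun key x

theorem braidPerm_pushBraid (k : Fin 4) : braidPerm 3 (pushBraid k) = 1 := by
  fin_cases k <;> simp only [pushBraid, Fin.zero_eta, Fin.mk_one, Fin.reduceFinMk,
    Matrix.cons_val, map_mul, braidPerm_sig] <;> decide

theorem pushHom_mem (x : SpherePi 5) : pushHom x ∈ P4 := by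
  have h : (braidPerm 3).comp pushHom = 1 := by
    apply sphere_hom_ext
    intro k
    rw [MonoidHom.comp_apply, MonoidHom.one_apply]
    induction k using Fin.lastCases with
    | last => rw [pushHom_last, map_inv, map_pow, braidPerm_fullTwist4, one_pow, inv_one]
    | cast k => rw [pushHom_castSucc, braidPerm_pushBraid]
  exact DFunLike.congr_fun h x

/-- `pushHom` as a homomorphism to the pure braid group. -/
def pushP4 : SpherePi 5 →* P4 := pushHom.codRestrict P4 pushHom_mem

theorem toK4_pushP4_last : toK4 (pushP4 (loop (Fin.last 4))) = 1 := by
  refine (QuotientGroup.eq_one_iff _).mpr (mem_center_P4_iff_zpow.mpr ⟨-2, Subtype.ext ?_⟩)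
  change pushHom _ = fullTwist4 ^ (-2 : ℤ)
  rw [pushHom_last, zpow_neg, zpow_ofNat]

/-- The homomorphism out of `π₁(S_{0,n})` induced by one out of `π₁(S_{0,n+1})` that kills the loop
around the last puncture. -/
def fillLift {n : ℕ} {G : Type*} [Group G] (f : SpherePi (n + 1) →* G)
    (hf : f (loop (Fin.last n)) = 1) : SpherePi n →* G :=
  sphereLift (fun k => f (loop k.castSucc)) (by
    have h := congrArg f (loop_prod (n + 1))
    simp only [List.ofFn_succ_last, List.prod_append, map_mul, List.prod_singleton, map_one,
      hf, mul_one, map_list_prod, List.map_ofFn] at h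
    exact h)

theorem fillLift_fill {n : ℕ} {G : Type*} [Group G] (f : SpherePi (n + 1) →* G)
    (hf : f (loop (Fin.last n)) = 1) (x : SpherePi (n + 1)) :
    fillLift f hf (fillPuncture n x) = f x := by
  have h : (fillLift f hf).comp (fillPuncture n) = f := by
    apply sphere_hom_ext
    intro k
    rw [MonoidHom.comp_apply]
    induction k using Fin.lastCases with
    | last => rw [fillPuncture_last, map_one, hf]
    | cast k => rw [fillPuncture_castSucc, fillLift, sphereLift_loop]
  exact DFunLike.congr_fun h x

/-- The point-pushing map `π₁(S_{0,4}) → K₄`. -/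
def pushK4 : SpherePi 4 →* K4 := fillLift (toK4.comp pushP4) toK4_pushP4_last

theorem pushK4_fill (x : SpherePi 5) : pushK4 (fillPuncture 4 x) = toK4 (pushP4 x) :=
  fillLift_fill _ _ x

/-- The action of a pure braid on `π₁(S_{0,4})`, the last puncture being filled in. -/
def artinFill : P4 →* PureAut 4 := (forgetAut 4).comp artinPure

theorem artinFill_fill (p : P4) (x : SpherePi 5) :
    (artinFill p).1 (fillPuncture 4 x) = fillPuncture 4 (artinAction p x) :=
  forgetAut_fill (artinPure p) x

/-- `π₁(S_{0,5}) → F₃`: fill in the last puncture and eliminate the loop around the fourth one. -/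
def fillFree : SpherePi 5 →* FreeGroup (Fin 3) := (sphereFreeLast 3).toMonoidHom.comp (fillPuncture 4)

theorem fillFree_castSucc (k : Fin 3) : fillFree (loop k.castSucc.castSucc) = FreeGroup.of k := by
  rw [fillFree, MonoidHom.comp_apply, fillPuncture_castSucc]
  exact sphereFreeLast_castSucc k
theorem fillFree_zero : fillFree (loop 0) = FreeGroup.of 0 := fillFree_castSucc 0
theorem fillFree_one : fillFree (loop 1) = FreeGroup.of 1 := fillFree_castSucc 1
theorem fillFree_two : fillFree (loop 2) = FreeGroup.of 2 := fillFree_castSucc 2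
theorem fillFree_four : fillFree (loop 4) = 1 := by
  change (sphereFreeLast 3) (fillPuncture 4 (loop (Fin.last 4))) = 1
  rw [fillPuncture_last, map_one]
theorem fillFree_three :
    fillFree (loop 3) = (FreeGroup.of 0 * FreeGroup.of 1 * FreeGroup.of 2)⁻¹ := by
  have h := congrArg fillFree (loop_prod 5)
  simp only [List.ofFn_succ, List.ofFn_zero, List.prod_cons, List.prod_nil, map_mul, map_one] at h
  change fillFree (loop 0) * (fillFree (loop 1) * (fillFree (loop 2) * (fillFree (loop 3) *
    (fillFree (loop 4) * 1)))) = 1 at h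
  rw [fillFree_zero, fillFree_one, fillFree_two, fillFree_four] at h
  rw [← mul_inv_eq_one, inv_inv, mul_eq_one_comm]
  simpa [mul_assoc] using h

theorem loop_last_inv : (loop (Fin.last 4) : SpherePi 5)⁻¹ = loop 0 * loop 1 * loop 2 * loop 3 := by
  have h := loop_prod 5
  simp only [List.ofFn_succ, List.ofFn_zero, List.prod_cons, List.prod_nil] at h
  change loop 0 * (loop 1 * (loop 2 * (loop 3 * (loop (Fin.last 4) * 1)))) = 1 at h
  rw [inv_eq_iff_mul_eq_one, mul_eq_one_comm]
  simpa [mul_assoc] using h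

/-- The full twist acts as the conjugation by the inverse of the loop around the last puncture. -/
theorem artinAction_fullTwist4 :
    artinAction fullTwist4 = MulAut.conj (loop (Fin.last 4))⁻¹ := by
  apply MulEquiv.toMonoidHom_injective
  apply sphere_hom_ext
  intro k
  change artinAction fullTwist4 (loop k) = MulAut.conj (loop (Fin.last 4))⁻¹ (loop k)
  induction k using Fin.lastCases with
  | last => rw [artinAction_last, MulAut.conj_apply]; group
  | cast k =>
    rw [loop_last_inv]
    fin_cases k <;> simp [fullTwist4, pow_succ, artinAction_sig_loop, twistLoop, mul_assoc]

/-- A push acts on `π₁(S_{0,4})` as the conjugation by the loop along which it pushes. -/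
theorem artinFill_pushP4 (x : SpherePi 5) :
    (artinFill (pushP4 x)).1 = MulAut.conj (fillPuncture 4 x) := by
  have h : (PureAut 4).subtype.comp (artinFill.comp pushP4) = MulAut.conj.comp (fillPuncture 4) := by
    apply sphere_hom_ext
    intro k
    apply MulEquiv.toMonoidHom_injective
    apply sphere_hom_ext
    intro i
    have e : (artinFill (pushP4 (loop k))).1 (loop i) =
        fillPuncture 4 (artinAction (pushHom (loop k)) (loop i.castSucc)) :=
      (congrArg _ (fillPuncture_castSucc i).symm).trans (artinFill_fill _ _)
    change (artinFill (pushP4 (loop k))).1 (loop i) =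
      MulAut.conj (fillPuncture 4 (loop k)) (loop i)
    rw [e, MulAut.conj_apply, ← fillPuncture_castSucc i]
    apply (sphereFreeLast 3).injective
    rw [map_mul, map_mul, map_inv]
    change fillFree _ = fillFree _ * fillFree _ * (fillFree _)⁻¹
    induction k using Fin.lastCases with
    | last =>
      rw [pushHom_last, show fillFree (loop (Fin.last 4)) = 1 from fillFree_four, inv_one, one_mul,
        mul_one]
      rw [map_inv, map_pow, artinAction_fullTwist4, ← map_pow, ← map_inv, MulAut.conj_apply]
      have h4 : fillFree (loop (Fin.last 4)) = 1 := fillFree_four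
      simp only [map_mul, map_inv, map_pow, h4, inv_one, one_pow, one_mul, mul_one]
    | cast k =>
      rw [pushHom_castSucc]
      fin_cases k <;> fin_cases i <;>
        simp [pushBraid, artinAction_sig_loop, twistLoop, mul_assoc,
          fillFree_zero, fillFree_one, fillFree_two, fillFree_three]
  exact DFunLike.congr_fun h x

theorem artinFill_fullTwistP4 : artinFill fullTwistP4 = 1 := by
  apply Subtype.ext
  ext y
  obtain ⟨x, rfl⟩ := fillPuncture_surjective 4 y
  rw [artinFill_fill]
  change fillPuncture 4 (artinAction fullTwist4 x) = fillPuncture 4 x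
  rw [artinAction_fullTwist4, MulAut.conj_apply]
  simp only [map_mul, map_inv, fillPuncture_last, inv_one, one_mul, mul_one]

theorem artinFill_of_mem_center {p : P4} (hp : p ∈ Subgroup.center P4) : artinFill p = 1 := by
  obtain ⟨n, rfl⟩ := mem_center_P4_iff_zpow.mp hp
  rw [map_zpow, artinFill_fullTwistP4, one_zpow]

/-- The elements of `F₂` whose inner automorphisms are point pushes. -/
def pushInner : Subgroup F2 := (K4ToAut.comp pushK4).range.comap MulAut.conj

theorem mem_pushInner_iff {f : F2} :
    f ∈ pushInner ↔ ∃ x : SpherePi 5, braidAut (pushHom x) = MulAut.conj f := by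
  constructor
  · rintro ⟨y, hy⟩
    obtain ⟨x, rfl⟩ := fillPuncture_surjective 4 y
    refine ⟨x, ?_⟩
    rw [MonoidHom.comp_apply, pushK4_fill] at hy
    exact hy
  · rintro ⟨x, hx⟩
    refine ⟨fillPuncture 4 x, ?_⟩
    rw [MonoidHom.comp_apply, pushK4_fill]
    exact hx

instance : pushInner.Normal where
  conj_mem f hf g := by
    obtain ⟨x, hx⟩ := mem_pushInner_iff.mp hf
    refine mem_pushInner_iff.mpr ⟨artinAction (freeToB4 g) x, ?_⟩
    rw [pushHom_artinAction, map_mul, map_mul, map_inv, hx, braidAut_freeToB4]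
    simp

theorem of_zero_sq_mem_pushInner : FreeGroup.of 0 ^ 2 ∈ pushInner := by
  refine mem_pushInner_iff.mpr ⟨loop (Fin.castSucc 0) * loop (Fin.castSucc 1), ?_⟩
  rw [map_mul, pushHom_castSucc, pushHom_castSucc, braidAut_pushBraid_zero_mul_one]

theorem of_one_sq_mem_pushInner : FreeGroup.of 1 ^ 2 ∈ pushInner := by
  have h : (FreeGroup.of 1 ^ 2)⁻¹ * FreeGroup.of 0 ^ 2 ∈ pushInner := by
    refine mem_pushInner_iff.mpr ⟨loop (Fin.castSucc 1) * (loop (Fin.castSucc 2))⁻¹, ?_⟩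
    rw [map_mul, map_inv, pushHom_castSucc, pushHom_castSucc, map_mul, map_inv,
      braidAut_pushBraid_one, mul_inv_cancel_right]
  have := mul_mem of_zero_sq_mem_pushInner (inv_mem h)
  simpa using this

theorem commutator_mem_pushInner :
    FreeGroup.of 0 * (FreeGroup.of 1)⁻¹ * (FreeGroup.of 0)⁻¹ * FreeGroup.of 1 ∈ pushInner := by
  refine mem_pushInner_iff.mpr ⟨loop (Fin.castSucc 0) * loop (Fin.castSucc 0), ?_⟩
  rw [map_mul, pushHom_castSucc, braidAut_pushBraid_zero_sq]

/-- A pure braid that acts trivially on `π₁(S_{0,4})` is central: by equivariance it commutes with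
all the pushes, hence fixes the squares of the generators of `F₂`. -/
theorem mem_center_P4_of_artinFill {p : P4} (hp : artinFill p = 1) : p ∈ Subgroup.center P4 := by
  have hc (x : SpherePi 5) : braidAut p * braidAut (pushHom x) * (braidAut p)⁻¹ =
      braidAut (pushHom x) := by
    have h1 : toK4 (pushP4 (artinAction p x)) = toK4 (pushP4 x) := by
      rw [← pushK4_fill, ← pushK4_fill, ← artinFill_fill, hp]
      rfl
    have h2 := congrArg K4ToAut h1
    rw [K4ToAut_mk, K4ToAut_mk] at h2
    change braidAut (pushHom (artinAction p x)) = braidAut (pushHom x) at h2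
    rw [pushHom_artinAction, map_mul, map_mul, map_inv] at h2
    exact h2
  have key (f : F2) (hf : f ∈ pushInner) : braidAut p f = f := by
    obtain ⟨x, hx⟩ := mem_pushInner_iff.mp hf
    apply F2_conj_injective
    have h := hc x
    rw [hx] at h
    rw [← h]
    ext y
    simp
  refine mem_center_P4_iff.mpr (MulAut.eq_one_of_map_sq fun i => key _ ?_)
  fin_cases i
  · exact of_zero_sq_mem_pushInner
  · exact of_one_sq_mem_pushInner

theorem pushK4_injective : Function.Injective pushK4 := by
  rw [injective_iff_map_eq_one]
  intro y hy
  obtain ⟨x, rfl⟩ := fillPuncture_surjective 4 y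
  rw [pushK4_fill] at hy
  have h1 := artinFill_of_mem_center ((QuotientGroup.eq_one_iff _).mp hy)
  have h2 := artinFill_pushP4 x
  rw [h1] at h2
  have hc (k : Fin 4) : Commute (fillPuncture 4 x) (loop k) := by
    have := (DFunLike.congr_fun h2 (loop k)).symm
    rw [MulAut.conj_apply] at this
    exact mul_inv_eq_iff_eq_mul.mp this
  exact sphere_eq_one_of_commute (j := 0) (k := 1) (by decide) (hc _) (hc _)

/-! ### The fifth fiber -/

theorem freeToB4_mem_P4_of_mem_pushInner {f : F2} (hf : f ∈ pushInner) : freeToB4 f ∈ P4 := by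
  obtain ⟨x, hx⟩ := mem_pushInner_iff.mp hf
  have h : braidAut ((pushHom x)⁻¹ * freeToB4 f) = 1 := by
    rw [map_mul, map_inv, hx, braidAut_freeToB4, inv_mul_cancel]
  obtain ⟨n, hn⟩ := braidAut_eq_one_iff.mp h
  rw [inv_mul_eq_iff_eq_mul] at hn
  rw [hn]
  exact mul_mem (pushHom_mem x) (zpow_mem (show fullTwist4 ∈ P4 from braidPerm_fullTwist4) n)

/-- `F₂ ∩ P₄` is the kernel of a map from `F₂` onto the Klein four-group. It consists of point pushes:
these contain the squares and the commutator of the generators. -/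
theorem mem_pushInner_of_freeToB4_mem {f : F2} (hf : freeToB4 f ∈ P4) : f ∈ pushInner := by
  let q : F2 →* F2 ⧸ pushInner := QuotientGroup.mk' pushInner
  have h0 : q (FreeGroup.of 0) ^ 2 = 1 := by
    rw [← map_pow]; exact (QuotientGroup.eq_one_iff _).mpr of_zero_sq_mem_pushInner
  have h1 : q (FreeGroup.of 1) ^ 2 = 1 := by
    rw [← map_pow]; exact (QuotientGroup.eq_one_iff _).mpr of_one_sq_mem_pushInner
  have hc : Commute (q (FreeGroup.of 0)) (q (FreeGroup.of 1)) := by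
    have h2 : q (FreeGroup.of 0 * (FreeGroup.of 1)⁻¹ * (FreeGroup.of 0)⁻¹ * FreeGroup.of 1) = 1 :=
      (QuotientGroup.eq_one_iff _).mpr commutator_mem_pushInner
    rw [map_mul, map_mul, map_mul, map_inv, map_inv] at h2
    have h3 : Commute (q (FreeGroup.of 0)) (q (FreeGroup.of 1))⁻¹ := by
      rw [mul_assoc, mul_eq_one_iff_eq_inv, mul_inv_rev, inv_inv] at h2
      exact h2
    exact Commute.inv_right_iff.mp h3
  let S : Subgroup F2 :=
    { carrier := {f | ∃ m n : ℤ, q f = q (FreeGroup.of 0 ^ m * FreeGroup.of 1 ^ n)}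
      one_mem' := ⟨0, 0, by simp⟩
      mul_mem' := by
        rintro f g ⟨m, n, hf⟩ ⟨m', n', hg⟩
        refine ⟨m + m', n + n', ?_⟩
        rw [map_mul, hf, hg]
        simp only [map_mul, map_zpow, zpow_add]
        exact ((hc.symm.zpow_zpow n m')).mul_mul_mul_comm _ _
      inv_mem' := by
        rintro f ⟨m, n, hf⟩
        refine ⟨-m, -n, ?_⟩
        rw [map_inv, hf]
        simp only [map_mul, map_zpow, zpow_neg, mul_inv_rev]
        exact (hc.symm.zpow_zpow n m).inv_inv.eq }
  have hS : S = ⊤ := by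
    rw [eq_top_iff, ← FreeGroup.closure_range_of, Subgroup.closure_le]
    rintro _ ⟨i, rfl⟩
    fin_cases i
    · exact ⟨1, 0, by simp⟩
    · exact ⟨0, 1, by simp⟩
  obtain ⟨m, n, hmn⟩ : f ∈ S := hS ▸ Subgroup.mem_top f
  -- Reduce the exponents modulo two, and compare the permutations.
  have hz {x : F2} (hx : q x ^ 2 = 1) (m : ℤ) : ∃ c : ℤ, (c = 0 ∨ c = 1) ∧ q x ^ m = q x ^ c := by
    rcases Int.even_or_odd' m with ⟨c, rfl | rfl⟩
    · exact ⟨0, Or.inl rfl, by rw [zpow_mul, zpow_ofNat, hx, one_zpow, zpow_zero]⟩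
    · exact ⟨1, Or.inr rfl, by rw [zpow_add, zpow_mul, zpow_ofNat, hx, one_zpow, one_mul]⟩
  obtain ⟨c, hc, hmc⟩ := hz h0 m
  obtain ⟨d, hd, hnd⟩ := hz h1 n
  rw [map_mul, map_zpow, map_zpow, hmc, hnd, ← map_zpow, ← map_zpow, ← map_mul] at hmn
  have hM : (FreeGroup.of 0 ^ c * FreeGroup.of 1 ^ d)⁻¹ * f ∈ pushInner := by
    rw [← QuotientGroup.eq_one_iff]
    change q _ = 1
    rw [map_mul, hmn, map_inv, inv_mul_cancel]
  have hp := mul_mem hf (inv_mem (freeToB4_mem_P4_of_mem_pushInner hM))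
  rw [← map_inv, ← map_mul, mul_inv_rev, inv_inv, mul_inv_cancel_left, MonoidHom.mem_ker] at hp
  rcases hc with rfl | rfl <;> rcases hd with rfl | rfl
  · simpa using hM
  all_goals
    exfalso
    simp only [freeToB4, zpow_zero, zpow_one, mul_one, one_mul, map_mul, map_inv,
      FreeGroup.lift_apply_of, Matrix.cons_val, braidPerm_sig] at hp
    revert hp
    decide

theorem cardanoFerrari_coe (p : P4) : (cardanoFerrari p : B3) = cardanoFerrariB4 p := rfl

theorem cardanoFerrariB4_pushBraid (k : Fin 4) : cardanoFerrariB4 (pushBraid k) = fullTwist3 := by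
  have h0 : cardanoFerrariB4 (pushBraid 0) = fullTwist3 := by
    simp [pushBraid, fullTwist3, pow_two, mul_assoc]
  have hs (j : Fin 3) (h : cardanoFerrariB4 (pushBraid j.castSucc) = fullTwist3) :
      cardanoFerrariB4 (pushBraid j.succ) = fullTwist3 := by
    have h1 := congrArg cardanoFerrariB4 (pushBraid_succ j)
    rw [h, map_mul, map_mul, map_inv, mul_inv_eq_iff_eq_mul, (fullTwist3_comm _).eq,
      mul_right_inj] at h1
    exact h1
  induction k using Fin.induction with
  | zero => exact h0
  | succ j ih => exact hs j ih

theorem cardanoFerrari_pushP4_mem (x : SpherePi 5) : toK3 (cardanoFerrari (pushP4 x)) = 1 := by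
  have h : (toK3.comp cardanoFerrari).comp pushP4 = 1 := by
    apply sphere_hom_ext
    intro k
    refine (QuotientGroup.eq_one_iff _).mpr (mem_center_P3_iff.mpr ?_)
    induction k using Fin.lastCases with
    | last =>
      refine ⟨-4, Subtype.ext ?_⟩
      rw [cardanoFerrari_coe, Subgroup.coe_zpow]
      change cardanoFerrariB4 (pushHom (loop (Fin.last 4))) = fullTwist3 ^ (-4 : ℤ)
      rw [pushHom_last, map_inv, map_pow, cardanoFerrariB4_fullTwist4, ← pow_mul, zpow_neg,
        zpow_ofNat]
    | cast k =>
      refine ⟨1, Subtype.ext ?_⟩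
      rw [cardanoFerrari_coe, Subgroup.coe_zpow]
      change cardanoFerrariB4 (pushHom (loop k.castSucc)) = fullTwist3 ^ (1 : ℤ)
      rw [pushHom_castSucc, cardanoFerrariB4_pushBraid, zpow_one]
  exact DFunLike.congr_fun h x

/-- The kernel of the map `K₄ → K₃` induced by the Cardano–Ferrari epimorphism consists of the point
pushes. -/
theorem toK4_mem_range_pushK4_iff {p : P4} :
    toK4 p ∈ pushK4.range ↔ toK3 (cardanoFerrari p) = 1 := by
  constructor
  · rintro ⟨y, hy⟩
    obtain ⟨x, rfl⟩ := fillPuncture_surjective 4 y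
    rw [pushK4_fill] at hy
    have h1 : (pushP4 x)⁻¹ * p ∈ Subgroup.center P4 := QuotientGroup.eq.mp hy
    obtain ⟨n, hn⟩ := mem_center_P4_iff_zpow.mp h1
    rw [inv_mul_eq_iff_eq_mul] at hn
    have h2 : toK3 (cardanoFerrari fullTwistP4) = 1 := by
      refine (QuotientGroup.eq_one_iff _).mpr (mem_center_P3_iff.mpr ⟨2, Subtype.ext ?_⟩)
      exact cardanoFerrariB4_fullTwist4
    rw [hn, map_mul, map_mul, cardanoFerrari_pushP4_mem, map_zpow, map_zpow, h2, one_zpow, one_mul]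
  · intro hp
    obtain ⟨n, hn⟩ := mem_center_P3_iff.mp ((QuotientGroup.eq_one_iff _).mp hp)
    let x : SpherePi 5 := loop (Fin.castSucc 0) ^ n
    have hx : pushHom x = pushBraid 0 ^ n := by rw [map_zpow, pushHom_castSucc]
    obtain ⟨f, hf⟩ := exists_eq_freeToB4_mul ((pushP4 x)⁻¹ * p : P4)
    have h1 : cardanoFerrariB4 ((pushP4 x)⁻¹ * p : P4) = 1 := by
      change cardanoFerrariB4 ((pushHom x)⁻¹ * p) = 1
      rw [map_mul, map_inv, hx, map_zpow, cardanoFerrariB4_pushBraid, ← cardanoFerrari_coe, hn]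
      exact inv_mul_cancel _
    rw [h1, map_one, mul_one] at hf
    have h2 : f ∈ pushInner := mem_pushInner_of_freeToB4_mem (hf ▸ ((pushP4 x)⁻¹ * p : P4).2)
    obtain ⟨y, hy⟩ := h2
    have h3 : pushK4 y = toK4 ((pushP4 x)⁻¹ * p) := by
      apply K4ToAut_injective
      rw [K4ToAut_mk, hf, braidAut_freeToB4]
      exact hy
    refine ⟨fillPuncture 4 x * y, ?_⟩
    rw [map_mul, h3, pushK4_fill, ← map_mul, mul_inv_cancel_left]

/-! ### Strand deletion -/

theorem braidDelete_mul (β γ : B4) (i : Fin 4) : (braidDelete (β * γ)).left i =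
    (braidDelete β).left i * (braidDelete γ).left ((braidPerm 3 β)⁻¹ i) := by
  rw [map_mul, SemidirectProduct.mul_left, Pi.mul_apply, arrow_apply, braidDelete_right]
  rfl

theorem braidDelete_inv (β : B4) (i : Fin 4) :
    (braidDelete β⁻¹).left i = ((braidDelete β).left (braidPerm 3 β i))⁻¹ := by
  rw [map_inv, SemidirectProduct.inv_left, braidDelete_right]
  rfl

theorem braidDelete_sig_left (j : Fin 3) (i : Fin 4) :
    (braidDelete (sig j)).left i = deleteCrossing j i := by
  rw [braidDelete_sig]

theorem strandForget_coe (i : Fin 4) (p : P4) :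
    (strandForget i p : B3) = (braidDelete p).left i := rfl

theorem braidPerm_addStrand_last (b : B3) : braidPerm 3 (addStrand b) 3 = 3 := by
  let H : Subgroup B3 := (MulAction.stabilizer (Equiv.Perm (Fin 4)) (3 : Fin 4)).comap
    ((braidPerm 3).comp addStrand)
  refine braid_induction H (fun i => ?_) b
  change braidPerm 3 (addStrand (sig i)) 3 = 3
  fin_cases i
  · change braidPerm 3 (addStrand (sig 0)) 3 = 3
    rw [addStrand_sig_zero, braidPerm_sig]; rfl
  · change braidPerm 3 (addStrand (sig 1)) 3 = 3
    rw [addStrand_sig_one, braidPerm_sig]; rfl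

theorem braidDelete_addStrand (b : B3) : (braidDelete (addStrand b)).left 3 = b := by
  have hp (c : B3) : (braidPerm 3 (addStrand c))⁻¹ 3 = 3 := by
    rw [Equiv.Perm.inv_eq_iff_eq, braidPerm_addStrand_last]
  let H : Subgroup B3 :=
    { carrier := {b | (braidDelete (addStrand b)).left 3 = b}
      one_mem' := by simp
      mul_mem' := by
        intro b c hb hc
        change (braidDelete (addStrand b)).left 3 = b at hb
        change (braidDelete (addStrand c)).left 3 = c at hc
        change (braidDelete (addStrand (b * c))).left 3 = b * c
        rw [map_mul, braidDelete_mul, hp, hb, hc]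
      inv_mem' := by
        intro b hb
        change (braidDelete (addStrand b)).left 3 = b at hb
        change (braidDelete (addStrand b⁻¹)).left 3 = b⁻¹
        rw [map_inv, braidDelete_inv, braidPerm_addStrand_last, hb] }
  refine braid_induction H (fun i => ?_) b
  change (braidDelete (addStrand (sig i))).left 3 = sig i
  fin_cases i
  · change (braidDelete (addStrand (sig 0))).left 3 = sig 0
    rw [addStrand_sig_zero, braidDelete_sig]; rfl
  · change (braidDelete (addStrand (sig 1))).left 3 = sig 1
    rw [addStrand_sig_one, braidDelete_sig]; rfl

theorem addStrand_mem (q : P3) : addStrand q ∈ P4 := by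
  rw [MonoidHom.mem_ker]
  ext1 k
  induction k using Fin.lastCases with
  | last => exact braidPerm_addStrand_last q
  | cast k =>
    have h := braidPerm_delete (addStrand q) 3 k
    rw [braidDelete_addStrand, MonoidHom.mem_ker.mp q.2, show (braidPerm 3 (addStrand q))⁻¹ 3 = 3 by
      rw [Equiv.Perm.inv_eq_iff_eq, braidPerm_addStrand_last]] at h
    have e : (3 : Fin 4).succAbove k = k.castSucc := Fin.succAbove_last_apply k
    rw [e] at h
    exact h.symm.trans e

/-- `addStrand` on pure braids. -/
def addStrandP : P3 →* P4 := (addStrand.comp P3.subtype).codRestrict P4 addStrand_mem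

theorem addStrandP_coe (q : P3) : (addStrandP q : B4) = addStrand q := rfl

@[simp] theorem strandForget_addStrandP (q : P3) : strandForget 3 (addStrandP q) = q :=
  Subtype.ext (braidDelete_addStrand q)

@[simp] theorem cardanoFerrari_addStrandP (q : P3) : cardanoFerrari (addStrandP q) = q :=
  Subtype.ext (cardanoFerrariB4_addStrand q)

/-! ### The kernel of the map that forgets the last strand -/

/-- The pure braid in which the last strand goes around the strand `i`. -/
def lastTwist : Fin 3 → B4 :=
  ![sig 2 * sig 1 * sig 0 * sig 0 * (sig 1)⁻¹ * (sig 2)⁻¹, sig 2 * sig 1 * sig 1 * (sig 2)⁻¹,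
    sig 2 * sig 2]

theorem braidPerm_lastTwist (i : Fin 3) : braidPerm 3 (lastTwist i) = 1 := by
  fin_cases i <;> simp only [lastTwist, Fin.zero_eta, Fin.mk_one, Fin.reduceFinMk,
    Matrix.cons_val, map_mul, map_inv, braidPerm_sig] <;> decide

theorem braidDelete_lastTwist (i : Fin 3) : (braidDelete (lastTwist i)).left 3 = 1 := by
  fin_cases i <;> simp only [lastTwist, Fin.zero_eta, Fin.mk_one, Fin.reduceFinMk,
    Matrix.cons_val, braidDelete_mul, braidDelete_inv, braidDelete_sig_left] <;>
    simp [braidPerm_sig, deleteCrossing]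

/-- The homomorphism from `F₃` to the kernel of the map that forgets the last strand. -/
def lastTwistHom : FreeGroup (Fin 3) →* P4 :=
  FreeGroup.lift fun i => ⟨lastTwist i, braidPerm_lastTwist i⟩

theorem lastTwistHom_of (i : Fin 3) : (lastTwistHom (FreeGroup.of i) : B4) = lastTwist i := by
  simp [lastTwistHom]

theorem strandForget_lastTwistHom (w : FreeGroup (Fin 3)) :
    strandForget 3 (lastTwistHom w) = 1 := by
  have h : (strandForget 3).comp lastTwistHom = 1 := by
    ext1 i
    apply Subtype.ext
    rw [MonoidHom.comp_apply, strandForget_coe, lastTwistHom_of, braidDelete_lastTwist]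
    rfl
  exact DFunLike.congr_fun h w

theorem sig_conj_lastTwist (j : Fin 2) :
    sig j.castSucc * lastTwist j.castSucc * (sig j.castSucc)⁻¹ = lastTwist j.succ := by
  apply B4_ext
  · apply MulAut.ext_F2 <;> fin_cases j <;> simp [lastTwist, braidAut_sig, mul_assoc]
  · fin_cases j <;> simp [lastTwist]

theorem sig_comm_lastTwist_mul (j : Fin 2) :
    Commute (sig j.castSucc) (lastTwist j.castSucc * lastTwist j.succ) := by
  apply B4_ext
  · apply MulAut.ext_F2 <;> fin_cases j <;> simp [lastTwist, braidAut_sig, mul_assoc]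
  · rw [map_mul, map_mul _ (_ * _), mul_comm]

theorem sig_comm_lastTwist (j : Fin 2) (i : Fin 3) (h1 : i ≠ j.castSucc) (h2 : i ≠ j.succ) :
    Commute (sig j.castSucc) (lastTwist i) := by
  apply B4_ext
  · apply MulAut.ext_F2 <;> fin_cases j <;> fin_cases i <;>
      first
      | exact absurd rfl h1
      | exact absurd rfl h2
      | simp [lastTwist, braidAut_sig, mul_assoc]
  · rw [map_mul, map_mul, mul_comm]

theorem addStrand_sig (j : Fin 2) : addStrand (sig j) = sig j.castSucc := by
  fin_cases j
  · exact addStrand_sig_zero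
  · exact addStrand_sig_one

theorem addStrand_range_le_normalizer : addStrand.range ≤
    Subgroup.normalizer (Subgroup.closure (Set.range lastTwist) : Set B4) := by
  have hm (i : Fin 3) : lastTwist i ∈ Subgroup.closure (Set.range lastTwist) :=
    Subgroup.subset_closure ⟨i, rfl⟩
  rintro _ ⟨b, rfl⟩
  change b ∈ (Subgroup.normalizer (Subgroup.closure (Set.range lastTwist) : Set B4)).comap addStrand
  refine braid_induction _ (fun j => ?_) b
  rw [Subgroup.mem_comap, addStrand_sig]
  have hc1 := sig_conj_lastTwist j
  have hc2 := sig_comm_lastTwist_mul j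
  refine mem_normalizer_closure ?_ ?_
  · rintro _ ⟨i, rfl⟩
    by_cases h1 : i = j.castSucc
    · rw [h1, hc1]; exact hm _
    · by_cases h2 : i = j.succ
      · have e : sig j.castSucc * lastTwist j.succ * (sig j.castSucc)⁻¹ =
            (lastTwist j.succ)⁻¹ * lastTwist j.castSucc * lastTwist j.succ := by
          nth_rw 2 [← hc1]
          have := hc2.eq
          rw [mul_assoc _ (lastTwist j.castSucc), ← mul_inv_eq_iff_eq_mul.mpr this]
          group
        rw [h2, e]
        exact mul_mem (mul_mem (inv_mem (hm _)) (hm _)) (hm _)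
      · rw [(sig_comm_lastTwist j i h1 h2).eq, mul_inv_cancel_right]; exact hm _
  · rintro _ ⟨i, rfl⟩
    by_cases h2 : i = j.succ
    · rw [h2, ← hc1]
      convert hm j.castSucc using 1
      group
    · by_cases h1 : i = j.castSucc
      · have e : (sig j.castSucc)⁻¹ * lastTwist j.castSucc * sig j.castSucc =
            lastTwist j.castSucc * lastTwist j.succ * (lastTwist j.castSucc)⁻¹ := by
          rw [eq_mul_inv_iff_mul_eq, mul_assoc, mul_assoc, inv_mul_eq_iff_eq_mul, hc2.eq, ← hc1]
          group
        rw [h1, e]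
        exact mul_mem (mul_mem (hm _) (hm _)) (inv_mem (hm _))
      · rw [mul_assoc, ← (sig_comm_lastTwist j i h1 h2).eq, inv_mul_cancel_left]; exact hm _

/-- Combing the last strand: a pure braid on four strands is the product of a braid in which only
the last strand moves and of a braid on the other strands. -/
theorem exists_eq_lastTwistHom_mul (p : P4) :
    ∃ w, p = lastTwistHom w * addStrandP (strandForget 3 p) := by
  let U := Subgroup.closure (Set.range lastTwist)
  have hm (i : Fin 3) : lastTwist i ∈ U ⊔ addStrand.range :=
    Subgroup.mem_sup_left (Subgroup.subset_closure ⟨i, rfl⟩)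
  have hs (j : Fin 2) : (sig j.castSucc : B4) ∈ U ⊔ addStrand.range :=
    Subgroup.mem_sup_right ⟨sig j, addStrand_sig j⟩
  have h01 : (sig 0 * sig 1 * sig 0 : B4) = sig 1 * sig 0 * sig 1 := sig_braid (0 : Fin 3) 1 rfl
  have h12 : (sig 1 * sig 2 * sig 1 : B4) = sig 2 * sig 1 * sig 2 := sig_braid (1 : Fin 3) 2 rfl
  have h02 : (sig 0 * sig 2 : B4) = sig 2 * sig 0 := sig_comm (0 : Fin 3) 2 (by decide)
  have hp : (p : B4) ∈ U ⊔ addStrand.range := by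
    refine mem_of_transversal _ ![sig 2 * sig 1 * sig 0, sig 2 * sig 1, sig 2, 1] (k₀ := 3) rfl ?_
      (by rw [MonoidHom.mem_ker.mp p.2]; rfl)
    intro j k
    fin_cases j <;> fin_cases k
    · change sig 2 * sig 1 * sig 0 * sig 0 * (sig 2 * sig 1)⁻¹ ∈ _
      simpa [lastTwist, mul_assoc] using hm 0
    · change sig 2 * sig 1 * sig 0 * (sig 2 * sig 1 * sig 0)⁻¹ ∈ _
      simp
    · change sig 2 * sig 0 * (sig 2)⁻¹ ∈ _
      rw [← h02, mul_inv_cancel_right]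
      exact hs 0
    · change 1 * sig 0 * 1⁻¹ ∈ _
      simpa using hs 0
    · change sig 2 * sig 1 * sig 0 * sig 1 * (sig 2 * sig 1 * sig 0)⁻¹ ∈ _
      convert hs 0 using 1
      rw [mul_inv_eq_iff_eq_mul, mul_assoc (sig 2), mul_assoc (sig 2), ← h01]
      simp only [← mul_assoc]
      rw [← h02]; rfl
    · change sig 2 * sig 1 * sig 1 * (sig 2)⁻¹ ∈ _
      exact hm 1
    · change sig 2 * sig 1 * (sig 2 * sig 1)⁻¹ ∈ _
      simp
    · change 1 * sig 1 * 1⁻¹ ∈ _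
      simpa using hs 1
    · change sig 2 * sig 1 * sig 0 * sig 2 * (sig 2 * sig 1 * sig 0)⁻¹ ∈ _
      convert hs 1 using 1
      rw [mul_inv_eq_iff_eq_mul, mul_assoc _ (sig 0), h02, ← mul_assoc, ← h12]
      simp only [mul_assoc]; rfl
    · change sig 2 * sig 1 * sig 2 * (sig 2 * sig 1)⁻¹ ∈ _
      convert hs 1 using 1
      rw [mul_inv_eq_iff_eq_mul, ← h12]
      simp only [mul_assoc]; rfl
    · change sig 2 * sig 2 * 1⁻¹ ∈ _
      simpa [lastTwist] using hm 2
    · change 1 * sig 2 * (sig 2)⁻¹ ∈ _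
      simp
  obtain ⟨u, hu, _, ⟨c, rfl⟩, hp⟩ := exists_mul_of_mem_sup addStrand_range_le_normalizer hp
  obtain ⟨w, rfl⟩ : ∃ w, (lastTwistHom w : B4) = u := by
    have : U ≤ (P4.subtype.comp lastTwistHom).range := by
      rw [Subgroup.closure_le]
      rintro _ ⟨i, rfl⟩
      exact ⟨FreeGroup.of i, lastTwistHom_of i⟩
    exact this hu
  refine ⟨w, Subtype.ext ?_⟩
  rw [Subgroup.coe_mul, addStrandP_coe, strandForget_coe, ← hp, braidDelete_mul,
    MonoidHom.mem_ker.mp (lastTwistHom w).2, ← strandForget_coe, strandForget_lastTwistHom]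
  rw [inv_one, Equiv.Perm.one_apply, braidDelete_addStrand]
  simp

theorem eq_lastTwistHom_of_strandForget {p : P4} (hp : strandForget 3 p = 1) :
    ∃ w, p = lastTwistHom w := by
  obtain ⟨w, hw⟩ := exists_eq_lastTwistHom_mul p
  exact ⟨w, by rw [hw, hp, map_one, mul_one]⟩

/-- The values of the homomorphism `fillFourth` on the loops. -/
def fourthLoop : Fin 5 → FreeGroup (Fin 3) :=
  let y : Fin 3 → FreeGroup (Fin 3) := FreeGroup.of
  ![(y 2)⁻¹ * (y 1)⁻¹ * (y 0)⁻¹ * y 1 * y 2, (y 2)⁻¹ * (y 1)⁻¹ * y 2, (y 2)⁻¹, 1, y 0 * y 1 * y 2]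

theorem fourthLoop_prod : (List.ofFn fourthLoop).prod = 1 := by
  simp only [List.ofFn_succ, List.ofFn_zero, List.prod_cons, List.prod_nil]
  simp [fourthLoop, mul_assoc]

/-- `π₁(S_{0,5}) → F₃`: fill in the fourth puncture. The basis of the target is chosen such that
the twist of the last strand around the strand `i` pushes this puncture along the generator `i`. -/
def fillFourth : SpherePi 5 →* FreeGroup (Fin 3) := sphereLift fourthLoop fourthLoop_prod

theorem fillFourth_loop (k : Fin 5) : fillFourth (loop k) = fourthLoop k :=
  sphereLift_loop _ fourthLoop_prod k

theorem fillFourth_lastTwist (i : Fin 3) (x : SpherePi 5) :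
    fillFourth (artinAction (lastTwist i) x) = fillFourth x := by
  have h : fillFourth.comp (artinAction (lastTwist i)).toMonoidHom = fillFourth := by
    apply sphere_hom_ext
    intro k
    change fillFourth (artinAction (lastTwist i) (loop k)) = _
    fin_cases i <;> fin_cases k <;>
      simp [lastTwist, artinAction_sig, halfTwist, twistLoop, twistInvLoop, mul_assoc,
        fillFourth_loop, fourthLoop]
  exact DFunLike.congr_fun h x

/-- A braid in which only the last strand moves acts trivially on `π₁` of the sphere with the fourth
puncture filled in, and it conjugates the loop around this puncture by a path that lifts the loop
along which the strand moves. -/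
theorem artinAction_lastTwistHom (w : FreeGroup (Fin 3)) :
    (∀ x, fillFourth (artinAction (lastTwistHom w) x) = fillFourth x) ∧
    ∃ g, artinAction (lastTwistHom w) (loop 3) = g⁻¹ * loop 3 * g ∧ fillFourth g = w := by
  let S : Subgroup (FreeGroup (Fin 3)) :=
    { carrier := {w | (∀ x, fillFourth (artinAction (lastTwistHom w) x) = fillFourth x) ∧
        ∃ g, artinAction (lastTwistHom w) (loop 3) = g⁻¹ * loop 3 * g ∧ fillFourth g = w}
      one_mem' := ⟨by intro x; simp, 1, by simp, by simp⟩
      mul_mem' := by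
        rintro v w ⟨hv, g, hg, hgv⟩ ⟨hw, h, hh, hhw⟩
        refine ⟨fun x => ?_, g * artinAction (lastTwistHom v) h, ?_, ?_⟩
        · rw [map_mul, Subgroup.coe_mul, map_mul, MulAut.mul_apply, hv, hw]
        · rw [map_mul, Subgroup.coe_mul, map_mul, MulAut.mul_apply, hh, map_mul, map_mul, map_inv,
            hg]
          group
        · rw [map_mul, hv, hgv, hhw]
      inv_mem' := by
        rintro v ⟨hv, g, hg, hgv⟩
        have hi (x) : fillFourth ((artinAction (lastTwistHom v))⁻¹ x) = fillFourth x := by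
          rw [← hv, MulAut.apply_inv_self]
        refine ⟨fun x => ?_, ((artinAction (lastTwistHom v))⁻¹ g)⁻¹, ?_, ?_⟩
        · rw [map_inv, Subgroup.coe_inv, map_inv, hi]
        · rw [map_inv, Subgroup.coe_inv, map_inv]
          apply (artinAction (lastTwistHom v)).injective
          rw [MulAut.apply_inv_self, map_mul, map_mul, map_inv, map_inv, MulAut.apply_inv_self, hg]
          group
        · rw [map_inv, hi, hgv] }
  have hS : S = ⊤ := by
    rw [eq_top_iff, ← FreeGroup.closure_range_of, Subgroup.closure_le]
    rintro _ ⟨i, rfl⟩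
    refine ⟨fun x => by rw [lastTwistHom_of, fillFourth_lastTwist], ?_⟩
    rw [lastTwistHom_of]
    fin_cases i
    · refine ⟨(loop 2)⁻¹ * (loop 1)⁻¹ * (loop 0)⁻¹ * loop 1 * loop 2, ?_, ?_⟩
      · simp [lastTwist, artinAction_sig, halfTwist, twistLoop, twistInvLoop, mul_assoc]
      · simp [fillFourth_loop, fourthLoop, mul_assoc]
    · refine ⟨(loop 2)⁻¹ * (loop 1)⁻¹ * loop 2, ?_, ?_⟩
      · simp [lastTwist, artinAction_sig, halfTwist, twistLoop, twistInvLoop, mul_assoc]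
      · simp [fillFourth_loop, fourthLoop, mul_assoc]
    · refine ⟨(loop 2)⁻¹, ?_, ?_⟩
      · simp [lastTwist, artinAction_sig, halfTwist, twistLoop, mul_assoc]
      · simp [fillFourth_loop, fourthLoop, mul_assoc]
  have : w ∈ S := hS ▸ Subgroup.mem_top w
  exact this

/-- The path of `artinAction_lastTwistHom` recovers the word `w`. -/
theorem lastTwistHom_injective : Function.Injective lastTwistHom := by
  rw [injective_iff_map_eq_one]
  intro w hw
  obtain ⟨-, g, hg, hgw⟩ := artinAction_lastTwistHom w
  rw [hw, Subgroup.coe_one, map_one, MulAut.one_apply] at hg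
  have hc : Commute g (loop (Fin.succ 2)) := by
    rw [mul_assoc, eq_inv_mul_iff_mul_eq] at hg
    exact hg
  obtain ⟨n, hn⟩ := mem_zpowers_loop_of_commute (2 : Fin 4) g hc
  rw [← hgw, ← hn]
  change fillFourth (loop 3 ^ n) = 1
  rw [map_zpow, fillFourth_loop]
  exact one_zpow n

/-! ### The maps `K₄ → K₃` -/

theorem fullTwist4_eq : fullTwist4 =
    (lastTwistHom (FreeGroup.of 0 * FreeGroup.of 1 * FreeGroup.of 2) : B4) *
      addStrand fullTwist3 := by
  rw [map_mul, map_mul, Subgroup.coe_mul, Subgroup.coe_mul, lastTwistHom_of, lastTwistHom_of,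
    lastTwistHom_of]
  apply B4_ext
  · rw [braidAut_fullTwist4]
    apply MulAut.ext_F2 <;>
      simp [lastTwist, fullTwist3, braidAut_sig, mul_assoc, pow_two]
  · rw [expSum_fullTwist4]
    apply Multiplicative.toAdd.injective
    simp [lastTwist, fullTwist3]

theorem strandForget_last_fullTwistP4 : strandForget 3 fullTwistP4 = fullTwistP3 := by
  have h : fullTwistP4 = lastTwistHom (FreeGroup.of 0 * FreeGroup.of 1 * FreeGroup.of 2) *
      addStrandP fullTwistP3 := Subtype.ext fullTwist4_eq
  rw [h, map_mul, strandForget_lastTwistHom, strandForget_addStrandP, one_mul]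

theorem fullTwistP3_zpow_eq_one {n : ℤ} (h : fullTwistP3 ^ n = 1) : n = 0 := by
  have h1 : expSum (addStrand (fullTwist3 ^ n)) = 1 := by
    rw [show fullTwist3 ^ n = 1 from congrArg Subtype.val h, map_one, map_one]
  have h2 := congrArg Multiplicative.toAdd h1
  simp [fullTwist3] at h2
  exact h2

theorem toK4_lastTwistHom_injective : Function.Injective (toK4.comp lastTwistHom) := by
  rw [injective_iff_map_eq_one]
  intro w hw
  obtain ⟨n, hn⟩ := mem_center_P4_iff_zpow.mp ((QuotientGroup.eq_one_iff _).mp hw)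
  have h := strandForget_lastTwistHom w
  rw [hn, map_zpow, strandForget_last_fullTwistP4] at h
  rw [fullTwistP3_zpow_eq_one h, zpow_zero] at hn
  exact lastTwistHom_injective (hn.trans (map_one _).symm)

/-- The homomorphism `K₄ → F₂` induced by a surjective homomorphism `P₄ → P₃`. -/
noncomputable def descend (f : P4 →* P3) (hf : Function.Surjective f) : K4 →* F2 :=
  freeToK3.symm.toMonoidHom.comp (QuotientGroup.map _ _ f (by
    intro p hp
    refine Subgroup.mem_center_iff.mpr fun q => ?_
    obtain ⟨r, rfl⟩ := hf q
    rw [← map_mul, ← map_mul, Subgroup.mem_center_iff.mp hp]))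

theorem descend_mk (f : P4 →* P3) (hf : Function.Surjective f) (p : P4) :
    descend f hf (toK4 p) = freeToK3.symm (toK3 (f p)) := rfl

theorem descend_surjective (f : P4 →* P3) (hf : Function.Surjective f) :
    Function.Surjective (descend f hf) := by
  intro w
  obtain ⟨q, hq⟩ := QuotientGroup.mk'_surjective _ (freeToK3 w)
  obtain ⟨p, rfl⟩ := hf q
  exact ⟨toK4 p, by rw [descend_mk, MulEquiv.symm_apply_eq]; exact hq⟩

theorem descend_eq_one_iff (f : P4 →* P3) (hf : Function.Surjective f) (p : P4) :
    descend f hf (toK4 p) = 1 ↔ toK3 (f p) = 1 := by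
  rw [descend_mk, MulEquiv.symm_apply_eq, map_one]

theorem ker_descend_eq_map_ker (f : P4 →* P3) (hf : Function.Surjective f)
    (hz : f fullTwistP4 = fullTwistP3) : (descend f hf).ker = f.ker.map toK4 := by
  ext k
  obtain ⟨p, rfl⟩ := QuotientGroup.mk'_surjective _ k
  rw [MonoidHom.mem_ker, descend_eq_one_iff]
  constructor
  · intro h
    obtain ⟨n, hn⟩ := mem_center_P3_iff.mp ((QuotientGroup.eq_one_iff _).mp h)
    refine ⟨p * (fullTwistP4 ^ n)⁻¹, ?_, ?_⟩
    · rw [SetLike.mem_coe, MonoidHom.mem_ker, map_mul, map_inv, map_zpow, hz, hn, mul_inv_cancel]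
    · have : toK4 (fullTwistP4 ^ n) = 1 :=
        (QuotientGroup.eq_one_iff _).mpr (zpow_mem fullTwistP4_mem_center n)
      rw [map_mul, map_inv, this, inv_one, mul_one]
  · rintro ⟨q, hq, hqp⟩
    have hd := congrArg (descend f hf) hqp
    rw [descend_mk, MonoidHom.mem_ker.mp hq, map_one, map_one] at hd
    rw [← descend_eq_one_iff f hf, ← hd]

/-! ### Conjugation by braids on four strands -/

theorem exists_braidPerm_eq (s : Equiv.Perm (Fin 4)) : ∃ β : B4, braidPerm 3 β = s := by
  have h : (braidPerm 3).range = ⊤ := by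
    rw [eq_top_iff, ← Subgroup.toSubmonoid_le, Subgroup.top_toSubmonoid,
      ← Equiv.Perm.mclosure_swap_castSucc_succ, Submonoid.closure_le]
    rintro _ ⟨i, rfl⟩
    exact ⟨sig i, braidPerm_sig i⟩
  exact (h ▸ Subgroup.mem_top s : s ∈ (braidPerm 3).range)

/-- Conjugation by a braid, on pure braids. -/
def conjP4 (β : B4) : P4 ≃* P4 := MulAut.conjNormal β

theorem conjP4_coe (β : B4) (p : P4) : (conjP4 β p : B4) = β * p * β⁻¹ :=
  MulAut.conjNormal_apply β p

/-- Conjugation by a braid, on `K₄`. -/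
def conjK4 (β : B4) : K4 ≃* K4 :=
  QuotientGroup.congr _ _ (conjP4 β) (by
    have h := Subgroup.characteristic_iff_map_eq.mp (inferInstance : (Subgroup.center P4).Characteristic)
    exact h (conjP4 β))

theorem conjK4_mk (β : B4) (p : P4) : conjK4 β (toK4 p) = toK4 (conjP4 β p) := rfl

theorem strandForget_conjP4 (β : B4) (p : P4) (i : Fin 4) :
    (strandForget (braidPerm 3 β i) (conjP4 β p) : B3) =
      (braidDelete β).left (braidPerm 3 β i) * strandForget i p *
        ((braidDelete β).left (braidPerm 3 β i))⁻¹ := by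
  have hp := MonoidHom.mem_ker.mp p.2
  have e : (braidPerm 3 β)⁻¹ (braidPerm 3 β i) = i := by simp
  rw [strandForget_coe, conjP4_coe, braidDelete_mul, braidDelete_mul, braidDelete_inv, map_mul, hp,
    mul_one, e, strandForget_coe]

theorem strandForget_conjP4_eq_one_iff (β : B4) (p : P4) (i : Fin 4) :
    strandForget (braidPerm 3 β i) (conjP4 β p) = 1 ↔ strandForget i p = 1 := by
  rw [← Subtype.coe_inj, ← Subtype.coe_inj, strandForget_conjP4, Subgroup.coe_one, conj_eq_one_iff]

theorem strandForget_surjective (i : Fin 4) : Function.Surjective (strandForget i) := by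
  intro q
  obtain ⟨β, hβ⟩ := exists_braidPerm_eq (Equiv.swap 3 i)
  have hi : braidPerm 3 β 3 = i := by rw [hβ, Equiv.swap_apply_left]
  let d := (braidDelete β).left i
  let q' : P3 := (MulAut.conjNormal d)⁻¹ q
  refine ⟨conjP4 β (addStrandP q'), ?_⟩
  have h := strandForget_conjP4 β (addStrandP q') 3
  rw [hi, strandForget_addStrandP] at h
  apply Subtype.ext
  rw [h]
  have : MulAut.conjNormal d q' = q := MulAut.apply_inv_self _ _ q
  rw [← this, MulAut.conjNormal_apply]

theorem cardanoFerrari_surjective : Function.Surjective cardanoFerrari :=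
  fun q => ⟨addStrandP q, cardanoFerrari_addStrandP q⟩

theorem strandForget_fullTwistP4 (i : Fin 4) : strandForget i fullTwistP4 = fullTwistP3 := by
  obtain ⟨β, hβ⟩ := exists_braidPerm_eq (Equiv.swap 3 i)
  have hi : braidPerm 3 β 3 = i := by rw [hβ, Equiv.swap_apply_left]
  have h := strandForget_conjP4 β fullTwistP4 3
  have hc : conjP4 β fullTwistP4 = fullTwistP4 := by
    apply Subtype.ext
    rw [conjP4_coe]
    change β * fullTwist4 * β⁻¹ = fullTwist4
    rw [← (fullTwist4_comm β).eq, mul_inv_cancel_right]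
  rw [hc, hi, strandForget_last_fullTwistP4] at h
  apply Subtype.ext
  rw [h]
  change _ * fullTwist3 * _ = fullTwist3
  rw [← (fullTwist3_comm _).eq, mul_inv_cancel_right]

/-! ### The five fibers -/

/-- The image in `K₄` of the kernel of the map that forgets the strand `i`. -/
def strandFiber (i : Fin 4) : Subgroup K4 := (strandForget i).ker.map toK4

theorem ker_descend_strandForget (i : Fin 4) :
    (descend (strandForget i) (strandForget_surjective i)).ker = strandFiber i :=
  ker_descend_eq_map_ker _ _ (strandForget_fullTwistP4 i)

theorem ker_descend_cardanoFerrari :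
    (descend cardanoFerrari cardanoFerrari_surjective).ker = pushK4.range := by
  ext k
  obtain ⟨p, rfl⟩ := QuotientGroup.mk'_surjective _ k
  rw [MonoidHom.mem_ker, descend_eq_one_iff, toK4_mem_range_pushK4_iff]

theorem mem_strandFiber {i : Fin 4} {p : P4} (h : strandForget i p = 1) :
    toK4 p ∈ strandFiber i := ⟨p, h, rfl⟩

theorem map_conjK4_strandFiber (β : B4) (i : Fin 4) :
    (strandFiber i).map (conjK4 β).toMonoidHom = strandFiber (braidPerm 3 β i) := by
  have h1 (β : B4) (i : Fin 4) :
      (strandFiber i).map (conjK4 β).toMonoidHom ≤ strandFiber (braidPerm 3 β i) := by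
    rintro _ ⟨_, ⟨p, hp, rfl⟩, rfl⟩
    exact ⟨conjP4 β p, (strandForget_conjP4_eq_one_iff β p i).mpr hp, rfl⟩
  refine le_antisymm (h1 β i) ?_
  rintro _ ⟨p, hp, rfl⟩
  have hpp : conjP4 β ((conjP4 β).symm p) = p := MulEquiv.apply_symm_apply _ _
  refine ⟨toK4 ((conjP4 β).symm p), ⟨_, ?_, rfl⟩, ?_⟩
  · apply (strandForget_conjP4_eq_one_iff β _ i).mp
    rw [hpp]
    exact hp
  · exact (conjK4_mk β _).trans (by rw [hpp])

theorem map_conjK4_range_pushK4 (β : B4) :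
    pushK4.range.map (conjK4 β).toMonoidHom = pushK4.range := by
  have h1 (β : B4) (y : SpherePi 4) : conjK4 β (pushK4 y) ∈ pushK4.range := by
    obtain ⟨x, rfl⟩ := fillPuncture_surjective 4 y
    refine ⟨fillPuncture 4 (artinAction β x), ?_⟩
    rw [pushK4_fill, pushK4_fill, conjK4_mk]
    refine congrArg toK4 (Subtype.ext ?_)
    rw [conjP4_coe]
    exact pushHom_artinAction β x
  refine le_antisymm ?_ ?_
  · rintro _ ⟨_, ⟨y, rfl⟩, rfl⟩
    exact h1 β y
  · rintro _ ⟨y, rfl⟩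
    refine ⟨conjK4 β⁻¹ (pushK4 y), h1 _ _, ?_⟩
    obtain ⟨x, rfl⟩ := fillPuncture_surjective 4 y
    rw [pushK4_fill]
    change toK4 (conjP4 β (conjP4 β⁻¹ (pushP4 x))) = _
    refine congrArg toK4 (Subtype.ext ?_)
    rw [conjP4_coe, conjP4_coe]
    group

/-- Modulo the full twist on four strands, the full twist on the first three strands is a movement of
the last strand around them. -/
theorem toK4_addStrandP_fullTwistP3_mem : toK4 (addStrandP fullTwistP3) ∈ strandFiber 3 := by
  have h : fullTwistP4 = lastTwistHom (FreeGroup.of 0 * FreeGroup.of 1 * FreeGroup.of 2) *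
      addStrandP fullTwistP3 := Subtype.ext fullTwist4_eq
  have h1 : toK4 fullTwistP4 = 1 := (QuotientGroup.eq_one_iff _).mpr fullTwistP4_mem_center
  rw [h, map_mul] at h1
  rw [eq_inv_of_mul_eq_one_right h1]
  exact inv_mem (mem_strandFiber (strandForget_lastTwistHom _))

/-- `K₄` is generated by the fourth fiber and the twists of the first strand around the next two. -/
theorem eq_top_of_strandFiber_le {L : Subgroup K4} (h3 : strandFiber 3 ≤ L)
    (h12 : toK4 (addStrandP (freeToP3 (FreeGroup.of 0))) ∈ L)
    (h13 : toK4 (addStrandP (freeToP3 (FreeGroup.of 1))) ∈ L) : L = ⊤ := by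
  have hl (w) : toK4 (lastTwistHom w) ∈ L := h3 (mem_strandFiber (strandForget_lastTwistHom w))
  have hf (v : F2) : toK4 (addStrandP (freeToP3 v)) ∈ L := by
    have : (⊤ : Subgroup F2) ≤ L.comap ((toK4.comp addStrandP).comp freeToP3) := by
      rw [← FreeGroup.closure_range_of, Subgroup.closure_le]
      rintro _ ⟨i, rfl⟩
      fin_cases i
      exacts [h12, h13]
    exact this (Subgroup.mem_top v)
  have hz : toK4 (addStrandP fullTwistP3) ∈ L := h3 toK4_addStrandP_fullTwistP3_mem
  rw [eq_top_iff]
  rintro k -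
  obtain ⟨p, rfl⟩ := QuotientGroup.mk'_surjective _ k
  obtain ⟨w, hw⟩ := exists_eq_lastTwistHom_mul p
  obtain ⟨v, n, hv⟩ := exists_eq_freeToP3_mul (strandForget 3 p)
  rw [hw, hv, map_mul, map_mul, map_mul, map_zpow, map_zpow]
  exact mul_mem (hl w) (mul_mem (hf v) (zpow_mem hz n))

/-- The twist of the second strand around the third one, as a pure braid. -/
def twistP23 : P3 := ⟨sig 1 ^ 2, braidPerm_sig_sq 1⟩

theorem freeToP3_zero_coe : (freeToP3 (FreeGroup.of 0) : B3) = twist12 := by simp [freeToP3]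

theorem freeToP3_one_coe : (freeToP3 (FreeGroup.of 1) : B3) = twist13 := by simp [freeToP3]

theorem fullTwistP3_eq :
    fullTwistP3 = freeToP3 (FreeGroup.of 1) * twistP23 * freeToP3 (FreeGroup.of 0) := by
  apply Subtype.ext
  rw [Subgroup.coe_mul, Subgroup.coe_mul, freeToP3_zero_coe, freeToP3_one_coe]
  exact fullTwist3_eq

theorem strandFiber_sup_three_two : strandFiber 3 ⊔ strandFiber 2 = ⊤ := by
  have h13 : toK4 (addStrandP (freeToP3 (FreeGroup.of 1))) ∈ strandFiber 3 ⊔ strandFiber 2 := by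
    refine Subgroup.mem_sup_right (mem_strandFiber (Subtype.ext ?_))
    rw [strandForget_coe, addStrandP_coe, freeToP3_one_coe, twist13, pow_two]
    simp only [map_mul, map_inv, addStrand_sig_zero, addStrand_sig_one]
    simp only [← map_mul, ← map_inv]
    simp only [braidDelete_mul, braidDelete_inv, braidDelete_sig_left]
    simp [braidPerm_sig, deleteCrossing]
  have h23 : toK4 (addStrandP twistP23) ∈ strandFiber 3 ⊔ strandFiber 2 := by
    refine Subgroup.mem_sup_right (mem_strandFiber (Subtype.ext ?_))
    rw [strandForget_coe, addStrandP_coe]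
    change (braidDelete (addStrand (sig 1 ^ 2))).left 2 = 1
    rw [pow_two, map_mul, addStrand_sig_one]
    simp only [braidDelete_mul, braidDelete_sig_left]
    simp [braidPerm_sig, deleteCrossing]
  have hz := Subgroup.mem_sup_left (T := strandFiber 2) toK4_addStrandP_fullTwistP3_mem
  refine eq_top_of_strandFiber_le le_sup_left ?_ h13
  rw [fullTwistP3_eq, map_mul, map_mul, map_mul, map_mul] at hz
  exact (Subgroup.mul_mem_cancel_left _ (mul_mem h13 h23)).mp hz

theorem strandFiber_sup_pushK4 : strandFiber 3 ⊔ pushK4.range = ⊤ := by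
  -- Two pure braids with the same image under the Cardano–Ferrari epimorphism differ by a push.
  have key (q : P3) (w : FreeGroup (Fin 3)) (h : cardanoFerrari (lastTwistHom w) = q) :
      toK4 (addStrandP q) ∈ strandFiber 3 ⊔ pushK4.range := by
    have h1 : toK4 (addStrandP q * (lastTwistHom w)⁻¹) ∈ pushK4.range := by
      rw [toK4_mem_range_pushK4_iff, map_mul, map_inv, h, cardanoFerrari_addStrandP, mul_inv_cancel,
        map_one]
    have h2 : toK4 (lastTwistHom w) ∈ strandFiber 3 :=
      mem_strandFiber (strandForget_lastTwistHom w)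
    have h3 := mul_mem (Subgroup.mem_sup_right (S := strandFiber 3) h1)
      (Subgroup.mem_sup_left (T := pushK4.range) h2)
    rwa [← map_mul, inv_mul_cancel_right] at h3
  have h12 := key (freeToP3 (FreeGroup.of 0)) (FreeGroup.of 2) (by
    apply Subtype.ext
    rw [freeToP3_zero_coe, cardanoFerrari_coe, lastTwistHom_of]
    simp [lastTwist, twist12, pow_two])
  have h23 := key twistP23 (FreeGroup.of 0) (by
    apply Subtype.ext
    rw [cardanoFerrari_coe, lastTwistHom_of]
    change _ = sig 1 ^ 2
    calc cardanoFerrariB4 (lastTwist 0)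
        = sig 0 * (sig 1 * sig 0 * (sig 1)⁻¹) ^ 2 * (sig 0)⁻¹ := by
          simp [lastTwist, pow_two, mul_assoc]
      _ = sig 0 * ((sig 0)⁻¹ * sig 1 * sig 0) ^ 2 * (sig 0)⁻¹ := by
          rw [conj_inv_of_braid sig_braid_B3]
      _ = sig 1 ^ 2 := by simp [pow_two, mul_assoc])
  have hz := Subgroup.mem_sup_left (T := pushK4.range) toK4_addStrandP_fullTwistP3_mem
  refine eq_top_of_strandFiber_le le_sup_left h12 ?_
  rw [fullTwistP3_eq, map_mul, map_mul, map_mul, map_mul, mul_assoc] at hz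
  exact (Subgroup.mul_mem_cancel_right _ (mul_mem h23 h12)).mp hz

theorem strandFiber_sup {i j : Fin 4} (hij : i ≠ j) : strandFiber i ⊔ strandFiber j = ⊤ := by
  have hs : ∃ s : Equiv.Perm (Fin 4), s 3 = i ∧ s 2 = j := by
    revert i j
    decide
  obtain ⟨s, h3, h2⟩ := hs
  obtain ⟨β, rfl⟩ := exists_braidPerm_eq s
  rw [← h3, ← h2, ← map_conjK4_strandFiber, ← map_conjK4_strandFiber, ← Subgroup.map_sup,
    strandFiber_sup_three_two]
  exact Subgroup.map_top_of_surjective _ (conjK4 β).surjective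

theorem strandFiber_sup_range_pushK4 (i : Fin 4) : strandFiber i ⊔ pushK4.range = ⊤ := by
  obtain ⟨β, hβ⟩ := exists_braidPerm_eq (Equiv.swap 3 i)
  have hi : braidPerm 3 β 3 = i := by rw [hβ, Equiv.swap_apply_left]
  rw [← hi, ← map_conjK4_range_pushK4 β, ← map_conjK4_strandFiber, ← Subgroup.map_sup,
    strandFiber_sup_pushK4]
  exact Subgroup.map_top_of_surjective _ (conjK4 β).surjective

/-! ### The five extensions -/

/-- The extension of `F₂` by `F₃` given by a surjective homomorphism and a parametrization of its
kernel. -/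
def extensionOf (i : FreeGroup (Fin 3) →* K4) (f : K4 →* F2) (hi : Function.Injective i)
    (hf : Function.Surjective f) (h : i.range = f.ker) :
    GroupExtension (FreeGroup (Fin 3)) K4 F2 where
  inl := i
  rightHom := f
  inl_injective := hi
  range_inl_eq_ker_rightHom := h
  rightHom_surjective := hf

theorem range_toK4_lastTwistHom : (toK4.comp lastTwistHom).range = strandFiber 3 := by
  apply le_antisymm
  · rintro _ ⟨w, rfl⟩
    exact mem_strandFiber (strandForget_lastTwistHom w)
  · rintro _ ⟨p, hp, rfl⟩
    obtain ⟨w, rfl⟩ := eq_lastTwistHom_of_strandForget hp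
    exact ⟨w, rfl⟩

theorem exists_strandExtension (i : Fin 4) : ∃ E : GroupExtension (FreeGroup (Fin 3)) K4 F2,
    E.inl.range = strandFiber i ∧
      E.rightHom = descend (strandForget i) (strandForget_surjective i) := by
  obtain ⟨β, hβ⟩ := exists_braidPerm_eq (Equiv.swap 3 i)
  have hi : braidPerm 3 β 3 = i := by rw [hβ, Equiv.swap_apply_left]
  have hr : ((conjK4 β).toMonoidHom.comp (toK4.comp lastTwistHom)).range = strandFiber i := by
    rw [MonoidHom.range_comp, range_toK4_lastTwistHom, map_conjK4_strandFiber, hi]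
  exact ⟨extensionOf ((conjK4 β).toMonoidHom.comp (toK4.comp lastTwistHom)) _
    ((conjK4 β).injective.comp toK4_lastTwistHom_injective) (descend_surjective _ _)
    (hr.trans (ker_descend_strandForget i).symm), hr, rfl⟩

theorem exists_pushExtension : ∃ E : GroupExtension (FreeGroup (Fin 3)) K4 F2,
    E.inl.range = pushK4.range ∧ E.rightHom = descend cardanoFerrari cardanoFerrari_surjective := by
  have hr : (pushK4.comp (sphereFreeLast 3).symm.toMonoidHom).range = pushK4.range := by
    have hs : (sphereFreeLast 3).symm.toMonoidHom.range = ⊤ :=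
      MonoidHom.range_eq_top.mpr (sphereFreeLast 3).symm.surjective
    rw [MonoidHom.range_comp, hs, MonoidHom.range_eq_map pushK4]
  exact ⟨extensionOf (pushK4.comp (sphereFreeLast 3).symm.toMonoidHom) _
    (pushK4_injective.comp (sphereFreeLast 3).symm.injective) (descend_surjective _ _)
    (hr.trans ker_descend_cardanoFerrari.symm), hr, rfl⟩

/-! ### The kernel of the Cardano–Ferrari epimorphism -/

theorem map_ker_cardanoFerrari_le : cardanoFerrari.ker.map toK4 ≤ pushK4.range := by
  rintro _ ⟨p, hp, rfl⟩
  rw [toK4_mem_range_pushK4_iff, MonoidHom.mem_ker.mp hp, map_one]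

/-- Modulo the center, the kernel of the Cardano–Ferrari epimorphism has index two in the fifth
fiber: pushes are mapped to powers of the full twist on three strands, and the full twist on four
strands is mapped to its square. -/
theorem relIndex_map_ker_cardanoFerrari :
    (cardanoFerrari.ker.map toK4).relIndex pushK4.range = 2 := by
  have hz : cardanoFerrari fullTwistP4 = fullTwistP3 ^ 2 := Subtype.ext cardanoFerrariB4_fullTwist4
  have h1 : toK4 fullTwistP4 = 1 := (QuotientGroup.eq_one_iff _).mpr fullTwistP4_mem_center
  -- The image of `p` lies in that of the kernel if and only if `Ψ p` is an even power.
  have hm (p : P4) (n : ℤ) (hn : cardanoFerrari p = fullTwistP3 ^ n) :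
      toK4 p ∈ cardanoFerrari.ker.map toK4 ↔ Even n := by
    constructor
    · rintro ⟨q, hq, hqp⟩
      obtain ⟨m, hm⟩ := mem_center_P4_iff_zpow.mp (QuotientGroup.eq.mp hqp)
      rw [inv_mul_eq_iff_eq_mul] at hm
      rw [hm, map_mul, MonoidHom.mem_ker.mp hq, one_mul, map_zpow, hz, ← zpow_natCast, ← zpow_mul,
        ← mul_inv_eq_one, ← zpow_neg, ← zpow_add] at hn
      have := fullTwistP3_zpow_eq_one hn
      exact ⟨m, by push_cast at this; omega⟩
    · rintro ⟨m, rfl⟩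
      refine ⟨p * (fullTwistP4 ^ m)⁻¹, ?_, ?_⟩
      · rw [SetLike.mem_coe, MonoidHom.mem_ker, map_mul, map_inv, map_zpow, hz, hn, ← zpow_natCast,
          ← zpow_mul, ← zpow_neg, ← zpow_add]
        rw [show m + m + -(((2 : ℕ) : ℤ) * m) = 0 by push_cast; ring, zpow_zero]
      · rw [map_mul, map_inv, map_zpow, h1, one_zpow, inv_one, mul_one]
  have hex (k : pushK4.range) :
      ∃ (p : P4) (n : ℤ), toK4 p = k ∧ cardanoFerrari p = fullTwistP3 ^ n := by
    obtain ⟨p, hp⟩ := QuotientGroup.mk'_surjective _ (k : K4)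
    have h := toK4_mem_range_pushK4_iff.mp (hp ▸ k.2)
    obtain ⟨n, hn⟩ := mem_center_P3_iff.mp ((QuotientGroup.eq_one_iff _).mp h)
    exact ⟨p, n, hp, hn⟩
  rw [Subgroup.relIndex, Subgroup.index_eq_two_iff]
  have h0 : cardanoFerrari (pushP4 (loop (Fin.castSucc 0))) = fullTwistP3 := by
    apply Subtype.ext
    rw [cardanoFerrari_coe]
    change cardanoFerrariB4 (pushHom (loop (Fin.castSucc 0))) = fullTwist3
    rw [pushHom_castSucc, cardanoFerrariB4_pushBraid]
  refine ⟨⟨toK4 (pushP4 (loop (Fin.castSucc 0))), ⟨_, pushK4_fill _⟩⟩, fun k => ?_⟩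
  obtain ⟨p, n, hp, hn⟩ := hex k
  rw [Subgroup.mem_subgroupOf, Subgroup.mem_subgroupOf, Subgroup.coe_mul, ← hp, ← map_mul,
    hm p n hn, hm _ (n + 1) (by rw [map_mul, hn, h0, zpow_add_one]), Int.even_add_one]
  rw [xor_comm]
  exact xor_not_right.mpr Iff.rfl

/-! ### Products of conjugates of generators in a free group -/

theorem List.exists_common_prefix {β : Type*} (l m : List β) :
    ∃ d s t, l = d ++ s ∧ m = d ++ t ∧ ∀ x ∈ s.head?, ∀ y ∈ t.head?, x ≠ y := by
  induction l generalizing m with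
  | nil => exact ⟨[], [], m, rfl, rfl, by simp⟩
  | cons x l ih =>
    rcases m with _ | ⟨y, m⟩
    · exact ⟨[], x :: l, [], rfl, rfl, by simp⟩
    · by_cases h : x = y
      · obtain ⟨d, s, t, rfl, rfl, hst⟩ := ih m
        exact ⟨x :: d, s, t, rfl, by rw [h]; rfl, hst⟩
      · exact ⟨[], x :: l, y :: m, rfl, rfl, by simpa using h⟩

namespace FreeGroup

variable {α : Type*}

theorem invRev_singleton (c : α) (b : Bool) : invRev [(c, b)] = [(c, !b)] := rfl

theorem IsReduced.invRev {l : List (α × Bool)} (h : IsReduced l) : IsReduced (invRev l) := by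
  classical
  rw [isReduced_iff_reduce_eq] at h ⊢
  rw [reduce_invRev, h]

/-- Two reduced words without a common prefix do not cancel when the first one is inverted. -/
theorem IsReduced.invRev_append {s t : List (α × Bool)} (hs : IsReduced s) (ht : IsReduced t)
    (h : ∀ x ∈ s.head?, ∀ y ∈ t.head?, x ≠ y) : IsReduced (FreeGroup.invRev s ++ t) := by
  rcases s with _ | ⟨⟨c, b⟩, s⟩
  · simpa using ht
  rcases t with _ | ⟨⟨e, f⟩, t⟩
  · simpa using hs.invRev
  have h1 := hs.invRev
  have h2 : IsReduced ([(c, !b)] ++ (e, f) :: t) := by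
    refine List.isChain_cons_cons.mpr ⟨fun hce => ?_, ht⟩
    simp only [List.head?_cons, Option.mem_def, Option.some.injEq, forall_eq', ne_eq,
      Prod.mk.injEq, not_and] at h
    have := h hce
    revert this; cases b <;> cases f <;> simp
  rw [invRev_cons] at h1 ⊢
  exact IsReduced.append_overlap h1 h2 (by simp [invRev_singleton])

/-- The conjugate `g x g⁻¹` of the generator `x`, encoded by the pair `(g, x)`. -/
def conjGen (p : FreeGroup α × α) : FreeGroup α := p.1 * of p.2 * p.1⁻¹

variable [DecidableEq α]

/-- The last letter of the conjugator `g` is neither the generator `x` nor its inverse. -/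
def IsTight (p : FreeGroup α × α) : Prop := ∀ b, IsReduced (p.1.toWord ++ [(p.2, b)])

/-- Neither of two adjacent conjugates shortens the conjugator of the other one in the way in which
a braid generator or its inverse would. -/
def NotShortening (p q : FreeGroup α × α) : Prop :=
  q.1.norm ≤ (conjGen p * q.1).norm ∧ p.1.norm ≤ ((conjGen q)⁻¹ * p.1).norm

/-- Two conjugates that do not shorten each other: write their conjugators as `d s` and `d t` with the
longest common prefix `d`. Then the product `x s⁻¹ t x'` of the rest is reduced. -/
theorem exists_of_notShortening {p q : FreeGroup α × α} (hp : IsTight p) (hq : IsTight q)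
    (h : NotShortening p q) : ∃ d s t, p.1.toWord = d ++ s ∧ q.1.toWord = d ++ t ∧
      IsReduced ((p.2, true) :: (FreeGroup.invRev s ++ (t ++ [(q.2, true)]))) := by
  obtain ⟨d, s, t, hs, ht, hst⟩ := List.exists_common_prefix p.1.toWord q.1.toWord
  have ep : p.1 = mk d * mk s := by rw [mul_mk, ← hs, mk_toWord]
  have eq : q.1 = mk d * mk t := by rw [mul_mk, ← ht, mk_toWord]
  have hp2 (b : Bool) : IsReduced (s ++ [(p.2, b)]) :=
    (hp b).infix ⟨d, [], by rw [hs]; simp⟩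
  have hq2 : IsReduced (t ++ [(q.2, true)]) := (hq true).infix ⟨d, [], by rw [ht]; simp⟩
  have hs' : IsReduced s := (hp2 true).infix ⟨[], _, rfl⟩
  have ht' : IsReduced t := hq2.infix ⟨[], _, rfl⟩
  have hps : IsReduced ([(p.2, true)] ++ FreeGroup.invRev s) := by
    simpa [invRev_singleton] using (hp2 false).invRev
  have hmid := hs'.invRev_append ht' hst
  refine ⟨d, s, t, hs, ht, ?_⟩
  rcases s with _ | ⟨⟨c, b⟩, s⟩
  · rcases t with _ | ⟨⟨e, f⟩, t⟩
    · exact List.isChain_cons_cons.mpr ⟨fun _ => rfl, List.isChain_singleton _⟩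
    · refine List.isChain_cons_cons.mpr ⟨fun hpe => ?_, hq2⟩
      by_contra hf
      have hf : f = false := by cases f <;> simp_all
      simp only at hpe
      subst hf
      have h1 := h.1
      rw [← hpe] at ht eq
      have : conjGen p * q.1 = mk (d ++ t) := by
        have e2 : mk ((p.2, false) :: t) = (of p.2)⁻¹ * mk t := rfl
        rw [conjGen, eq, ep, ← one_eq_mk, e2, ← mul_mk]
        group
      rw [this] at h1
      have h2 := h1.trans norm_mk_le
      rw [norm, ht] at h2
      simp at h2
  · rcases t with _ | ⟨⟨e, f⟩, t⟩
    · rw [invRev_cons] at hps ⊢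
      have : IsReduced ([(c, !b)] ++ [(q.2, true)]) := by
        refine List.isChain_cons_cons.mpr ⟨fun hpe => ?_, List.isChain_singleton _⟩
        by_contra hb
        have hb : b = true := by cases b <;> simp_all
        simp only at hpe
        subst hb
        have h1 := h.2
        rw [hpe] at hs ep
        have : (conjGen q)⁻¹ * p.1 = mk (d ++ s) := by
          have e2 : mk ((q.2, true) :: s) = of q.2 * mk s := rfl
          rw [conjGen, eq, ep, ← one_eq_mk, e2, ← mul_mk]
          group
        rw [this] at h1
        have h2 := h1.trans norm_mk_le
        rw [norm, hs] at h2
        simp at h2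
      simpa [invRev_singleton] using IsReduced.append_overlap (L₁ := [(p.2, true)] ++ FreeGroup.invRev s)
        (L₂ := [(c, !b)]) (by simpa [invRev_singleton] using hps) this (by simp)
    · have h1 := IsReduced.append_overlap hps hmid (by rw [invRev_cons]; simp [FreeGroup.invRev])
      rw [List.append_assoc] at h1
      have h2 := IsReduced.append_overlap (L₁ := [(p.2, true)] ++ FreeGroup.invRev ((c, b) :: s))
        (L₂ := (e, f) :: t) (L₃ := [(q.2, true)]) (by simpa using h1) hq2 (by simp)
      simpa using h2

/-- If adjacent conjugates do not shorten each other, the letters `x` of the factors of the product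
`y₁ ⋯ yₙ` all survive in its reduced word. -/
theorem exists_reduced_prod (p : FreeGroup α × α) (l : List (FreeGroup α × α))
    (ht : ∀ q ∈ p :: l, IsTight q) (hl : (p :: l).IsChain NotShortening) :
    ∃ R, ((p :: l).map conjGen).prod = mk (p.1.toWord ++ (p.2, true) :: R) ∧
      IsReduced (p.1.toWord ++ (p.2, true) :: R) ∧ l.length ≤ R.length ∧
      (R.length = l.length → ∀ q ∈ p :: l, q.1 = 1) := by
  induction l generalizing p with
  | nil =>
    have hp := ht p (by simp)
    refine ⟨invRev p.1.toWord, ?_, ?_, by simp, ?_⟩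
    · rw [List.map_singleton, List.prod_singleton, ← List.singleton_append, ← mul_mk, ← mul_mk,
        ← inv_mk, mk_toWord, conjGen, mul_assoc]
      rfl
    · have h1 : IsReduced ([(p.2, true)] ++ invRev p.1.toWord) := by simpa [invRev_singleton] using (hp false).invRev
      have := IsReduced.append_overlap (hp true) h1 (by simp)
      simpa using this
    · simp
  | cons q l ih =>
    obtain ⟨hpq, hl⟩ := List.isChain_cons_cons.mp hl
    obtain ⟨R, hR, hred, hlen, heq⟩ := ih q (fun r hr => ht r (List.mem_cons_of_mem _ hr)) hl
    obtain ⟨d, s, t, hs, ht2, hst⟩ := exists_of_notShortening (ht p (by simp)) (ht q (by simp)) hpq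
    refine ⟨invRev s ++ (t ++ (q.2, true) :: R), ?_, ?_, ?_, ?_⟩
    · have ep : p.1 = mk d * mk s := by rw [mul_mk, ← hs, mk_toWord]
      rw [List.map_cons, List.prod_cons, hR, conjGen, ht2, hs, ep]
      have (L : List (α × Bool)) : mk ((p.2, true) :: L) = of p.2 * mk L := rfl
      simp only [← mul_mk, this, ← inv_mk]
      group
    · have h1 : IsReduced (p.1.toWord ++ [(p.2, true)]) := ht p (by simp) true
      have h2 : IsReduced ((t ++ [(q.2, true)]) ++ R) :=
        hred.infix ⟨d, [], by rw [ht2]; simp⟩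
      have h3 := IsReduced.append_overlap (L₁ := (p.2, true) :: invRev s) (by simpa using hst) h2
        (by simp)
      have h4 := IsReduced.append_overlap (L₁ := p.1.toWord) (L₂ := [(p.2, true)])
        (L₃ := invRev s ++ (t ++ (q.2, true) :: R)) h1 (by simpa using h3) (by simp)
      simpa using h4
    · simp; omega
    · intro h
      simp only [List.length_append, invRev_length, List.length_cons] at h
      have hs0 : s = [] := List.eq_nil_of_length_eq_zero (by omega)
      have ht0 : t = [] := List.eq_nil_of_length_eq_zero (by omega)
      have := heq (by omega)
      intro r hr
      rcases List.mem_cons.mp hr with rfl | hr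
      · have hq := this q (by simp)
        rw [hq, toWord_one, ht0] at ht2
        rw [hs0, ← ht2] at hs
        exact toWord_eq_nil_iff.mp hs
      · exact this r hr

/-- If a product of `n` conjugates of generators has norm at most `n` and adjacent factors do not
shorten each other, then the factors are generators. -/
theorem eq_one_of_norm_prod_le (l : List (FreeGroup α × α)) (ht : ∀ q ∈ l, IsTight q)
    (hl : l.IsChain NotShortening) (hn : (l.map conjGen).prod.norm ≤ l.length) :
    ∀ q ∈ l, q.1 = 1 := by
  rcases l with _ | ⟨p, l⟩
  · simp
  obtain ⟨R, hR, hred, hlen, heq⟩ := exists_reduced_prod p l ht hl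
  rw [hR, norm, toWord_mk, hred.reduce_eq] at hn
  simp only [List.length_append, List.length_cons] at hn
  exact heq (by omega)

theorem exists_shorter_of_not_isTight {p : FreeGroup α × α} (h : ¬ IsTight p) :
    ∃ g : FreeGroup α, g.norm < p.1.norm ∧ conjGen (g, p.2) = conjGen p := by
  rw [IsTight, not_forall] at h
  obtain ⟨b, hb⟩ := h
  rcases List.eq_nil_or_concat' p.1.toWord with h0 | ⟨w, ⟨c, e⟩, hw⟩
  · rw [h0] at hb
    exact absurd (List.isChain_singleton _) hb
  have hred : IsReduced (w ++ [(c, e)]) := hw ▸ isReduced_toWord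
  have hc : c = p.2 := by
    by_contra hc
    apply hb
    rw [hw]
    refine IsReduced.append_overlap hred (List.isChain_cons_cons.mpr ⟨fun h => absurd h hc,
      List.isChain_singleton _⟩) (by simp)
  have e1 : p.1 = mk w * mk [(c, e)] := by rw [mul_mk, ← hw, mk_toWord]
  refine ⟨mk w, ?_, ?_⟩
  · refine norm_mk_le.trans_lt ?_
    rw [norm, hw]; simp
  · rw [conjGen, conjGen, e1, hc]
    cases e
    · have : mk [(p.2, false)] = (of p.2)⁻¹ := rfl
      rw [this]; group
    · have : mk [(p.2, true)] = of p.2 := rfl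
      rw [this]; group

end FreeGroup

/-! ### Artin's theorem and the capping isomorphism -/

open FreeGroup (conjGen of mk IsTight NotShortening exists_shorter_of_not_isTight
  eq_one_of_norm_prod_le toWord_mk toWord) in
/-- **Artin's theorem** on four strands: an endomorphism of `π₁(S_{0,5})` that fixes `x₄` and maps the
other loops to conjugates of loops is the action of a braid. The induction is on the total length of
the conjugators. -/
theorem exists_artinAction_eq_of_conjGen (φ : SpherePi 5 →* SpherePi 5)
    (g : Fin 4 → FreeGroup (Fin 4) × Fin 4) (h4 : φ (loop (Fin.last 4)) = loop (Fin.last 4))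
    (hφ : ∀ k : Fin 4, sphereFreeLast 4 (φ (loop k.castSucc)) = conjGen (g k)) :
    ∃ β : B4, φ = (artinAction β).toMonoidHom := by
  induction hN : ∑ k, (g k).1.norm using Nat.strong_induction_on generalizing φ g with
  | _ N ih =>
  by_cases ht : ∀ k, IsTight (g k)
  swap
  · -- A conjugator ends with a power of its generator and can be shortened.
    rw [not_forall] at ht
    obtain ⟨k, hk⟩ := ht
    obtain ⟨x, hx, hx2⟩ := exists_shorter_of_not_isTight hk
    refine ih _ ?_ φ (Function.update g k (x, (g k).2)) h4 ?_ rfl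
    · rw [← hN]
      refine Finset.sum_lt_sum (fun i _ => ?_) ⟨k, Finset.mem_univ _, by simpa using hx⟩
      by_cases h : i = k
      · subst h; simpa using hx.le
      · simp [h]
    · intro i
      by_cases h : i = k
      · subst h; rw [hφ, Function.update_self, hx2]
      · rw [hφ, Function.update_of_ne h]
  by_cases hadj : ∀ j : Fin 3, NotShortening (g j.castSucc) (g j.succ)
  swap
  · -- Composing with a braid generator or its inverse shortens a conjugator.
    rw [not_forall] at hadj
    obtain ⟨j, hj⟩ := hadj
    have hsum (f : Fin 4 → ℕ) : ∃ r, ∀ f' : Fin 4 → ℕ,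
        (∀ i, i ≠ j.castSucc → i ≠ j.succ → f' i = f i) →
          ∑ i, f' i = f' j.castSucc + f' j.succ + r := by
      refine ⟨∑ i ∈ ({j.castSucc, j.succ} : Finset (Fin 4))ᶜ, f i, fun f' hf => ?_⟩
      rw [← Finset.sum_add_sum_compl ({j.castSucc, j.succ} : Finset (Fin 4)),
        Finset.sum_pair (by simp [Fin.ext_iff])]
      congr 1
      refine Finset.sum_congr rfl fun i hi => ?_
      simp only [Finset.mem_compl, Finset.mem_insert, Finset.mem_singleton, not_or] at hi
      exact hf i hi.1 hi.2
    obtain ⟨r, hr⟩ := hsum fun i => (g i).1.norm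
    rw [hr _ fun _ _ _ => rfl] at hN
    have hne : j.castSucc ≠ j.succ := by simp [Fin.ext_iff]
    rw [NotShortening, not_and_or, not_le, not_le] at hj
    rcases hj with hj | hj
    · let g' : Fin 4 → FreeGroup (Fin 4) × Fin 4 := fun i =>
        if i = j.castSucc then (conjGen (g j.castSucc) * (g j.succ).1, (g j.succ).2)
        else if i = j.succ then g j.castSucc else g i
      suffices h : ∃ β : B4, φ.comp (artinAction (sig j)).toMonoidHom = (artinAction β).toMonoidHom by
        obtain ⟨β, hβ⟩ := h
        refine ⟨β * (sig j)⁻¹, ?_⟩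
        apply MonoidHom.ext
        intro x
        have := DFunLike.congr_fun hβ ((artinAction (sig j))⁻¹ x)
        simpa using this
      refine ih _ ?_ _ g' ?_ ?_ rfl
      · rw [hr fun i => (g' i).1.norm]
        · simp [g', hne.symm]; omega
        · intro i h1 h2; simp [g', h1, h2]
      · rw [MonoidHom.comp_apply, MulEquiv.coe_toMonoidHom, artinAction_last, h4]
      · intro k
        rw [MonoidHom.comp_apply, MulEquiv.coe_toMonoidHom, artinAction_sig_loop, twistLoop]
        by_cases h1 : k = j.castSucc
        · subst h1
          simp only [if_true, map_mul, map_inv, hφ, g']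
          simp only [conjGen]; group
        · by_cases h2 : k = j.succ
          · subst h2
            rw [if_neg (by simp [Fin.ext_iff]), if_pos rfl, hφ]
            simp [g', hne.symm]
          · rw [if_neg (by simpa using h1), if_neg (fun h => h2 (Fin.castSucc_injective _ h)), hφ]
            simp [g', h1, h2]
    · let g' : Fin 4 → FreeGroup (Fin 4) × Fin 4 := fun i =>
        if i = j.castSucc then g j.succ
        else if i = j.succ then ((conjGen (g j.succ))⁻¹ * (g j.castSucc).1, (g j.castSucc).2)
        else g i
      suffices h : ∃ β : B4, φ.comp (artinAction (sig j))⁻¹.toMonoidHom = (artinAction β).toMonoidHom by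
        obtain ⟨β, hβ⟩ := h
        refine ⟨β * sig j, ?_⟩
        apply MonoidHom.ext
        intro x
        have := DFunLike.congr_fun hβ (artinAction (sig j) x)
        simpa using this
      refine ih _ ?_ _ g' ?_ ?_ rfl
      · rw [hr fun i => (g' i).1.norm]
        · simp [g', hne.symm]; omega
        · intro i h1 h2; simp [g', h1, h2]
      · have := artinAction_last (sig j)⁻¹
        rw [map_inv] at this
        rw [MonoidHom.comp_apply, MulEquiv.coe_toMonoidHom, this, h4]
      · intro k
        have hinv : (artinAction (sig j))⁻¹ (loop k.castSucc) = twistInvLoop j k.castSucc :=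
          (congrArg (fun ψ : MulAut (SpherePi 5) => ψ⁻¹ (loop k.castSucc)) (artinAction_sig j)).trans
            (sphereLift_loop _ (twistInvLoop_prod j) k.castSucc)
        rw [MonoidHom.comp_apply, MulEquiv.coe_toMonoidHom, hinv, twistInvLoop]
        by_cases h1 : k = j.castSucc
        · subst h1
          rw [if_pos rfl]
          simp only [hφ, g', if_true]
        · by_cases h2 : k = j.succ
          · subst h2
            rw [if_neg (by simp [Fin.ext_iff]), if_pos rfl]
            simp only [map_mul, map_inv, hφ, g', if_neg hne.symm, if_true]
            simp only [conjGen]; group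
          · rw [if_neg (by simpa using h1), if_neg (fun h => h2 (Fin.castSucc_injective _ h)), hφ]
            simp [g', h1, h2]
  -- Otherwise all conjugators are trivial, because the product of the conjugates is short.
  have hprod : (List.ofFn fun k => conjGen (g k)).prod = (List.ofFn fun k : Fin 4 => of k).prod := by
    have h1 := congrArg (fun x => sphereFreeLast 4 (φ x)) loop_last_inv
    have h2 := congrArg (sphereFreeLast 4) loop_last_inv
    have e0 := sphereFreeLast_castSucc (0 : Fin 4)
    have e1 := sphereFreeLast_castSucc (1 : Fin 4)
    have e2 := sphereFreeLast_castSucc (2 : Fin 4)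
    have e3 := sphereFreeLast_castSucc (3 : Fin 4)
    simp only [map_inv, h4, map_mul] at h1
    rw [← map_inv, h2] at h1
    have h3 : _ = conjGen (g 0) * conjGen (g 1) * conjGen (g 2) * conjGen (g 3) :=
      h1.trans (by rw [← hφ, ← hφ, ← hφ, ← hφ]; rfl)
    simp only [map_mul] at h3
    rw [List.ofFn_succ, List.ofFn_succ, List.ofFn_succ, List.ofFn_succ, List.ofFn_zero]
    simp only [List.ofFn_succ, List.ofFn_zero, List.prod_cons, List.prod_nil, mul_one, ← mul_assoc]
    exact h3.symm.trans (congrArg₂ _ (congrArg₂ _ (congrArg₂ _ e0 e1) e2) e3)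
  have hone : ∀ k, (g k).1 = 1 := by
    intro k
    refine eq_one_of_norm_prod_le (List.ofFn g) ?_ ?_ ?_ (g k) (List.mem_ofFn.mpr ⟨k, rfl⟩)
    · intro q hq
      obtain ⟨i, rfl⟩ := List.mem_ofFn.mp hq
      exact ht i
    · have h0 := hadj 0
      have h1 := hadj 1
      have h2 := hadj 2
      simp [List.ofFn_succ, List.isChain_cons_cons]
      exact ⟨h0, h1, h2⟩
    · rw [List.map_ofFn]
      change (List.ofFn fun k => conjGen (g k)).prod.norm ≤ _
      rw [hprod]
      have : (List.ofFn fun k : Fin 4 => of k).prod.norm = 4 := by decide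
      rw [this]; simp
  have hword : (g 0).2 = 0 ∧ (g 1).2 = 1 ∧ (g 2).2 = 2 ∧ (g 3).2 = 3 := by
    have e1 (k) : conjGen (g k) = of (g k).2 := by simp [conjGen, hone]
    simp only [e1] at hprod
    have hw (f : Fin 4 → Fin 4) : (List.ofFn fun k => of (f k)).prod.toWord =
        List.ofFn fun k => (f k, true) := by
      have : (List.ofFn fun k => of (f k)).prod = mk (List.ofFn fun k => (f k, true)) := by
        simp [List.ofFn_succ, of]
      rw [this, toWord_mk]
      apply FreeGroup.IsReduced.reduce_eq
      simp [List.ofFn_succ, FreeGroup.IsReduced]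
    have := congrArg toWord hprod
    rw [hw, hw fun k => k] at this
    simpa [List.ofFn_succ] using this
  refine ⟨1, ?_⟩
  apply sphere_hom_ext
  intro k
  induction k using Fin.lastCases with
  | last => simpa using h4
  | cast k =>
    apply (sphereFreeLast 4).injective
    rw [hφ, conjGen, hone]
    obtain ⟨h0, h1, h2, h3⟩ := hword
    have : (g k).2 = k := by fin_cases k <;> assumption
    simp [this, sphereFreeLast_castSucc]

theorem isConj_loop_castSucc {n : ℕ} {i j : Fin n}
    (h : IsConj (loop i.castSucc : SpherePi (n + 1)) (loop j.castSucc)) : i = j := by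
  by_contra hij
  let f : FreeGroup (Fin n) →* Multiplicative ℤ :=
    FreeGroup.lift fun k => if k = i then Multiplicative.ofAdd 1 else 1
  have h1 := (f.comp (sphereFreeLast n).toMonoidHom).map_isConj h
  rw [isConj_iff_eq] at h1
  simp [f, Ne.symm hij] at h1

/-- An automorphism in `PureAut 5` that fixes the last loop is the action of a pure braid. -/
theorem exists_artinPure_eq (φ : PureAut 5) (h : φ.1 (loop (Fin.last 4)) = loop (Fin.last 4)) :
    ∃ p : P4, artinPure p = φ := by
  choose c hc using fun k : Fin 4 => isConj_iff.mp (φ.2 k.castSucc)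
  obtain ⟨β, hβ⟩ := exists_artinAction_eq_of_conjGen φ.1.toMonoidHom
    (fun k => (sphereFreeLast 4 (c k), k)) h (fun k => by
      rw [MulEquiv.coe_toMonoidHom, ← hc]
      simp [FreeGroup.conjGen])
  have hφ : artinAction β = φ.1 := MulEquiv.toMonoidHom_injective hβ.symm
  refine ⟨⟨β, ?_⟩, Subtype.ext hφ⟩
  rw [MonoidHom.mem_ker]
  ext1 k
  refine isConj_loop_castSucc ((artinAction_isConj β k).trans ?_)
  rw [hφ]
  exact (φ.2 k.castSucc).symm

theorem capping_surjective : Function.Surjective capping := by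
  intro x
  obtain ⟨φ, rfl⟩ := QuotientGroup.mk'_surjective _ x
  obtain ⟨c, hc⟩ := isConj_iff.mp (φ.2 (Fin.last 4))
  have hin (k) : IsConj (loop k : SpherePi 5) (MulAut.conj c⁻¹ (loop k)) :=
    isConj_iff.mpr ⟨c⁻¹, rfl⟩
  let ι : PureAut 5 := ⟨MulAut.conj c⁻¹, hin⟩
  obtain ⟨p, hp⟩ := exists_artinPure_eq (ι * φ) (by
    change c⁻¹ * φ.1 (loop (Fin.last 4)) * c⁻¹⁻¹ = _
    rw [← hc]
    group)
  refine ⟨p, ?_⟩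
  have hι : QuotientGroup.mk' (InnerAut 5) ι = 1 :=
    (QuotientGroup.eq_one_iff _).mpr ⟨c⁻¹, rfl⟩
  change QuotientGroup.mk' (InnerAut 5) (artinPure p) = _
  rw [hp, map_mul, hι, one_mul]

theorem capping_eq_one_iff {p : P4} : capping p = 1 ↔ p ∈ Subgroup.center P4 := by
  constructor
  · intro h
    obtain ⟨c, hc⟩ := (QuotientGroup.eq_one_iff _).mp h
    have hc' (x : SpherePi 5) : artinAction p x = c * x * c⁻¹ := (DFunLike.congr_fun hc x).symm
    -- An inner automorphism that fixes the last loop is the conjugation by one of its powers.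
    have h4 := hc' (loop (Fin.last 4))
    rw [artinAction_last, eq_mul_inv_iff_mul_eq] at h4
    obtain ⟨m, hm⟩ := mem_zpowers_loop_of_commute (3 : Fin 4) c h4.symm
    have hfill : fillPuncture 4 c = 1 := by
      have h1 : fillPuncture 4 (loop (Fin.succ 3)) = 1 := fillPuncture_last
      rw [← hm, map_zpow, h1, one_zpow]
    apply mem_center_P4_of_artinFill
    apply Subtype.ext
    ext y
    obtain ⟨x, rfl⟩ := fillPuncture_surjective 4 y
    rw [artinFill_fill, hc', map_mul, map_mul, map_inv, hfill]
    simp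
  · intro h
    obtain ⟨m, rfl⟩ := mem_center_P4_iff_zpow.mp h
    have h1 : capping fullTwistP4 = 1 :=
      (QuotientGroup.eq_one_iff _).mpr ⟨_, artinAction_fullTwist4.symm⟩
    rw [map_zpow, h1, one_zpow]

/-- The isomorphism of `K₄` with the pure mapping class group of the five-punctured sphere. -/
noncomputable def K4EquivPMod : K4 ≃* PMod 5 :=
  MulEquiv.ofBijective
    (QuotientGroup.lift _ capping fun _ hp => capping_eq_one_iff.mpr hp)
    ⟨(injective_iff_map_eq_one _).mpr fun x => by
      obtain ⟨p, rfl⟩ := QuotientGroup.mk'_surjective _ x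
      exact fun h => (QuotientGroup.eq_one_iff _).mpr (capping_eq_one_iff.mp h),
    fun y => by
      obtain ⟨p, hp⟩ := capping_surjective y
      exact ⟨toK4 p, hp⟩⟩

theorem K4EquivPMod_mk (p : P4) : K4EquivPMod (toK4 p) = capping p := rfl

/-- The point pushes are the elements of the point-pushing subgroup: if a pure braid acts on
`π₁(S_{0,4})` by an inner automorphism, then a push acts on it by the same automorphism. -/
theorem range_pushK4_eq_comap_pointPush :
    pushK4.range = (pointPush 4).comap K4EquivPMod.toMonoidHom := by
  ext x
  obtain ⟨p, rfl⟩ := QuotientGroup.mk'_surjective _ x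
  have h1 : toK4 p ∈ (pointPush 4).comap K4EquivPMod.toMonoidHom ↔ artinFill p ∈ InnerAut 4 :=
    QuotientGroup.eq_one_iff _
  rw [h1]
  constructor
  · rintro ⟨y, hy⟩
    obtain ⟨x, rfl⟩ := fillPuncture_surjective 4 y
    rw [pushK4_fill] at hy
    have h2 := artinFill_of_mem_center (QuotientGroup.eq.mp hy)
    rw [map_mul, map_inv, inv_mul_eq_one] at h2
    exact ⟨fillPuncture 4 x, by rw [← h2]; exact (artinFill_pushP4 x).symm⟩
  · rintro ⟨y, hy⟩
    obtain ⟨x, rfl⟩ := fillPuncture_surjective 4 y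
    refine ⟨fillPuncture 4 x, ?_⟩
    rw [pushK4_fill]
    refine QuotientGroup.eq.mpr (mem_center_P4_of_artinFill ?_)
    rw [map_mul, map_inv, inv_mul_eq_one]
    exact Subtype.ext ((artinFill_pushP4 x).trans hy)

/-! ### Nielsen reduced families in a free group -/

namespace FreeGroup

variable {α β : Type*}

section

variable [DecidableEq α]

/-- The cancellation in a product of two elements of a free group. -/
theorem exists_cancel (x y : FreeGroup α) : ∃ s d t, x.toWord = s ++ invRev d ∧
    y.toWord = d ++ t ∧ (x * y).toWord = s ++ t ∧ x * y = mk s * mk t := by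
  obtain ⟨d, s, t, hs, ht, hst⟩ := List.exists_common_prefix x⁻¹.toWord y.toWord
  have hs1 : IsReduced s := isReduced_toWord.infix ⟨d, [], by rw [List.append_nil, ← hs]⟩
  have ht1 : IsReduced t := isReduced_toWord.infix ⟨d, [], by rw [List.append_nil, ← ht]⟩
  have hx : x.toWord = invRev s ++ invRev d := by
    rw [← invRev_append, ← hs, toWord_inv, invRev_invRev]
  have e : x * y = mk (invRev s ++ t) := by
    rw [← mk_toWord (x := x), ← mk_toWord (x := y), hx, ht, ← mul_mk, ← mul_mk, ← mul_mk,
      ← inv_mk, ← inv_mk]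
    group
  refine ⟨invRev s, d, t, hx, ht, ?_, by rw [e, mul_mk]⟩
  rw [e, toWord_mk, (hs1.invRev_append ht1 hst).reduce_eq]

theorem norm_lt_norm_mul_self {x : FreeGroup α} (hx : x ≠ 1) : x.norm < (x * x).norm := by
  obtain ⟨s, d, t, h1, h2, h3, -⟩ := exists_cancel x x
  by_contra h
  have e1 := congrArg List.length h1
  have e2 := congrArg List.length h2
  have e3 := congrArg List.length h3
  simp only [List.length_append, invRev_length] at e1 e2 e3
  simp only [norm] at h
  -- The prefix `d` of `x` is at least as long as the prefix `s`, so `x = s d⁻¹` cancels.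
  obtain ⟨c, rfl⟩ : s <+: d :=
    List.prefix_of_prefix_length_le ⟨_, h1.symm⟩ ⟨_, h2.symm⟩ (by omega)
  have hc : invRev c = c := by
    rw [h2, invRev_append, List.append_assoc, ← List.append_assoc] at h1
    rw [← List.append_assoc] at h1
    exact (List.append_inj_left (by simpa using h1) (by simp)).symm
  have hc2 : (mk c)⁻¹ = mk c := by rw [inv_mk, hc]
  have hx2 : x * x = 1 := by
    rw [← mk_toWord (x := x), h1, ← mul_mk, ← inv_mk, ← mul_mk, mul_inv_rev, hc2]
    calc _ = mk s * (mk c * mk c) * (mk s)⁻¹ := by group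
      _ = 1 := by nth_rewrite 1 [← hc2]; group
  exact hx (by simpa [← sq, pow_eq_one_iff] using hx2)

end

/-- The letter `(i, true)` stands for `y i` and the letter `(i, false)` for its inverse. -/
def letterVal (y : β → FreeGroup α) (p : β × Bool) : FreeGroup α :=
  lift y (mk [p])

theorem lift_mk_cons (y : β → FreeGroup α) (p : β × Bool) (l : List (β × Bool)) :
    lift y (mk (p :: l)) = letterVal y p * lift y (mk l) := by
  rw [letterVal, ← _root_.map_mul, mul_mk]; rfl

variable [DecidableEq α]

/-- A Nielsen reduced family: a product of three consecutive letters of a reduced word does not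
cancel the middle one completely. -/
structure IsNielsenReduced (y : β → FreeGroup α) : Prop where
  ne_one : ∀ p, letterVal y p ≠ 1
  norm_le_left : ∀ p q, IsReduced [p, q] →
    (letterVal y p).norm ≤ (letterVal y p * letterVal y q).norm
  norm_le_right : ∀ p q, IsReduced [p, q] →
    (letterVal y q).norm ≤ (letterVal y p * letterVal y q).norm
  norm_lt : ∀ p q r, IsReduced [p, q, r] → (letterVal y p).norm + (letterVal y r).norm <
    (letterVal y p * letterVal y q).norm + (letterVal y q * letterVal y r).norm

theorem IsNielsenReduced.exists_toWord {y : β → FreeGroup α} (hy : IsNielsenReduced y)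
    (p : β × Bool) (l : List (β × Bool)) (h : IsReduced (p :: l)) :
    ∃ s e R, (letterVal y p).toWord = s ++ e ∧ (lift y (FreeGroup.mk (p :: l))).toWord = s ++ R ∧
      l.length ≤ R.length ∧ (l = [] → e = []) ∧ ∀ q ∈ l.head?,
        2 * e.length + (letterVal y p * letterVal y q).norm =
          (letterVal y p).norm + (letterVal y q).norm := by
  induction l generalizing p with
  | nil => exact ⟨_, [], [], (List.append_nil _).symm, by rw [List.append_nil]; rfl, by simp⟩
  | cons q l ih =>
    have hpq : IsReduced [p, q] := h.infix ⟨[], l, by simp⟩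
    obtain ⟨s, e, R, h1, h2, h3, h4, h5⟩ := ih q (h.infix ⟨[p], [], by simp⟩)
    obtain ⟨s', d, t, g1, g2, g3, -⟩ := exists_cancel (letterVal y p) (letterVal y q)
    have hq := hy.ne_one q
    replace hq := mt norm_eq_zero.mp hq
    have n1 := congrArg List.length g1
    have n2 := congrArg List.length g2
    have n3 := congrArg List.length g3
    have n4 := congrArg List.length h1
    simp only [List.length_append, invRev_length] at n1 n2 n3 n4
    have hle := hy.norm_le_left p q hpq
    have hds : d.length < s.length := by
      rcases l with _ | ⟨r, l⟩
      · rw [h4 rfl] at n4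
        simp only [norm, List.length_nil] at *
        omega
      · have := h5 r (by simp)
        have := hy.norm_lt p q r (h.infix ⟨[], l, by simp⟩)
        simp only [norm] at *
        omega
    obtain ⟨c, rfl⟩ : d <+: s :=
      List.prefix_of_prefix_length_le ⟨_, g2.symm⟩ ⟨_, h1.symm⟩ hds.le
    have hc : c ≠ [] := by rintro rfl; simp at hds
    have ht : t = c ++ e := by
      rw [g2, List.append_assoc] at h1
      exact List.append_cancel_left h1
    refine ⟨s', invRev d, c ++ R, g1, ?_, ?_, by simp, ?_⟩
    · have hr1 : IsReduced (s' ++ c) :=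
        (g3 ▸ isReduced_toWord : IsReduced (s' ++ t)).infix ⟨[], e, by rw [ht]; simp⟩
      have hr2 : IsReduced (c ++ R) :=
        (h2 ▸ isReduced_toWord : IsReduced (d ++ c ++ R)).infix ⟨d, [], by simp⟩
      have hr := IsReduced.append_overlap hr1 hr2 hc
      have e1 : lift y (FreeGroup.mk (p :: q :: l)) = FreeGroup.mk (s' ++ c ++ R) := by
        rw [lift_mk_cons, ← mk_toWord (x := letterVal y p), g1,
          ← mk_toWord (x := lift y (FreeGroup.mk (q :: l))), h2]
        simp only [← mul_mk, ← inv_mk]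
        group
      rw [e1, toWord_mk, hr.reduce_eq, List.append_assoc]
    · have := List.length_pos_of_ne_nil hc
      simp only [List.length_append, List.length_cons]
      omega
    · intro r hr
      obtain rfl : q = r := by simpa using hr
      simp only [norm, invRev_length]
      omega

/-- A word of length `m` in a Nielsen reduced family has norm at least `m`. -/
theorem IsNielsenReduced.length_le_norm {y : β → FreeGroup α} (hy : IsNielsenReduced y)
    (l : List (β × Bool)) (h : IsReduced l) : l.length ≤ (lift y (FreeGroup.mk l)).norm := by
  rcases l with _ | ⟨p, l⟩
  · simp
  obtain ⟨s, e, R, h1, h2, h3, h4, h5⟩ := hy.exists_toWord p l h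
  have hp := hy.ne_one p
  replace hp := mt norm_eq_zero.mp hp
  have n1 := congrArg List.length h1
  have n2 := congrArg List.length h2
  simp only [List.length_append] at n1 n2
  have : 0 < s.length := by
    rcases l with _ | ⟨q, l⟩
    · rw [h4 rfl] at n1
      simp only [norm, List.length_nil] at *
      omega
    · have := h5 q (by simp)
      have := hy.norm_le_right p q (h.infix ⟨[], l, by simp⟩)
      simp only [norm] at *
      omega
  simp only [norm, List.length_cons]
  omega

theorem IsNielsenReduced.exists_letterVal_eq [DecidableEq β] {y : β → FreeGroup α}
    (hy : IsNielsenReduced y) (hsurj : Function.Surjective (lift y)) (i : α) :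
    ∃ p, letterVal y p = of i := by
  obtain ⟨w, hw⟩ := hsurj (of i)
  have h := hy.length_le_norm w.toWord isReduced_toWord
  rw [mk_toWord, hw, norm_of] at h
  rcases hl : w.toWord with _ | ⟨p, _ | ⟨q, l⟩⟩
  · rw [toWord_eq_nil_iff.mp hl, _root_.map_one] at hw
    exact absurd hw (one_ne_of i)
  · exact ⟨p, by rw [letterVal, ← hl, mk_toWord, hw]⟩
  · rw [hl] at h; simp at h

end FreeGroup

/-! ### Nielsen moves in the free group of rank two -/

namespace FreeGroup

variable {α : Type*}

/-- A relation closed under the Nielsen moves on pairs of elements and under simultaneous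
conjugation. -/
structure IsNielsenClosed (Q : FreeGroup α → FreeGroup α → Prop) : Prop where
  swap : ∀ {x y}, Q x y → Q y x
  inv : ∀ {x y}, Q x y → Q x⁻¹ y
  mul : ∀ {x y}, Q x y → Q (x * y) y
  conj : ∀ {x y} g, Q x y → Q (g * x * g⁻¹) (g * y * g⁻¹)

variable {Q : FreeGroup α → FreeGroup α → Prop} {u v : FreeGroup α}

theorem rel_letterVal (hQ : IsNielsenClosed Q) (huv : Q u v) {p q : Fin 2 × Bool}
    (hpq : p.1 ≠ q.1) : Q (letterVal ![u, v] p) (letterVal ![u, v] q) := by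
  have hvu := hQ.swap huv
  have hinv {x y} (h : Q x y) : Q x y⁻¹ := hQ.swap (hQ.inv (hQ.swap h))
  obtain ⟨i, b⟩ := p
  obtain ⟨j, c⟩ := q
  fin_cases i <;> fin_cases j <;> cases b <;> cases c <;>
    first
    | exact absurd rfl hpq
    | simp [letterVal]
  all_goals first | exact huv | exact hvu | exact hinv huv | exact hinv hvu | exact hQ.inv huv |
    exact hQ.inv hvu | exact hQ.inv (hinv huv) | exact hQ.inv (hinv hvu)

theorem letterVal_eq_or {β : Type*} (y : β → FreeGroup α) {p q : β × Bool} (h : p.1 = q.1) :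
    letterVal y p = letterVal y q ∨ letterVal y q = (letterVal y p)⁻¹ := by
  obtain ⟨i, b⟩ := p
  obtain ⟨j, c⟩ := q
  obtain rfl : i = j := h
  cases b <;> cases c <;> simp [letterVal]

variable [DecidableEq α]

theorem norm_letterVal (i : Fin 2) (b c : Bool) :
    (letterVal ![u, v] (i, b)).norm = (letterVal ![u, v] (i, c)).norm := by
  cases b <;> cases c <;> simp [letterVal]

/-- Nielsen's theorem in rank two: a pair of minimal total norm among those obtained by
Nielsen moves and conjugations is Nielsen reduced. -/
theorem isNielsenReduced_of_minimal (hQ : IsNielsenClosed Q) (huv : Q u v) (hu : u ≠ 1)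
    (hv : v ≠ 1) (hmin : ∀ x y, Q x y → u.norm + v.norm ≤ x.norm + y.norm) :
    IsNielsenReduced ![u, v] := by
  have hne (p) : letterVal ![u, v] p ≠ 1 := by
    obtain ⟨i, b⟩ := p
    fin_cases i <;> cases b <;> simp [letterVal, hu, hv]
  have hsum {p q : Fin 2 × Bool} (hpq : p.1 ≠ q.1) : (letterVal ![u, v] p).norm +
      (letterVal ![u, v] q).norm = u.norm + v.norm := by
    obtain ⟨i, b⟩ := p
    obtain ⟨j, c⟩ := q
    rw [norm_letterVal i b true, norm_letterVal j c true]
    fin_cases i <;> fin_cases j <;>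
      first
      | exact absurd rfl hpq
      | simp [letterVal]
    omega
  have hcases {p q : Fin 2 × Bool} (h : IsReduced [p, q]) : p = q ∨ p.1 ≠ q.1 := by
    by_cases h1 : p.1 = q.1
    · exact Or.inl (Prod.ext h1 ((isReduced_cons_cons.mp h).1 h1))
    · exact Or.inr h1
  have hmul {p q : Fin 2 × Bool} (hpq : p.1 ≠ q.1) : (letterVal ![u, v] p).norm ≤
      (letterVal ![u, v] p * letterVal ![u, v] q).norm := by
    have h1 := hmin _ _ (hQ.mul (rel_letterVal hQ huv hpq))
    have h2 := hsum hpq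
    omega
  have hmul' {p q : Fin 2 × Bool} (hpq : p.1 ≠ q.1) : (letterVal ![u, v] q).norm ≤
      (letterVal ![u, v] p * letterVal ![u, v] q).norm := by
    have h0 := rel_letterVal hQ huv hpq
    have h1 := hmin _ _ (hQ.mul (hQ.inv (hQ.swap (hQ.inv h0))))
    have h2 := hsum hpq
    rw [← mul_inv_rev, norm_inv_eq, norm_inv_eq] at h1
    omega
  have hleft (p q : Fin 2 × Bool) (h : IsReduced [p, q]) : (letterVal ![u, v] p).norm ≤
      (letterVal ![u, v] p * letterVal ![u, v] q).norm := by
    rcases hcases h with rfl | h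
    · exact (norm_lt_norm_mul_self (hne p)).le
    · exact hmul h
  have hright (p q : Fin 2 × Bool) (h : IsReduced [p, q]) : (letterVal ![u, v] q).norm ≤
      (letterVal ![u, v] p * letterVal ![u, v] q).norm := by
    rcases hcases h with rfl | h
    · exact (norm_lt_norm_mul_self (hne p)).le
    · exact hmul' h
  refine ⟨hne, hleft, hright, fun p q r h => ?_⟩
  have hpq : IsReduced [p, q] := h.infix ⟨[], [r], by simp⟩
  have hqr : IsReduced [q, r] := h.infix ⟨[p], [], by simp⟩
  have l1 := hleft p q hpq
  have l2 := hright p q hpq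
  have l3 := hleft q r hqr
  have l4 := hright q r hqr
  have hq := hne q
  rcases hcases hpq with rfl | hpq
  · have := norm_lt_norm_mul_self hq
    omega
  rcases hcases hqr with rfl | hqr
  · have := norm_lt_norm_mul_self hq
    omega
  by_contra hlt
  have hxz := letterVal_eq_or ![u, v] (p := p) (q := r) (by omega)
  have h0 := rel_letterVal hQ huv hpq
  have hs := hsum hpq
  generalize letterVal ![u, v] p = x at *
  generalize letterVal ![u, v] q = y at *
  generalize letterVal ![u, v] r = z at *
  -- Here `y = d w⁻¹`, where the two halves cancel in `x * y` and in `y * z`.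
  obtain ⟨s, d, t, x1, y1, xy1, -⟩ := exists_cancel x y
  obtain ⟨s', w, t', y2, z1, yz1, -⟩ := exists_cancel y z
  have e1 := congrArg List.length x1
  have e2 := congrArg List.length y1
  have e3 := congrArg List.length xy1
  have e4 := congrArg List.length y2
  have e5 := congrArg List.length z1
  have e6 := congrArg List.length yz1
  simp only [List.length_append, invRev_length] at e1 e2 e3 e4 e5 e6
  simp only [norm] at hlt l1 l2 l3 l4
  obtain ⟨rfl, rfl⟩ := List.append_inj (y1.symm.trans y2) (by omega)
  have hd : d ≠ [] := by
    rintro rfl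
    simp only [List.length_nil] at *
    exact hq (toWord_eq_nil_iff.mp (List.eq_nil_of_length_eq_zero (by omega)))
  have hdl := List.length_pos_of_ne_nil hd
  have ey : y = mk d * (mk w)⁻¹ := by rw [inv_mk, mul_mk, ← y1, mk_toWord]
  rcases hxz with rfl | rfl
  · -- Then `x = w m d⁻¹`, and conjugating `(y * x, y)` by `d` gives the shorter pair `(m, w⁻¹ d)`.
    obtain ⟨m, rfl⟩ : w <+: s :=
      List.prefix_of_prefix_length_le ⟨_, z1.symm⟩ ⟨_, x1.symm⟩ (by omega)
    have ex : x = mk w * mk m * (mk d)⁻¹ := by rw [inv_mk, mul_mk, mul_mk, ← x1, mk_toWord]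
    have h1 := hQ.swap (hQ.inv (hQ.swap (hQ.inv (hQ.mul (hQ.swap (hQ.inv (hQ.swap (hQ.inv h0))))))))
    have h2 := hmin _ _ (hQ.conj (mk d)⁻¹ h1)
    have f1 : (mk d)⁻¹ * (x⁻¹ * y⁻¹)⁻¹ * (mk d)⁻¹⁻¹ = mk m := by rw [ex, ey]; group
    have f2 : (mk d)⁻¹ * y⁻¹⁻¹ * (mk d)⁻¹⁻¹ = mk (invRev w ++ d) := by
      rw [ey, ← mul_mk, ← inv_mk]; group
    rw [f1, f2] at h2
    have f3 := norm_mk_le (L₁ := m)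
    have f4 := norm_mk_le (L₁ := invRev w ++ d)
    simp only [List.length_append, invRev_length] at f4 e1
    simp only [norm] at *
    omega
  · -- Then `d` and `w` are prefixes of `z` of the same length.
    rw [toWord_inv, x1, invRev_append, invRev_invRev] at z1
    obtain ⟨rfl, -⟩ := List.append_inj z1 (by omega)
    rw [mul_inv_cancel] at ey
    exact hq ey

end FreeGroup

/-! ### The image of the braid group in `Aut(F₂)` -/

section

local notation "a" => (FreeGroup.of 0 : F2)
local notation "b" => (FreeGroup.of 1 : F2)

/-- The automorphism of `F₂` that exchanges the two letters. -/
def swapF2 : MulAut F2 :=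
  autF2 b a b a (endF2_b _ _) (endF2_a _ _) (endF2_b _ _) (endF2_a _ _)

/-- The automorphism of `F₂` that inverts the first letter. -/
def invF2 : MulAut F2 :=
  autF2 a⁻¹ b a⁻¹ b (by simp) (by simp) (by simp) (by simp)

/-- The automorphism of `F₂` that multiplies the first letter by the second one. -/
def mulF2 : MulAut F2 :=
  autF2 (a * b) b (a * b⁻¹) b (by simp) (by simp) (by simp) (by simp)

@[simp] theorem swapF2_a : swapF2 a = b := by simp [swapF2, autF2]
@[simp] theorem swapF2_b : swapF2 b = a := by simp [swapF2, autF2]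
@[simp] theorem invF2_a : invF2 a = a⁻¹ := by simp [invF2, autF2]
@[simp] theorem invF2_b : invF2 b = b := by simp [invF2, autF2]
@[simp] theorem mulF2_a : mulF2 a = a * b := by simp [mulF2, autF2]
@[simp] theorem mulF2_b : mulF2 b = b := by simp [mulF2, autF2]

/-- Nielsen's generators of `Aut(F₂)`. -/
theorem eq_top_of_nielsen_mem {N : Subgroup (MulAut F2)} (hs : swapF2 ∈ N) (hi : invF2 ∈ N)
    (hm : mulF2 ∈ N) (hc : ∀ x, MulAut.conj x ∈ N) : N = ⊤ := by
  rw [eq_top_iff]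
  intro φ _
  let Q : F2 → F2 → Prop := fun x y => ∃ ψ ∈ N, φ (ψ a) = x ∧ φ (ψ b) = y
  have hQ : FreeGroup.IsNielsenClosed Q := by
    refine ⟨?_, ?_, ?_, ?_⟩
    · rintro _ _ ⟨ψ, hψ, rfl, rfl⟩
      exact ⟨ψ * swapF2, mul_mem hψ hs, by simp, by simp⟩
    · rintro _ _ ⟨ψ, hψ, rfl, rfl⟩
      exact ⟨ψ * invF2, mul_mem hψ hi, by simp, by simp⟩
    · rintro _ _ ⟨ψ, hψ, rfl, rfl⟩
      exact ⟨ψ * mulF2, mul_mem hψ hm, by simp, by simp⟩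
    · rintro _ _ g ⟨ψ, hψ, rfl, rfl⟩
      exact ⟨MulAut.conj (φ⁻¹ g) * ψ, mul_mem (hc _) hψ, by simp, by simp⟩
  obtain ⟨⟨ψ, hψ⟩, -, hmin⟩ := (measure fun ψ : N =>
    (φ (ψ.1 a)).norm + (φ (ψ.1 b)).norm).wf.has_min Set.univ ⟨1, Set.mem_univ _⟩
  have huv : Q (φ (ψ a)) (φ (ψ b)) := ⟨ψ, hψ, rfl, rfl⟩
  have hne (i : Fin 2) : φ (ψ (FreeGroup.of i)) ≠ 1 := by simp
  have hred := FreeGroup.isNielsenReduced_of_minimal hQ huv (hne 0) (hne 1) (by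
    rintro _ _ ⟨χ, hχ, rfl, rfl⟩
    exact not_lt.mp (hmin ⟨χ, hχ⟩ (Set.mem_univ _)))
  have hlift : FreeGroup.lift ![φ (ψ a), φ (ψ b)] = (φ * ψ).toMonoidHom := by
    ext i
    fin_cases i <;> simp
  have hsurj : Function.Surjective (FreeGroup.lift ![φ (ψ a), φ (ψ b)]) := by
    rw [hlift]; exact (φ * ψ).surjective
  obtain ⟨p, hp⟩ := hred.exists_letterVal_eq hsurj 0
  obtain ⟨q, hq⟩ := hred.exists_letterVal_eq hsurj 1
  have hpq : p.1 ≠ q.1 := by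
    intro h
    have h1 := FreeGroup.letterVal_eq_or ![φ (ψ a), φ (ψ b)] h
    rw [hp, hq] at h1
    revert h1
    decide
  obtain ⟨χ, hχ, h0, h1⟩ := FreeGroup.rel_letterVal hQ huv hpq
  rw [hp] at h0
  rw [hq] at h1
  have : φ * χ = 1 := MulAut.ext_F2 h0 h1
  rw [mul_eq_one_iff_eq_inv.mp this]
  exact inv_mem hχ

theorem mulF2_mem_range : mulF2 ∈ braidAut.range := by
  refine ⟨(sig 2)⁻¹ * sig 1 * sig 2, MulAut.ext_F2 ?_ ?_⟩ <;> simp [braidAut_sig, mul_assoc]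

theorem invF2_mul_swapF2_mem_range : invF2 * swapF2 ∈ braidAut.range := by
  refine ⟨(sig 2)⁻¹ * sig 1 * sig 2 * sig 1 * sig 0, MulAut.ext_F2 ?_ ?_⟩ <;>
    simp [braidAut_sig, mul_assoc]

theorem swapF2_mul_self : swapF2 * swapF2 = 1 := by
  refine MulAut.ext_F2 ?_ ?_ <;> simp

/-- The exchange of the letters normalizes the image of the braid group. -/
theorem swapF2_conj_mem {φ : MulAut F2} (h : φ ∈ braidAut.range) :
    swapF2 * φ * swapF2 ∈ braidAut.range := by
  have hi : swapF2⁻¹ = swapF2 := inv_eq_of_mul_eq_one_left swapF2_mul_self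
  obtain ⟨β, rfl⟩ := h
  have := braid_induction ((braidAut.range).comap ((MulAut.conj swapF2).toMonoidHom.comp braidAut))
    (fun j => ?_) β
  · have h2 : swapF2 * braidAut β * swapF2⁻¹ ∈ braidAut.range := this
    rwa [hi] at h2
  · change swapF2 * braidAut (sig j) * swapF2⁻¹ ∈ braidAut.range
    rw [hi]
    fin_cases j
    · refine ⟨((sig 2)⁻¹ * sig 1 * sig 2)⁻¹, MulAut.ext_F2 ?_ ?_⟩ <;> simp [braidAut_sig, mul_assoc]
    · refine ⟨(sig 1)⁻¹, MulAut.ext_F2 ?_ ?_⟩ <;> simp [braidAut_sig, mul_assoc]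
    · refine ⟨((sig 0)⁻¹ * sig 1 * sig 0)⁻¹, MulAut.ext_F2 ?_ ?_⟩ <;> simp [braidAut_sig, mul_assoc]

theorem mem_range_braidAut_or (φ : MulAut F2) :
    φ ∈ braidAut.range ∨ φ * swapF2 ∈ braidAut.range := by
  let N : Subgroup (MulAut F2) :=
    { carrier := {φ | φ ∈ braidAut.range ∨ φ * swapF2 ∈ braidAut.range}
      one_mem' := Or.inl (one_mem _)
      mul_mem' := by
        have e (φ ψ : MulAut F2) : φ * swapF2 * (swapF2 * ψ) = φ * ψ := by
          rw [mul_assoc, ← mul_assoc swapF2, swapF2_mul_self, one_mul]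
        rintro φ ψ (h1 | h1) (h2 | h2)
        · exact Or.inl (mul_mem h1 h2)
        · exact Or.inr (by rw [mul_assoc]; exact mul_mem h1 h2)
        · refine Or.inr ?_
          have := mul_mem h1 (swapF2_conj_mem h2)
          rwa [mul_assoc swapF2, e, ← mul_assoc] at this
        · refine Or.inl ?_
          have := mul_mem h1 (swapF2_conj_mem h2)
          rwa [mul_assoc swapF2, e, mul_assoc ψ, swapF2_mul_self, mul_one] at this
      inv_mem' := by
        rintro φ (h | h)
        · exact Or.inl (inv_mem h)
        · refine Or.inr ?_
          have := swapF2_conj_mem (inv_mem h)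
          rwa [mul_inv_rev, ← mul_assoc, mul_inv_cancel, one_mul] at this }
  have hN : N = ⊤ := by
    refine eq_top_of_nielsen_mem (Or.inr ?_) (Or.inr ?_) (Or.inl mulF2_mem_range)
      fun x => Or.inl ⟨freeToB4 x, braidAut_freeToB4 x⟩
    · rw [swapF2_mul_self]; exact one_mem _
    · exact invF2_mul_swapF2_mem_range
  have : φ ∈ N := hN ▸ Subgroup.mem_top φ
  exact this

/-- Braids act on the abelianization of `F₂` with determinant `1`. -/
theorem det_linearAction (β : B3) (v w : ℤ × ℤ) :
    (linearAction β v).1 * (linearAction β w).2 - (linearAction β v).2 * (linearAction β w).1 =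
      v.1 * w.2 - v.2 * w.1 := by
  let H : Subgroup B3 :=
    { carrier := {β | ∀ v w, (linearAction β v).1 * (linearAction β w).2 -
        (linearAction β v).2 * (linearAction β w).1 = v.1 * w.2 - v.2 * w.1}
      one_mem' := by intro v w; simp
      mul_mem' := by
        intro β γ hβ hγ v w
        rw [map_mul, LinearEquiv.mul_apply, LinearEquiv.mul_apply, hβ, hγ]
      inv_mem' := by
        intro β hβ v w
        have e (v) : linearAction β ((linearAction β)⁻¹ v) = v := by
          rw [← LinearEquiv.mul_apply, mul_inv_cancel]; rfl
        have := hβ ((linearAction β)⁻¹ v) ((linearAction β)⁻¹ w)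
        rw [e, e] at this
        rw [map_inv, ← this] }
  refine braid_induction H (fun j v w => ?_) β v w
  fin_cases j
  · simp only [Fin.zero_eta, linearAction_sig_zero]; ring
  · simp only [Fin.mk_one, linearAction_sig_one]; ring

theorem swapF2_not_mem_range : swapF2 ∉ braidAut.range := by
  rintro ⟨β, hβ⟩
  have h0 := abF2_braidAut β a
  have h1 := abF2_braidAut β b
  rw [hβ, swapF2_a] at h0
  rw [hβ, swapF2_b] at h1
  have h := det_linearAction (cardanoFerrariB4 β) (abF2 a).toAdd (abF2 b).toAdd
  rw [← h0, ← h1] at h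
  simp [abF2] at h

theorem index_range_braidAut : braidAut.range.index = 2 := by
  rw [Subgroup.index_eq_two_iff]
  refine ⟨swapF2, fun φ => ?_⟩
  rcases mem_range_braidAut_or φ with h | h
  · refine Or.inr ⟨h, fun h2 => swapF2_not_mem_range ?_⟩
    simpa using mul_mem (inv_mem h) h2
  · refine Or.inl ⟨h, fun h2 => swapF2_not_mem_range ?_⟩
    simpa using mul_mem (inv_mem h2) h

theorem index_range_K4ToAut : K4ToAut.range.index = 48 := by
  have h1 : K4ToAut.range = P4.map braidAut := by
    ext φ
    constructor
    · rintro ⟨x, rfl⟩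
      obtain ⟨p, rfl⟩ := QuotientGroup.mk'_surjective _ x
      exact ⟨p, p.2, rfl⟩
    · rintro ⟨p, hp, rfl⟩
      exact ⟨toK4 ⟨p, hp⟩, rfl⟩
  have hk : braidAut.ker ≤ P4 := by
    intro β hβ
    obtain ⟨n, rfl⟩ := braidAut_eq_one_iff.mp hβ
    exact zpow_mem fullTwistP4.2 n
  have h2 : P4.index = 24 := by
    rw [Subgroup.index_ker, MonoidHom.range_eq_top.mpr exists_braidPerm_eq, Subgroup.card_top,
      Nat.card_eq_fintype_card, Fintype.card_perm]
    rfl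
  rw [h1, Subgroup.index_map, sup_eq_left.mpr hk, h2, index_range_braidAut]

end

theorem theorem1p2 :
    -- `K₄` is a subgroup of index `48` of `Aut(F₂)`, through the conjugation action of `B₄`
    (∃ ι : K4 →* MulAut F2, (∀ p : P4, ι (toK4 p) = braidAut p) ∧
      Function.Injective ι ∧ ι.range.index = 48) ∧
    -- five extensions `1 → F₃ → K₄ → F₂ → 1`
    ∃ E : Fin 5 → GroupExtension (FreeGroup (Fin 3)) K4 F2,
      -- the fibers are distinct normal subgroups, and any two of them generate `K₄`
      (∀ i, (E i).inl.range.Normal) ∧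
      (∀ i j, i ≠ j → (E i).inl.range ≠ (E j).inl.range) ∧
      (∀ i j, i ≠ j → (E i).inl.range ⊔ (E j).inl.range = ⊤) ∧
      (∃ e : K3 ≃* F2,
        -- the first four are induced by the strand-forgetting maps
        (∀ i : Fin 4, (E i.castSucc).inl.range = (strandForget i).ker.map toK4 ∧
          ∀ p : P4, (E i.castSucc).rightHom (toK4 p) = e (toK3 (strandForget i p))) ∧
        -- the fifth is induced by the Cardano–Ferrari epimorphism
        ∀ p : P4, (E (Fin.last 4)).rightHom (toK4 p) = e (toK3 (cardanoFerrari p))) ∧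
      -- the image in `K₄` of the kernel of the Cardano–Ferrari epimorphism has index two
      -- in the fifth fiber
      cardanoFerrari.ker.map toK4 ≤ (E (Fin.last 4)).inl.range ∧
      (cardanoFerrari.ker.map toK4).relIndex (E (Fin.last 4)).inl.range = 2 ∧
      -- the fifth fiber is the point-pushing subgroup of `PMod(S_{0,5})`
      ∃ Φ : K4 ≃* PMod 5, (∀ p : P4, Φ (toK4 p) = capping p) ∧
        (E (Fin.last 4)).inl.range = (pointPush 4).comap Φ.toMonoidHom := by
  refine ⟨⟨K4ToAut, K4ToAut_mk, K4ToAut_injective, index_range_K4ToAut⟩, ?_⟩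
  choose E hE hEr using exists_strandExtension
  obtain ⟨E', hE', hEr'⟩ := exists_pushExtension
  let F : Fin 5 → GroupExtension (FreeGroup (Fin 3)) K4 F2 := Fin.lastCases E' E
  have hF (i : Fin 4) : F i.castSucc = E i := Fin.lastCases_castSucc i
  have hF' : F (Fin.last 4) = E' := Fin.lastCases_last
  have hsup (i j) (hij : i ≠ j) : (F i).inl.range ⊔ (F j).inl.range = ⊤ := by
    induction i using Fin.lastCases with
    | last =>
      induction j using Fin.lastCases with
      | last => exact absurd rfl hij
      | cast j => rw [hF, hF', hE, hE', sup_comm, strandFiber_sup_range_pushK4]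
    | cast i =>
      induction j using Fin.lastCases with
      | last => rw [hF, hF', hE, hE', strandFiber_sup_range_pushK4]
      | cast j => rw [hF, hF, hE, hE, strandFiber_sup fun h => hij (congrArg _ h)]
  refine ⟨F, fun i => ?_, fun i j hij h => ?_, hsup, ⟨freeToK3.symm, fun i => ?_, fun p => ?_⟩, ?_⟩
  · rw [GroupExtension.range_inl_eq_ker_rightHom]
    infer_instance
  · -- Otherwise one fiber would be all of `K₄`, and its quotient `F₂` would be trivial.
    have h1 := hsup i j hij
    rw [← h, sup_idem, GroupExtension.range_inl_eq_ker_rightHom, MonoidHom.ker_eq_top_iff] at h1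
    obtain ⟨x, hx⟩ := (F i).rightHom_surjective (FreeGroup.of 0)
    rw [h1] at hx
    exact FreeGroup.one_ne_of _ hx
  · rw [hF, hE, hEr]
    exact ⟨rfl, fun p => rfl⟩
  · rw [hF', hEr']
    rfl
  · rw [hF', hE']
    exact ⟨map_ker_cardanoFerrari_le, relIndex_map_ker_cardanoFerrari, K4EquivPMod, K4EquivPMod_mk,
      range_pushK4_eq_comap_pointPush⟩
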